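/- **Ford's Lemma, algebraic case.** For $s_0\in\mathbb C$ and $|\omega|<\pi/2$ let $L(s_0,\omega)=\{s_0-re^{i\omega}: r\ge 0\}$ be the ray (cut) issuing from $s_0$ at angle $\omega$ with the negative real axis. Powers of $s-s_0$ off this ray are formed with the branch of $\log(s-s_0)$ that is real for $s-s_0>0$. A function $\phi$ has a singularity of *algebraic type* $(\lambda,\theta,\psi)$ at $s_0$ (with this cut) if $$\phi(s)=(s-s_0)^{-\lambda}\,\psi\bigl((s-s_0)^{\theta}\bigr)$$ in a neighbourhood of $s_0$ slit along the cut, where $\lambda,\theta\in\mathbb C$, $\Re\theta>0$, and $\psi(w)=\sum_{k\ge0}p_kw^k$ is analytic at $0$. Let $b_j(s_0)$ denote the coefficients of the Laurent expansion $\frac{\pi}{\sin\pi s}=\sum_{j\ge-1}b_j(s_0)(s-s_0)^j$ at $s_0$. Let $M\ge1$, and let $\phi$ be analytic on $D=\mathbb C\setminus\bigcup_{m=1}^M L(s_m,\omega_m)$ with singularities of algebraic type $(\lambda_m,\theta_m,\psi_m)$ at $s_m$, where $\psi_m(w)=\sum_k p_{m,k}w^k$ and $\omega_m\in(-\frac\pi2,0)\cup(0,\frac\pi2)$.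 Suppose that the cuts $L(s_m,\omega_m)$ are pairwise disjoint and contain no positive integer, and that there are $C>0$ and $A$ with $$|\phi(s)|<Ce^{A|s|}\quad\text{as } |s|\to\infty \text{ in } D,\qquad 0<A<\pi\min_{1\le m\le M}|\sin\omega_m| .$$ Let $1\le N\le M$ be such that $\Re s_1=\dots=\Re s_N>\Re s_m$ for all $m>N$. Put $n_{\max}=-\Re s_1$ if $\Re s_1\in\mathbb Z$ and $s_1,\dots,s_N\notin\mathbb Z$, and $n_{\max}=\lceil-\Re s_1\rceil-1$ otherwise. Then the function $F(z)=\sum_{n\ge1}\phi(n)(-z)^n$, $|z|<e^{-A}$, continues analytically to the sector $|\arg z|<\pi-A$ and, for some $R$, further to $\{|z|>R,\ |\arg z|<\pi\}$; and as $z\to\infty$ in any sector with vertex at $0$ that avoids the negative real axis (uniformly in $|\arg z|<\pi$) it has the asymptotic expansion $$F(z)\sim\sum_{0\le n\le n_{\max}}(-1)^{n+1}\phi(-n)z^{-n}-\sum_{m=1}^N z^{s_m}\sum_{k\ge0,\ j\ge-1}\frac{p_{m,k}\,b_j(s_m)}{\Gamma(-\theta_mk-j+\lambda_m)}(\log z)^{-\theta_mk-j+\lambda_m-1}$$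 with principal branches of $\log z$ and of the powers of $z$ and $\log z$, and with $1/\Gamma=0$ at the poles of $\Gamma$. That is, for every real $K$, if the inner sums are restricted to the finitely many $(k,j)$ with $\Re(\theta_mk+j)<K$, the difference of the two sides is $$O\Bigl(|z|^{\Re s_1}\sum_{m=1}^N|\log z|^{\Re\lambda_m-K-1}\Bigr).$$ -/

import Mathlib

open Filter Topology Asymptotics

noncomputable section

/-- The branch cut issuing from `s₀` at angle `ω` with the negative real axis: the closed ray
`{s₀ - r e^{iω} : r ≥ 0}`. -/
def branchCut (s₀ : ℂ) (ω : ℝ) : Set ℂ :=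
  {s : ℂ | ∃ r : ℝ, 0 ≤ r ∧ s = s₀ - (r : ℂ) * Complex.exp ((ω : ℂ) * Complex.I)}

/-- The logarithm on the plane slit along the ray `{-r e^{iω} : r ≥ 0}`, for `|ω| < π / 2`.  It is
the branch that is real on the positive real axis. -/
def branchLog (ω : ℝ) (w : ℂ) : ℂ :=
  Complex.log (w * Complex.exp (-((ω : ℂ) * Complex.I))) + (ω : ℂ) * Complex.I

/-- The power `w ^ a` for the branch `branchLog ω` of the logarithm. -/
def branchPow (ω : ℝ) (w a : ℂ) : ℂ :=
  Complex.exp (a * branchLog ω w)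

/-- `φ` has a singularity of algebraic type `(lam, θ, ψ)` at `s₀`, the branch cut being at angle
`ω` with the negative real axis. -/
structure HasAlgebraicSingularity (φ : ℂ → ℂ) (s₀ : ℂ) (ω : ℝ) (lam θ : ℂ) (ψ : ℂ → ℂ) :
    Prop where
  re_pos : 0 < θ.re
  analytic : AnalyticAt ℂ ψ 0
  local_expansion : ∀ᶠ s in 𝓝[(branchCut s₀ ω)ᶜ] s₀,
    φ s = branchPow ω (s - s₀) (-lam) * ψ (branchPow ω (s - s₀) θ)

/-- The complex plane without the branch cuts. -/
def slitDomain {M : ℕ} (s : Fin M → ℂ) (ω : Fin M → ℝ) : Set ℂ :=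
  (⋃ m, branchCut (s m) (ω m))ᶜ

/-- The growth condition: `|φ(s)| < C e^{A|s|}` as `|s| → ∞` in `D`, for some `C > 0`. -/
def GrowthOn (φ : ℂ → ℂ) (D : Set ℂ) (A : ℝ) : Prop :=
  ∃ C : ℝ, 0 < C ∧ ∃ r : ℝ, ∀ s ∈ D, r ≤ ‖s‖ → ‖φ s‖ < C * Real.exp (A * ‖s‖)

/-- The coefficient of `(s - c) ^ k` in the Taylor expansion of `f` at `c`. -/
def taylorCoeffAt (f : ℂ → ℂ) (c : ℂ) (k : ℕ) : ℂ :=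
  iteratedDeriv k f c / (k.factorial : ℂ)

/-- The function `(s - s₀) π / sin (π s)`, with its removable singularity at `s₀` removed. -/
def regularizedCsc (s₀ : ℂ) : ℂ → ℂ :=
  Function.update (fun s => (s - s₀) * (Real.pi / Complex.sin (Real.pi * s))) s₀
    (limUnder (𝓝[≠] s₀) fun s => (s - s₀) * (Real.pi / Complex.sin (Real.pi * s)))

/-- The coefficient `b_j(s₀)` of `(s - s₀) ^ j` in the Laurent expansion of `π / sin (π s)` at
`s₀`; the expansion starts at `j = -1`. -/
def cscCoeff (s₀ : ℂ) (j : ℤ) : ℂ :=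
  if j < -1 then 0 else taylorCoeffAt (regularizedCsc s₀) s₀ (j + 1).toNat

/-- The finite set of all `(k, j)` with `k ≥ 0`, `j ≥ -1` and `Re (θ k + j) < K`, if
`Re θ > 0`; see `mem_truncIndex`. -/
def truncIndex (θ : ℂ) (K : ℝ) : Finset (ℕ × ℤ) :=
  (Finset.range ⌈(K + 1) / θ.re⌉₊ ×ˢ Finset.Ico (-1 : ℤ) ⌈K⌉).filter
    fun q => θ.re * (q.1 : ℝ) + (q.2 : ℝ) < K

theorem mem_truncIndex {θ : ℂ} (hθ : 0 < θ.re) (K : ℝ) (k : ℕ) (j : ℤ) :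
    (k, j) ∈ truncIndex θ K ↔ -1 ≤ j ∧ θ.re * (k : ℝ) + (j : ℝ) < K := by
  simp only [truncIndex, Finset.mem_filter, Finset.mem_product, Finset.mem_range, Finset.mem_Ico]
  constructor
  · rintro ⟨⟨_, h, _⟩, h'⟩
    exact ⟨h, h'⟩
  · rintro ⟨h, h'⟩
    have hk : 0 ≤ θ.re * (k : ℝ) := by positivity
    have hj : (-1 : ℝ) ≤ (j : ℝ) := by exact_mod_cast h
    refine ⟨⟨Nat.lt_ceil.2 ?_, h, Int.lt_ceil.2 (by linarith)⟩, h'⟩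
    rw [lt_div_iff₀ hθ]
    linarith

/-- The partial sum over `Re (θ k + j) < K` of the logarithmic series
`∑ p_k b_j(s₀) / Γ(-θ k - j + lam) * (log z) ^ (-θ k - j + lam - 1)`.
In Mathlib `Γ` is `0` at its poles, so that `1 / Γ` is the entire function it should be. -/
def logPartialSum (s₀ lam θ : ℂ) (ψ : ℂ → ℂ) (K : ℝ) (z : ℂ) : ℂ :=
  ∑ q ∈ truncIndex θ K,
    taylorCoeffAt ψ 0 q.1 * cscCoeff s₀ q.2 / Complex.Gamma (-θ * q.1 - q.2 + lam) *
      Complex.log z ^ (-θ * q.1 - q.2 + lam - 1)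

open scoped Classical in
/-- The largest index of the sum of powers of `z`; `σ` is the largest real part of the `s m`, and
the `s m` with `m < N` are those of real part `σ`. In the first case `⌊-σ⌋ = -σ`. -/
def nMax {M : ℕ} (s : Fin M → ℂ) (N : ℕ) (σ : ℝ) : ℤ :=
  if (∃ a : ℤ, σ = a) ∧ ∀ m : Fin M, (m : ℕ) < N → ∀ a : ℤ, s m ≠ a then ⌊-σ⌋
  else ⌈-σ⌉ - 1

/-- The union of the disc `|z| < e^{-A}`, in which the series `∑ φ(n) (-z)^n` converges, the sector
`|arg z| < π - A`, and the part `|z| > R` of the plane slit along the negative real axis. -/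
def continuationDomain (A R : ℝ) : Set ℂ :=
  {z | ‖z‖ < Real.exp (-A)} ∪ {z | z ≠ 0 ∧ |z.arg| < Real.pi - A} ∪
    {z | R < ‖z‖ ∧ z ∈ Complex.slitPlane}

end

noncomputable section

open MeasureTheory Set

/-! Put `L = log z`. Since `π / sin (π s)` has residue `(-1)^n` at each integer `n`, the series is,
up to finitely many terms, `-1/(2πi)` times the integral of `φ(s) (π / sin (π s)) e^{sL}` over an
upward contour just to the right of the line `Re s = σ`. Two shapes of this contour are needed.

If its ends are vertical, the factor `e^{-π |Im s|}` of the cosecant outweighs `e^{A |s|}` and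
`e^{|Im s| |arg z|}` as long as `|arg z| < π - A`, and the integral is holomorphic in that sector.
For `|z| < e^{-A}` the line can be pushed to the right across all integers, and the residues add up
to the power series (`CutPlaneBound.tsum_eq_contourIntegral`).

If its ends are bent to the left, in the directions `±i - κ`, then `|e^{sL}|` behaves along them at
worst like `exp (t (π - κ log |z|))`. For large `|z|` this beats any exponential growth of `φ`,
whatever the argument of `z` (`re_direction_mul_le`). The slope is chosen with `κ ≤ cos ω_m` for all
`m`: then a cone around the right half-plane with vertex `s_m` misses the cut at `s_m`
(`notMem_branchCut`), and contours that start high enough stay inside all these cones. Both contours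
give the same value where both converge (`CutPlaneBound.contourIntegral_rotate`), so the pieces glue
to one continuation (`CutPlaneBound.exists_continuation`).

For the asymptotics, the integrand without `e^{sL}` is expanded at each `s_m` on the line `Re s = σ`
into powers `(s - s_m)^{θk + j - λ}` with coefficients `p_k b_j`. By Hankel's formula
(`contourIntegral_cpow`) the integral of `(s - q)^a e^{sL}` is `2πi e^{qL} L^{-a-1} / Γ(-a)`, which
produces exactly the terms of the expansion. After subtraction of enough powers, and of a simple
pole at `σ` if `σ` is an integer and none of the `s_m`, the remainder has a bounded `n`-th
derivative up to the line (`LineSingularities.rightRegularAt_cscRemainder`). Integrating by parts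
`n` times gains `L^{-n}`, and placing the contour at distance `1 / Re L` from the line costs only a
constant factor. So the remainder contributes `O(|z|^σ |log z|^{-n})`
(`SlantedExpBound.norm_contourIntegral_le`). The bounds use only `|Im L| ≤ π`, hence they are
uniform in `arg z`.

It remains to match the finitely many exceptional terms (`exists_residueSum_eq`). The simple pole at
an integer `σ` contributes `ρ z^σ`, which cancels a residue or supplies one; this is the reason for
the two cases of `nMax`. Powers `z^n` with `0 < n < σ` are absorbed by the error term. -/

/-- Holomorphic dependence of an integral on a parameter, under domination of the integrand. -/
theorem hasDerivAt_integral_of_holomorphic {α : Type*} [MeasurableSpace α] {μ : Measure α}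
    {U : Set ℂ} (hU : IsOpen U) {F : ℂ → α → ℂ} {bound : α → ℝ}
    (hmeas : ∀ p ∈ U, AEStronglyMeasurable (F p) μ)
    (hdiff : ∀ᵐ a ∂μ, DifferentiableOn ℂ (fun p => F p a) U)
    (hbound : ∀ᵐ a ∂μ, ∀ p ∈ U, ‖F p a‖ ≤ bound a) (hint : Integrable bound μ)
    {p : ℂ} (hp : p ∈ U) :
    Integrable (fun a => deriv (fun q => F q a) p) μ ∧
      HasDerivAt (fun q => ∫ a, F q a ∂μ) (∫ a, deriv (fun q => F q a) p ∂μ) p := by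
  obtain ⟨r, hr, hball⟩ := Metric.isOpen_iff.1 hU p hp
  refine hasDerivAt_integral_of_dominated_loc_of_deriv_le (s := Metric.ball p (r / 2))
    (bound := fun a => bound a / (r / 4))
    (F' := fun q a => deriv (fun q => F q a) q) (Metric.ball_mem_nhds p (by positivity)) ?_ ?_ ?_ ?_
    (hint.div_const _) ?_
  · filter_upwards [hU.mem_nhds hp] with q hq using hmeas q hq
  · exact hint.mono' (hmeas p hp) (by filter_upwards [hbound] with a ha using ha p hp)
  -- The derivative is measurable in `a` because it is the limit of the difference quotients with
  -- increments `1 / (n + 1)`. The shift by `N` below keeps `p + 1 / (n + N + 1)` in `U`.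
  · have hlim : Tendsto (fun n : ℕ => ((1 / ((n : ℝ) + 1) : ℝ) : ℂ)) atTop (𝓝[≠] 0) := by
      refine tendsto_nhdsWithin_iff.2 ⟨?_, Eventually.of_forall fun n => ?_⟩
      · simpa [Function.comp_def] using (Complex.continuous_ofReal.tendsto 0).comp
          (tendsto_one_div_add_atTop_nhds_zero_nat (𝕜 := ℝ))
      · simp only [mem_compl_iff, mem_singleton_iff, Complex.ofReal_eq_zero]
        positivity
    have hev : ∀ᶠ n : ℕ in atTop, p + ((1 / ((n : ℝ) + 1) : ℝ) : ℂ) ∈ U := by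
      have h2 : Tendsto (fun n : ℕ => p + ((1 / ((n : ℝ) + 1) : ℝ) : ℂ)) atTop (𝓝 (p + 0)) :=
        tendsto_const_nhds.add (tendsto_nhds_of_tendsto_nhdsWithin hlim)
      rw [add_zero] at h2
      exact h2.eventually (hU.mem_nhds hp)
    obtain ⟨N, hN⟩ := eventually_atTop.1 hev
    refine aestronglyMeasurable_of_tendsto_ae (u := atTop)
      (f := fun (n : ℕ) a => ((1 / (((n + N : ℕ) : ℝ) + 1) : ℝ) : ℂ)⁻¹ •
        (F (p + ((1 / (((n + N : ℕ) : ℝ) + 1) : ℝ) : ℂ)) a - F p a)) ?_ ?_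
    · intro n
      exact ((hmeas _ (hN (n + N) (Nat.le_add_left _ _))).sub (hmeas p hp)).const_smul
        ((1 / (((n + N : ℕ) : ℝ) + 1) : ℝ) : ℂ)⁻¹
    · filter_upwards [hdiff] with a ha
      have := (hasDerivAt_iff_tendsto_slope_zero.1
        ((ha.differentiableAt (hU.mem_nhds hp)).hasDerivAt)).comp hlim
      exact (tendsto_add_atTop_iff_nat N).2 this
  -- Cauchy's estimate on the circle of radius `r / 4` about `q`, which lies in `U` since `q` is
  -- within `r / 2` of `p`.
  · filter_upwards [hbound, hdiff] with a ha hd q hq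
    have hsub : Metric.closedBall q (r / 4) ⊆ U := fun x hx => hball (by
      rw [Metric.mem_closedBall] at hx
      rw [Metric.mem_ball] at hq ⊢
      linarith [dist_triangle x q p])
    exact Complex.norm_deriv_le_of_forall_mem_sphere_norm_le (f := fun q => F q a) (c := q)
      (R := r / 4) (C := bound a) (by positivity)
      (DifferentiableOn.diffContOnCl (hd.mono (by
        rw [closure_ball _ (by positivity)]; exact hsub)))
      (fun z hz => ha z (hsub (Metric.sphere_subset_closedBall hz)))
  · filter_upwards [hdiff] with a hd q hq
    refine (hd.differentiableAt (hU.mem_nhds (hball ?_))).hasDerivAt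
    exact Metric.ball_subset_ball (by linarith) hq

/-! ### Integrals along rays -/

/-- The integral of `f` along the ray from `p` in the direction `u`. -/
def rayIntegral (u : ℂ) (f : ℂ → ℂ) (p : ℂ) : ℂ :=
  ∫ t in Ioi (0 : ℝ), f (p + t * u) * u

/-- `f` is holomorphic on an open set that is invariant under translations in the direction `u`, and
decays exponentially in this direction, locally uniformly. -/
structure RayDecay (u : ℂ) (f : ℂ → ℂ) (U : Set ℂ) : Prop where
  isOpen : IsOpen U
  diff : DifferentiableOn ℂ f U
  ray : ∀ s ∈ U, ∀ t : ℝ, 0 ≤ t → s + t * u ∈ U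
  decay : ∃ (K : ℂ → ℝ) (ε : ℝ), 0 < ε ∧ ContinuousOn K U ∧
    ∀ s ∈ U, ∀ t : ℝ, 0 ≤ t → ‖f (s + t * u)‖ ≤ K s * Real.exp (-ε * t)

namespace RayDecay

variable {u : ℂ} {f g : ℂ → ℂ} {U : Set ℂ}

theorem continuousOn (h : RayDecay u f U) {p : ℂ} (hp : p ∈ U) :
    ContinuousOn (fun t : ℝ => f (p + t * u)) (Ici 0) :=
  h.diff.continuousOn.comp (by fun_prop) fun t ht => h.ray p hp t ht

theorem integrableOn (h : RayDecay u f U) {p : ℂ} (hp : p ∈ U) :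
    IntegrableOn (fun t : ℝ => f (p + t * u)) (Ioi 0) := by
  obtain ⟨K, ε, hε, -, hK⟩ := h.decay
  refine Integrable.mono' ((integrableOn_exp_mul_Ioi (a := -ε) (by linarith) 0).const_mul (K p))
    (((h.continuousOn hp).mono Ioi_subset_Ici_self).aestronglyMeasurable measurableSet_Ioi) ?_
  filter_upwards [ae_restrict_mem measurableSet_Ioi] with t ht using hK p hp t (le_of_lt ht)

theorem tendsto_zero (h : RayDecay u f U) {p : ℂ} (hp : p ∈ U) :
    Tendsto (fun t : ℝ => f (p + t * u)) atTop (𝓝 0) := by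
  obtain ⟨K, ε, hε, -, hK⟩ := h.decay
  have h1 : Tendsto (fun t : ℝ => K p * Real.exp (-ε * t)) atTop (𝓝 0) := by
    have : Tendsto (fun t : ℝ => -ε * t) atTop atBot :=
      tendsto_id.const_mul_atTop_of_neg (by linarith)
    simpa using (Real.tendsto_exp_atBot.comp this).const_mul (K p)
  refine squeeze_zero_norm' ?_ h1
  filter_upwards [eventually_ge_atTop 0] with t ht using hK p hp t ht

/-- Differentiation under the integral sign. The continuity of the constant in `decay` gives one
exponential majorant, with constant `K p + 1`, for all base points near `p`. -/
theorem integrable_deriv_and_hasDerivAt (h : RayDecay u f U) {p : ℂ} (hp : p ∈ U) :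
    IntegrableOn (fun t : ℝ => deriv f (p + t * u)) (Ioi 0) ∧
      HasDerivAt (fun q => ∫ t in Ioi (0 : ℝ), f (q + t * u))
        (∫ t in Ioi (0 : ℝ), deriv f (p + t * u)) p := by
  obtain ⟨K, ε, hε, hKc, hK⟩ := h.decay
  have hev : ∀ᶠ q in 𝓝 p, K q < K p + 1 :=
    (hKc.continuousAt (h.isOpen.mem_nhds hp)).eventually_lt_const (by linarith)
  obtain ⟨r, hr, hball⟩ := Metric.eventually_nhds_iff_ball.1 (hev.and (h.isOpen.mem_nhds hp))
  have hder : ∀ q ∈ U, ∀ t : ℝ, 0 ≤ t →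
      HasDerivAt (fun q => f (q + t * u)) (deriv f (q + t * u)) q := fun q hq t ht => by
    have h1 := (h.diff.differentiableAt (h.isOpen.mem_nhds (h.ray q hq t ht))).hasDerivAt
    exact h1.comp_add_const q (t * u)
  have := hasDerivAt_integral_of_holomorphic (μ := (volume : Measure ℝ).restrict (Ioi (0 : ℝ)))
    (U := Metric.ball p r) (F := fun q (t : ℝ) => f (q + t * u))
    (bound := fun t => (K p + 1) * Real.exp (-ε * t)) Metric.isOpen_ball ?_ ?_ ?_ ?_
    (Metric.mem_ball_self hr)
  · have hcongr : ∀ᵐ (t : ℝ) ∂((volume : Measure ℝ).restrict (Ioi (0 : ℝ))),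
        deriv (fun q => f (q + t * u)) p = deriv f (p + t * u) := by
      filter_upwards [ae_restrict_mem measurableSet_Ioi] with t ht using
        (hder p hp t (le_of_lt ht)).deriv
    rw [integral_congr_ae hcongr] at this
    exact ⟨this.1.congr hcongr, this.2⟩
  · intro q hq
    exact (((h.continuousOn (hball q hq).2).mono Ioi_subset_Ici_self).aestronglyMeasurable
      measurableSet_Ioi)
  · filter_upwards [ae_restrict_mem measurableSet_Ioi] with t ht q hq
    exact (hder q (hball q hq).2 t (le_of_lt ht)).differentiableAt.differentiableWithinAt
  · filter_upwards [ae_restrict_mem measurableSet_Ioi] with t ht q hq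
    exact (hK q (hball q hq).2 t (le_of_lt ht)).trans
      (mul_le_mul_of_nonneg_right (hball q hq).1.le (Real.exp_pos _).le)
  · exact (integrableOn_exp_mul_Ioi (a := -ε) (by linarith) 0).const_mul _

theorem rayIntegral_deriv (h : RayDecay u f U) {p : ℂ} (hp : p ∈ U) :
    rayIntegral u (deriv f) p = -f p := by
  have h1 : ∀ t ∈ Ici (0 : ℝ),
      HasDerivAt (fun t : ℝ => f (p + t * u)) (deriv f (p + t * u) * u) t := fun t ht => by
    have h2 := (h.diff.differentiableAt (h.isOpen.mem_nhds (h.ray p hp t ht))).hasDerivAt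
    have h3 : HasDerivAt (fun t : ℝ => p + (t : ℂ) * u) u t := by
      simpa using ((Complex.ofRealCLM.hasDerivAt (x := t)).mul_const u).const_add p
    exact h2.comp t h3
  have := integral_Ioi_of_hasDerivAt_of_tendsto' h1
    ((h.integrable_deriv_and_hasDerivAt hp).1.mul_const u) (h.tendsto_zero hp)
  simpa [rayIntegral] using this

/-- Differentiation under the integral turns `f` into `f'`, and the integral of `f'` along a ray is
minus its value at the vertex. So `-rayIntegral u f` is a primitive of `f` on `U`; this takes the
place of Cauchy's theorem for unbounded regions. -/
theorem hasDerivAt_rayIntegral (h : RayDecay u f U) {p : ℂ} (hp : p ∈ U) :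
    HasDerivAt (rayIntegral u f) (-f p) p := by
  have h1 := (h.integrable_deriv_and_hasDerivAt hp).2.mul_const u
  rw [← h.rayIntegral_deriv hp]
  simp only [rayIntegral, integral_mul_const]
  have h2 : rayIntegral u f = fun q => (∫ t in Ioi (0 : ℝ), f (q + t * u)) * u := by
    ext q; simp only [rayIntegral, integral_mul_const]
  rw [h2]
  exact h1

/-- The fundamental theorem of calculus for ray integrals, along a segment. -/
theorem rayIntegral_sub_rayIntegral (h : RayDecay u f U) {p v : ℂ} {a b : ℝ}
    (hseg : ∀ y ∈ uIcc a b, p + y * v ∈ U) :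
    rayIntegral u f (p + b * v) - rayIntegral u f (p + a * v) =
      -∫ y in a..b, f (p + y * v) * v := by
  have hc : ContinuousOn (fun y : ℝ => f (p + y * v)) (uIcc a b) :=
    h.diff.continuousOn.comp (by fun_prop) hseg
  rw [← intervalIntegral.integral_neg]
  symm
  refine intervalIntegral.integral_eq_sub_of_hasDerivAt
    (f := fun y : ℝ => rayIntegral u f (p + y * v)) (fun y hy => ?_)
    ((hc.mul continuousOn_const).neg).intervalIntegrable
  have h3 : HasDerivAt (fun t : ℝ => p + (t : ℂ) * v) v y := by
    simpa using ((Complex.ofRealCLM.hasDerivAt (x := y)).mul_const v).const_add p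
  simpa [neg_mul, Function.comp_def] using (h.hasDerivAt_rayIntegral (hseg y hy)).comp y h3

end RayDecay

theorem norm_rayIntegral_le {u : ℂ} {f : ℂ → ℂ} {p : ℂ} {M ε : ℝ} (hε : 0 < ε)
    (h : ∀ t : ℝ, 0 < t → ‖f (p + t * u)‖ ≤ M * Real.exp (-ε * t)) :
    ‖rayIntegral u f p‖ ≤ M * ‖u‖ / ε := by
  have h1 := integrableOn_exp_mul_Ioi (a := -ε) (by linarith) 0
  have h2 := integral_exp_mul_Ioi (a := -ε) (by linarith) 0
  refine (norm_integral_le_of_norm_le (h1.const_mul (M * ‖u‖)) ?_).trans ?_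
  · filter_upwards [ae_restrict_mem measurableSet_Ioi] with t ht
    rw [norm_mul]
    nlinarith [h t ht, norm_nonneg u, mul_le_mul_of_nonneg_right (h t ht) (norm_nonneg u)]
  · rw [integral_const_mul, h2]
    simp [div_eq_mul_inv]

/-! ### Integrals along contours with two infinite ends -/

/-- The integral of `f` along the contour that comes from infinity in the lower half-plane along
the direction `-i - η`, follows the vertical segment from `x - iT` to `x + iT`, and then goes to
infinity along the direction `i - η`. -/
def contourIntegral (η T : ℝ) (f : ℂ → ℂ) (x : ℝ) : ℂ :=
  rayIntegral (Complex.I - η) f (x + T * Complex.I)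
    - rayIntegral (-Complex.I - η) f (x + (-T : ℝ) * Complex.I)
    + ∫ y in (-T)..T, f (x + y * Complex.I) * Complex.I

/-- `f` can be integrated along the contours of `contourIntegral η T`, for `a < x < b`. -/
structure ContourDecay (η T a b : ℝ) (f : ℂ → ℂ) (V W : Set ℂ) : Prop where
  upper : RayDecay (Complex.I - η) f V
  lower : RayDecay (-Complex.I - η) f W
  strip : ∀ s : ℂ, a < s.re → s.re < b → |s.im| ≤ T → AnalyticAt ℂ f s
  nonneg : 0 ≤ T
  mem_upper : ∀ x : ℝ, a < x → x < b → (x + T * Complex.I : ℂ) ∈ V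
  mem_lower : ∀ x : ℝ, a < x → x < b → (x + (-T : ℝ) * Complex.I : ℂ) ∈ W

namespace ContourDecay

variable {η T a b : ℝ} {f g : ℂ → ℂ} {V W : Set ℂ}

/-- Cauchy's theorem on the rectangle between the two vertical segments. Its horizontal sides are
accounted for by the change of the two ray integrals, which are primitives up to sign. -/
theorem contourIntegral_eq (h : ContourDecay η T a b f V W) {x x' : ℝ} (hx : a < x) (hxb : x < b)
    (hx' : a < x') (hxb' : x' < b) : contourIntegral η T f x = contourIntegral η T f x' := by
  have hre : ∀ y ∈ uIcc x x', a < y ∧ y < b := fun y hy =>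
    ⟨(lt_min hx hx').trans_le hy.1, hy.2.trans_lt (max_lt hxb hxb')⟩
  have h1 := h.upper.rayIntegral_sub_rayIntegral (p := T * Complex.I) (v := 1) (a := x) (b := x')
    (fun y hy => by
      simpa [add_comm] using h.mem_upper y (hre y hy).1 (hre y hy).2)
  have h2 := h.lower.rayIntegral_sub_rayIntegral (p := (-T : ℝ) * Complex.I) (v := 1) (a := x)
    (b := x') (fun y hy => by
      simpa [add_comm] using h.mem_lower y (hre y hy).1 (hre y hy).2)
  have h3 := Complex.integral_boundary_rect_eq_zero_of_differentiableOn f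
    (x + (-T : ℝ) * Complex.I) (x' + T * Complex.I) (fun s hs => by
      rw [Complex.mem_reProdIm] at hs
      simp only [Complex.add_re, Complex.ofReal_re, Complex.mul_re, Complex.I_re, mul_zero,
        Complex.ofReal_im, Complex.I_im, mul_one, sub_self, add_zero, Complex.add_im,
        Complex.mul_im, zero_add] at hs
      refine (h.strip s (hre _ hs.1).1 (hre _ hs.1).2 ?_).differentiableAt.differentiableWithinAt
      rw [uIcc_of_le (a := -T) (by linarith [h.nonneg])] at hs
      exact abs_le.2 hs.2)
  simp only [Complex.add_re, Complex.ofReal_re, Complex.mul_re, Complex.I_re, mul_zero,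
        Complex.ofReal_im, Complex.I_im, mul_one, sub_self, add_zero, Complex.add_im,
        Complex.mul_im, zero_add, smul_eq_mul] at h3
  simp only [mul_one, add_comm _ (_ : ℂ)] at h1 h2
  simp only [contourIntegral, intervalIntegral.integral_mul_const]
  simp only [add_comm _ (_ : ℂ)] at h3 ⊢
  linear_combination -h1 + h2 - h3

theorem contourIntegral_deriv (h : ContourDecay η T a b f V W) {x : ℝ} (hx : a < x) (hxb : x < b) :
    contourIntegral η T (deriv f) x = 0 := by
  have hd : ∀ y ∈ uIcc (-T) T, AnalyticAt ℂ f (x + y * Complex.I) := fun y hy => by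
    rw [uIcc_of_le (by linarith [h.nonneg])] at hy
    exact h.strip _ (by simpa using hx) (by simpa using hxb) (by simpa using abs_le.2 hy)
  have h1 : ∫ y in (-T)..T, deriv f (x + y * Complex.I) * Complex.I =
      f (x + T * Complex.I) - f (x + (-T : ℝ) * Complex.I) := by
    refine intervalIntegral.integral_eq_sub_of_hasDerivAt
      (f := fun y : ℝ => f (x + y * Complex.I)) (fun y hy => ?_) ?_
    · have h3 : HasDerivAt (fun t : ℝ => (x : ℂ) + (t : ℂ) * Complex.I) Complex.I y := by
        simpa using ((Complex.ofRealCLM.hasDerivAt (x := y)).mul_const Complex.I).const_add (x : ℂ)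
      exact (hd y hy).differentiableAt.hasDerivAt.comp y h3
    · refine ContinuousOn.intervalIntegrable (ContinuousOn.mul (fun y hy => ?_) continuousOn_const)
      exact (ContinuousAt.comp (f := fun y : ℝ => (x : ℂ) + y * Complex.I) (hd y hy).deriv.continuousAt
        (by fun_prop)).continuousWithinAt
  rw [contourIntegral, h.upper.rayIntegral_deriv (h.mem_upper x hx hxb),
    h.lower.rayIntegral_deriv (h.mem_lower x hx hxb), h1]
  ring

end ContourDecay

/-! ### Exponential bounds along slanted rays -/

/-- `f` is holomorphic on an open set that is invariant under translations in the direction `u`, and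
grows at most like `exp (B t)` in this direction, locally uniformly. -/
structure RayBound (u : ℂ) (f : ℂ → ℂ) (U : Set ℂ) (B : ℝ) : Prop where
  isOpen : IsOpen U
  diff : DifferentiableOn ℂ f U
  ray : ∀ s ∈ U, ∀ t : ℝ, 0 ≤ t → s + t * u ∈ U
  bound : ∃ K : ℂ → ℝ, ContinuousOn K U ∧
    ∀ s ∈ U, ∀ t : ℝ, 0 ≤ t → ‖f (s + t * u)‖ ≤ K s * Real.exp (B * t)

theorem RayBound.rayDecay {u : ℂ} {f : ℂ → ℂ} {U : Set ℂ} {B : ℝ} (h : RayBound u f U B) {L : ℂ}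
    (hL : B + (u * L).re < 0) : RayDecay u (fun s => f s * Complex.exp (s * L)) U where
  isOpen := h.isOpen
  diff := h.diff.mul (by fun_prop)
  ray := h.ray
  decay := by
    obtain ⟨K, hK, hb⟩ := h.bound
    refine ⟨fun s => K s * Real.exp ((s * L).re), -(B + (u * L).re), by linarith,
      hK.mul (by fun_prop), fun s hs t ht => ?_⟩
    rw [norm_mul, Complex.norm_exp]
    refine (mul_le_mul_of_nonneg_right (hb s hs t ht) (Real.exp_pos _).le).trans (le_of_eq ?_)
    have : ((s + t * u) * L).re = (s * L).re + t * (u * L).re := by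
      rw [add_mul, Complex.add_re, mul_assoc, Complex.re_ofReal_mul]
    rw [mul_assoc, mul_assoc, ← Real.exp_add, ← Real.exp_add, this]
    ring_nf

/-- A crude bound, but uniform over all exponents in a disc, as is needed for holomorphy in the
exponent. -/
theorem norm_cpow_le_exp {w a : ℂ} {ρ : ℝ} (hw : w ≠ 0) (ha : ‖a‖ ≤ ρ) :
    ‖w ^ a‖ ≤ Real.exp (ρ * (Real.pi + ‖w‖ + 1 / ‖w‖)) := by
  have hw' : 0 < ‖w‖ := norm_pos_iff.2 hw
  rw [Complex.cpow_def_of_ne_zero hw, Complex.norm_exp]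
  refine Real.exp_le_exp.2 ?_
  have h1 : |Real.log ‖w‖| ≤ ‖w‖ + 1 / ‖w‖ := by
    have h2 := Real.log_le_sub_one_of_pos hw'
    have h3 := Real.log_le_sub_one_of_pos (one_div_pos.2 hw')
    rw [one_div, Real.log_inv, ← one_div] at h3
    have : 0 < 1 / ‖w‖ := by positivity
    rw [abs_le]; constructor <;> linarith
  have h2 : ‖Complex.log w‖ ≤ Real.pi + ‖w‖ + 1 / ‖w‖ := by
    refine (Complex.norm_le_abs_re_add_abs_im _).trans ?_
    rw [Complex.log_re, Complex.log_im]
    linarith [Complex.abs_arg_le_pi w]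
  calc (Complex.log w * a).re ≤ ‖Complex.log w * a‖ := Complex.re_le_norm _
    _ = ‖a‖ * ‖Complex.log w‖ := by rw [norm_mul, mul_comm]
    _ ≤ _ := mul_le_mul ha h2 (norm_nonneg _) ((norm_nonneg _).trans ha)

/-- Without the term `1 / ‖w‖` of the general bound: this stays bounded near `w = 0` and allows the
passage to the vertex of the contour. -/
theorem norm_cpow_le_exp_of_re_nonneg {w a : ℂ} (hw : w ≠ 0) (ha : 0 ≤ a.re) :
    ‖w ^ a‖ ≤ Real.exp (‖a‖ * (Real.pi + ‖w‖)) := by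
  have hw' : 0 < ‖w‖ := norm_pos_iff.2 hw
  rw [Complex.cpow_def_of_ne_zero hw, Complex.norm_exp]
  refine Real.exp_le_exp.2 ?_
  rw [Complex.mul_re, Complex.log_re, Complex.log_im]
  have h2 : Real.log ‖w‖ * a.re ≤ ‖w‖ * ‖a‖ :=
    (mul_le_mul_of_nonneg_right ((Real.log_le_sub_one_of_pos hw').trans (by linarith)) ha).trans
      (mul_le_mul_of_nonneg_left (Complex.re_le_norm a) hw'.le)
  have h3 : -(w.arg * a.im) ≤ Real.pi * ‖a‖ := by
    refine (neg_le_abs _).trans ?_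
    rw [abs_mul]
    exact mul_le_mul (Complex.abs_arg_le_pi w) (Complex.abs_im_le_norm a) (abs_nonneg _)
      Real.pi_pos.le
  linarith

/-- The half-plane `Re w + e η Im w > 0`, moved by `q`. -/
def slantedHalfPlane (e η : ℝ) (q : ℂ) : Set ℂ :=
  {s | 0 < (s - q).re + e * η * (s - q).im}

theorem isOpen_slantedHalfPlane (e η : ℝ) (q : ℂ) : IsOpen (slantedHalfPlane e η q) :=
  isOpen_lt continuous_const (by fun_prop)

/-- The functional `Re w + e η Im w` does not change in the direction `e i - η` if `e ^ 2 = 1`. The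
sign `e = 1` serves the upper end of the contour and `e = -1` the lower one. -/
theorem add_mem_slantedHalfPlane {e η : ℝ} (he : e * e = 1) {q s : ℂ}
    (hs : s ∈ slantedHalfPlane e η q) (t : ℝ) :
    s + t * (e * Complex.I - η) ∈ slantedHalfPlane e η q := by
  simp only [slantedHalfPlane, mem_ofPred_eq, Complex.sub_re, Complex.sub_im, Complex.add_re,
    Complex.add_im, Complex.mul_re, Complex.mul_im, Complex.ofReal_re, Complex.ofReal_im,
    Complex.I_re, Complex.I_im] at hs ⊢
  have : e * η * (t * e) = η * t := by linear_combination η * t * he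
  linarith

theorem sub_mem_slitPlane {e η : ℝ} {q s : ℂ} (hs : s ∈ slantedHalfPlane e η q) :
    s - q ∈ Complex.slitPlane := by
  rw [Complex.mem_slitPlane_iff]
  by_contra! h
  simp only [slantedHalfPlane, mem_ofPred_eq, h.2] at hs
  linarith

/-- As the left-hand side is constant along slanted rays, this bounds `1 / ‖w‖` along a whole ray at
once. -/
theorem le_norm_of_slanted {e η : ℝ} (he : e * e = 1) (hη : 0 < η) (hη1 : η ≤ 1) (w : ℂ) :
    w.re + e * η * w.im ≤ 2 * ‖w‖ := by
  have h1 := Complex.re_le_norm w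
  have h2 : e * η * w.im ≤ |e| * η * |w.im| := by
    refine (le_abs_self _).trans (le_of_eq ?_)
    rw [abs_mul, abs_mul, abs_of_pos hη]
  have h3 : |e| = 1 := by
    rw [← sq_eq_sq₀ (abs_nonneg e) one_pos.le, sq_abs]; linarith [he, sq e]
  rw [h3, one_mul] at h2
  nlinarith [Complex.abs_im_le_norm w, norm_nonneg w, abs_nonneg w.im]

theorem norm_direction_le {e η : ℝ} (he : e * e = 1) (hη : 0 ≤ η) (hη1 : η ≤ 1) :
    ‖(e * Complex.I - η : ℂ)‖ ≤ 2 := by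
  have h3 : |e| = 1 := by
    rw [← sq_eq_sq₀ (abs_nonneg e) one_pos.le, sq_abs]; linarith [he, sq e]
  refine (norm_sub_le _ _).trans ?_
  simp [h3, abs_of_nonneg hη]
  linarith

theorem norm_ray_le {e η : ℝ} (he : e * e = 1) (hη : 0 ≤ η) (hη1 : η ≤ 1) (w : ℂ) {t : ℝ}
    (ht : 0 ≤ t) : ‖w + t * (e * Complex.I - η)‖ ≤ ‖w‖ + 2 * t := by
  refine (norm_add_le _ _).trans ?_
  rw [norm_mul, Complex.norm_real, Real.norm_of_nonneg ht]
  nlinarith [norm_direction_le he hη hη1]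

theorem norm_cpow_ray_le {e η : ℝ} (he : e * e = 1) (hη : 0 < η) (hη1 : η ≤ 1) {q a s : ℂ} {ρ : ℝ}
    (ha : ‖a‖ ≤ ρ) (hs : s ∈ slantedHalfPlane e η q) {t : ℝ} (ht : 0 ≤ t) :
    ‖(s + t * (e * Complex.I - η) - q) ^ a‖ ≤
      Real.exp (ρ * (Real.pi + ‖s - q‖ + 2 / ((s - q).re + e * η * (s - q).im))) *
        Real.exp (2 * ρ * t) := by
  have hm := add_mem_slantedHalfPlane he hs t
  refine (norm_cpow_le_exp (Complex.slitPlane_ne_zero (sub_mem_slitPlane hm)) ha).trans ?_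
  rw [← Real.exp_add, Real.exp_le_exp]
  have hρ : 0 ≤ ρ := (norm_nonneg _).trans ha
  have h1 : ‖s + t * (e * Complex.I - η) - q‖ ≤ ‖s - q‖ + 2 * t := by
    rw [add_sub_right_comm]; exact norm_ray_le he hη.le hη1 _ ht
  have h2 : 1 / ‖s + t * (e * Complex.I - η) - q‖ ≤
      2 / ((s - q).re + e * η * (s - q).im) := by
    have h3 := le_norm_of_slanted he hη hη1 (s + t * (e * Complex.I - η) - q)
    have h4 : (s + t * (e * Complex.I - η) - q).re + e * η * (s + t * (e * Complex.I - η) - q).im =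
        (s - q).re + e * η * (s - q).im := by
      simp
      linear_combination η * t * he
    rw [h4] at h3
    have h5 : 0 < (s - q).re + e * η * (s - q).im := hs
    rw [div_le_div_iff₀ (by linarith) h5]
    linarith
  nlinarith

theorem rayBound_cpow {e η : ℝ} (he : e * e = 1) (hη : 0 < η) (hη1 : η ≤ 1) (q a : ℂ) {ρ : ℝ}
    (ha : ‖a‖ ≤ ρ) :
    RayBound (e * Complex.I - η) (fun s => (s - q) ^ a) (slantedHalfPlane e η q) (2 * ρ) where
  isOpen := isOpen_slantedHalfPlane e η q
  diff := fun s hs => (((differentiableAt_id (𝕜 := ℂ) (x := s)).sub_const q).cpow_const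
    (sub_mem_slitPlane hs)).differentiableWithinAt
  ray := fun s hs t _ => add_mem_slantedHalfPlane he hs t
  bound := by
    refine ⟨fun s => Real.exp (ρ * (Real.pi + ‖s - q‖ + 2 / ((s - q).re + e * η * (s - q).im))),
      ?_, fun s hs t ht => norm_cpow_ray_le he hη hη1 ha hs ht⟩
    refine Real.continuous_exp.comp_continuousOn (continuousOn_const.mul
      (ContinuousOn.add (by fun_prop) (continuousOn_const.div (by fun_prop) fun s hs => ?_)))
    exact ne_of_gt hs

/-- The reason for bending the ends of the contour: with `L = log z`, the exponential rate becomes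
as negative as desired for large `|z|`, uniformly in `arg z`. -/
theorem re_direction_mul_le {e η : ℝ} (he : e * e = 1) {L : ℂ} (hL : |L.im| ≤ Real.pi) :
    ((e * Complex.I - η) * L).re ≤ Real.pi - η * L.re := by
  have h3 : |e| = 1 := by
    rw [← sq_eq_sq₀ (abs_nonneg e) one_pos.le, sq_abs]; linarith [he, sq e]
  have h4 : -(e * L.im) ≤ Real.pi := by
    refine (neg_le_abs _).trans ?_
    rw [abs_mul, h3, one_mul]; exact hL
  simp
  linarith

/-! ### Hankel's formula -/

/-- Both sides are holomorphic in `r` on the right half-plane and agree at the real points `1 + 1 /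
(n + 1)`, which accumulate at `1`. -/
theorem integral_cpow_mul_exp_neg_mul_Ioi_complex {a r : ℂ} (ha : 0 < a.re) (hr : 0 < r.re) :
    ∫ t in Ioi (0 : ℝ), (t : ℂ) ^ (a - 1) * Complex.exp (-(r * t)) =
      (1 / r) ^ a * Complex.Gamma a := by
  have hopen : ∀ δ : ℝ, IsOpen {z : ℂ | δ < z.re} := fun δ =>
    isOpen_lt continuous_const Complex.continuous_re
  have hd : DifferentiableOn ℂ (fun r : ℂ =>
      ∫ t in Ioi (0 : ℝ), (t : ℂ) ^ (a - 1) * Complex.exp (-(r * t))) {z | 0 < z.re} := by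
    intro z hz
    have hz0 : 0 < z.re := hz
    refine (hasDerivAt_integral_of_holomorphic (μ := (volume : Measure ℝ).restrict (Ioi 0))
      (F := fun r (t : ℝ) => (t : ℂ) ^ (a - 1) * Complex.exp (-(r * t)))
      (bound := fun t => t ^ (a.re - 1) * Real.exp (-(z.re / 2) * t)) (hopen (z.re / 2))
      (fun p _ => ?_) (Eventually.of_forall fun t => by fun_prop) ?_ ?_
      (show z.re / 2 < z.re by linarith)).2.differentiableAt.differentiableWithinAt
    · refine ContinuousOn.aestronglyMeasurable (ContinuousOn.mul (fun t ht => ?_) (by fun_prop))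
        measurableSet_Ioi
      exact (ContinuousAt.cpow (Complex.continuous_ofReal.continuousAt) continuousAt_const
        (Or.inl (by simpa using ht))).continuousWithinAt
    · filter_upwards [ae_restrict_mem measurableSet_Ioi] with t ht p hp
      have ht' : 0 < t := ht
      have hp' : z.re / 2 < p.re := hp
      rw [norm_mul, Complex.norm_cpow_eq_rpow_re_of_pos ht', Complex.norm_exp]
      refine mul_le_mul_of_nonneg_left (Real.exp_le_exp.2 ?_) (Real.rpow_nonneg ht'.le _)
      rw [Complex.neg_re, Complex.re_mul_ofReal]
      nlinarith
    · have := integrableOn_rpow_mul_exp_neg_mul_rpow (s := a.re - 1) (p := 1) (b := z.re / 2)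
        (by linarith) one_pos (by linarith)
      simp only [Real.rpow_one] at this
      exact this
  have hd2 : DifferentiableOn ℂ (fun r : ℂ => (1 / r) ^ a * Complex.Gamma a) {z | 0 < z.re} := by
    intro z hz
    have hz0 : 0 < z.re := hz
    have hzne : z ≠ 0 := fun h => by simp [h] at hz0
    refine (DifferentiableAt.mul_const (DifferentiableAt.cpow_const
      ((differentiableAt_const _).div differentiableAt_id hzne) ?_) _).differentiableWithinAt
    refine Or.inl ?_
    simp only [Pi.div_apply, id, one_div, Complex.inv_re]
    exact div_pos hz0 (Complex.normSq_pos.2 hzne)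
  refine (hd.analyticOnNhd (hopen 0)).eqOn_of_preconnected_of_frequently_eq
    (hd2.analyticOnNhd (hopen 0)) (convex_halfSpace_re_gt 0).isPreconnected
    (z₀ := 1) (show (0 : ℝ) < (1 : ℂ).re by simp) ?_ hr
  have hlim : Tendsto (fun n : ℕ => ((1 + 1 / ((n : ℝ) + 1) : ℝ) : ℂ)) atTop (𝓝[≠] 1) := by
    refine tendsto_nhdsWithin_iff.2 ⟨?_, Eventually.of_forall fun n => ?_⟩
    · have := (Complex.continuous_ofReal.tendsto (1 + 0)).comp
        ((tendsto_one_div_add_atTop_nhds_zero_nat (𝕜 := ℝ)).const_add 1)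
      simpa [Function.comp_def] using this
    · simp only [mem_compl_iff, mem_singleton_iff]
      rw [← Complex.ofReal_one, Complex.ofReal_inj]
      have : (0 : ℝ) < 1 / ((n : ℝ) + 1) := by positivity
      linarith
  refine hlim.frequently (Frequently.of_forall fun n => ?_)
  exact Complex.integral_cpow_mul_exp_neg_mul_Ioi ha (by positivity)

/-- The integral of a power along a ray issuing from its branch point. -/
theorem rayIntegral_cpow_vertex {e η : ℝ} (he : e = 1 ∨ e = -1) (hη : 0 < η) {q a L : ℂ}
    (ha : 0 ≤ a.re) (hL : |L.im| ≤ Real.pi) (hLre : Real.pi < η * L.re) :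
    rayIntegral (e * Complex.I - η) (fun s => (s - q) ^ a * Complex.exp (s * L)) q =
      Complex.exp (q * L) * L ^ (-a - 1) * Complex.Gamma (a + 1) *
        Complex.exp ((a + 1) * (e * Real.pi * Complex.I)) := by
  have hee : e * e = 1 := by rcases he with rfl | rfl <;> norm_num
  set u : ℂ := e * Complex.I - η with hu
  have hure : u.re = -η := by simp [hu]
  have huim : u.im = e := by simp [hu]
  have hu0 : u ≠ 0 := fun h => by rw [h] at hure; simp at hure; linarith
  have hLpos : 0 < L.re := by
    by_contra! h; nlinarith [Real.pi_pos]
  have hL0 : L ≠ 0 := fun h => by rw [h] at hLpos; simp at hLpos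
  have hr : 0 < (-u * L).re := by
    have := re_direction_mul_le (η := η) hee hL
    rw [neg_mul, Complex.neg_re]; linarith
  have hint : ∀ t ∈ Ioi (0 : ℝ), (q + t * u - q) ^ a * Complex.exp ((q + t * u) * L) * u =
      (u ^ a * u * Complex.exp (q * L)) *
        ((t : ℂ) ^ ((a + 1) - 1) * Complex.exp (-((-u * L) * t))) := fun t ht => by
    have h1 : (t * u) ^ a = (t : ℂ) ^ a * u ^ a := by
      have ht0 : (t : ℂ) ≠ 0 := by exact_mod_cast (ne_of_gt ht)
      rw [Complex.cpow_def_of_ne_zero (mul_ne_zero ht0 hu0), Complex.cpow_def_of_ne_zero ht0,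
        Complex.cpow_def_of_ne_zero hu0, Complex.log_ofReal_mul ht hu0, Complex.ofReal_log (le_of_lt ht),
        add_mul, Complex.exp_add]
    rw [add_sub_cancel_left, h1, add_sub_cancel_right,
      show (q + t * u) * L = q * L + -((-u * L) * t) by ring, Complex.exp_add]
    ring
  rw [rayIntegral, setIntegral_congr_fun measurableSet_Ioi hint, integral_const_mul,
    integral_cpow_mul_exp_neg_mul_Ioi_complex (by simp; linarith) hr]
  -- Here the branches matter: `-u` and `L` both lie in the right half-plane, so their arguments add
  -- without a jump, and passing from `-u` to `u` costs `e π i`.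
  have hlog : Complex.log (-u * L) = Complex.log u - e * Real.pi * Complex.I + Complex.log L := by
    have h1 : Complex.log (-u) = Complex.log u - e * Real.pi * Complex.I := by
      apply Complex.ext
      · simp [Complex.log_re]
      · rw [Complex.log_im]
        rcases he with rfl | rfl
        · rw [Complex.arg_neg_eq_arg_sub_pi_of_im_pos (by rw [huim]; norm_num)]; simp [Complex.log_im]
        · rw [Complex.arg_neg_eq_arg_add_pi_of_im_neg (by rw [huim]; norm_num)]; simp [Complex.log_im]
    rw [← h1, Complex.log_mul_eq_add_log_iff (neg_ne_zero.2 hu0) hL0]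
    have h2 := abs_lt.1 (Complex.abs_arg_lt_pi_div_two_iff.2 (Or.inl hLpos))
    have h3 := abs_lt.1 (Complex.abs_arg_lt_pi_div_two_iff (z := -u) |>.2
      (Or.inl (by simpa [hure] using hη)))
    constructor <;> linarith [h2.1, h2.2, h3.1, h3.2]
  have hne : -u * L ≠ 0 := mul_ne_zero (neg_ne_zero.2 hu0) hL0
  have h5 : u ^ a * u = u ^ (a + 1) := by rw [Complex.cpow_add _ _ hu0, Complex.cpow_one]
  rw [h5, one_div, Complex.inv_cpow _ _ (by
    intro h; rw [Complex.arg_eq_pi_iff] at h; linarith [h.1]), ← Complex.cpow_neg,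
    Complex.cpow_def_of_ne_zero hne, Complex.cpow_def_of_ne_zero hu0,
    Complex.cpow_def_of_ne_zero hL0, hlog]
  have h6 : Complex.exp (Complex.log u * (a + 1)) * Complex.exp
      ((Complex.log u - e * Real.pi * Complex.I + Complex.log L) * -(a + 1)) =
      Complex.exp (Complex.log L * (-a - 1)) *
        Complex.exp ((a + 1) * (e * Real.pi * Complex.I)) := by
    rw [← Complex.exp_add, ← Complex.exp_add]; ring_nf
  linear_combination (Complex.exp (q * L) * Complex.Gamma (a + 1)) * h6

/-- Euler's reflection formula, in the shape in which it combines the phases of the two sides of the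
Hankel contour. -/
theorem Gamma_mul_exp_sub_exp {a : ℂ} (ha : 0 ≤ a.re) :
    Complex.Gamma (a + 1) * (Complex.exp ((a + 1) * (Real.pi * Complex.I)) -
      Complex.exp (-((a + 1) * (Real.pi * Complex.I)))) =
      2 * Real.pi * Complex.I * (Complex.Gamma (-a))⁻¹ := by
  have h1 := Complex.Gamma_mul_Gamma_one_sub (a + 1)
  rw [show 1 - (a + 1) = -a by ring] at h1
  have h2 : Complex.exp ((a + 1) * (Real.pi * Complex.I)) -
      Complex.exp (-((a + 1) * (Real.pi * Complex.I))) =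
      2 * Complex.I * Complex.sin (Real.pi * (a + 1)) := by
    rw [Complex.sin]
    have : -(Real.pi * (a + 1)) * Complex.I = -((a + 1) * (Real.pi * Complex.I)) := by ring
    rw [this, show Real.pi * (a + 1) * Complex.I = (a + 1) * (Real.pi * Complex.I) by ring]
    linear_combination (-Complex.exp (-((a + 1) * (Real.pi * Complex.I))) +
      Complex.exp ((a + 1) * (Real.pi * Complex.I))) * Complex.I_sq
  have h3 : Complex.Gamma (a + 1) ≠ 0 := Complex.Gamma_ne_zero_of_re_pos (by simp; linarith)
  rw [h2]
  -- If the sine vanishes, then with division by zero the reflection formula forces `Γ (-a) = 0`,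
  -- and its inverse is `0` as well.
  by_cases hs : Complex.sin (Real.pi * (a + 1)) = 0
  · rw [hs, div_zero] at h1
    rw [(mul_eq_zero.1 h1).resolve_left h3, hs]; simp
  · have h4 : Complex.Gamma (-a) ≠ 0 := fun h => by
      rw [h, mul_zero] at h1
      exact div_ne_zero (by exact_mod_cast Real.pi_ne_zero) hs h1.symm
    rw [eq_div_iff hs] at h1
    field_simp
    rw [mul_comm (Real.pi : ℂ)] at h1
    linear_combination h1

theorem ofReal_one_mul_I_sub (η : ℝ) : ((1 : ℝ) * Complex.I - η : ℂ) = Complex.I - η := by simp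

theorem ofReal_neg_one_mul_I_sub (η : ℝ) : ((-1 : ℝ) * Complex.I - η : ℂ) = -Complex.I - η := by
  simp

theorem mem_slantedHalfPlane {e η : ℝ} {q s : ℂ} :
    s ∈ slantedHalfPlane e η q ↔ 0 < s.re - q.re + e * η * (s.im - q.im) := by
  simp [slantedHalfPlane]

theorem rayDecay_cpow_mul_exp {e η : ℝ} (he : e * e = 1) (hη : 0 < η) (hη1 : η ≤ 1) (q a : ℂ)
    {L : ℂ} (hL : |L.im| ≤ Real.pi) (hLre : Real.pi + 2 * ‖a‖ < η * L.re) :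
    RayDecay (e * Complex.I - η) (fun s => (s - q) ^ a * Complex.exp (s * L))
      (slantedHalfPlane e η q) :=
  (rayBound_cpow he hη hη1 q a le_rfl).rayDecay (by
    linarith [re_direction_mul_le (η := η) he hL])

theorem contourDecay_cpow_mul_exp {η T : ℝ} (hη : 0 < η) (hη1 : η ≤ 1) {q a L : ℂ}
    (hT : |q.im| ≤ T) (hL : |L.im| ≤ Real.pi) (hLre : Real.pi + 2 * ‖a‖ < η * L.re) (b : ℝ) :
    ContourDecay η T q.re b (fun s => (s - q) ^ a * Complex.exp (s * L))
      (slantedHalfPlane 1 η q) (slantedHalfPlane (-1) η q) where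
  upper := by
    rw [← ofReal_one_mul_I_sub]
    exact rayDecay_cpow_mul_exp (by norm_num) hη hη1 q a hL hLre
  lower := by
    rw [← ofReal_neg_one_mul_I_sub]
    exact rayDecay_cpow_mul_exp (by norm_num) hη hη1 q a hL hLre
  strip := fun s hs _ _ => by
    refine AnalyticAt.mul (AnalyticAt.cpow (by fun_prop) analyticAt_const (Or.inl ?_))
      (by fun_prop)
    simpa using hs
  nonneg := (abs_nonneg _).trans hT
  mem_upper := fun x hx _ => by
    rw [mem_slantedHalfPlane]
    have := (abs_le.1 hT).2
    simp
    nlinarith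
  mem_lower := fun x hx _ => by
    rw [mem_slantedHalfPlane]
    have := (abs_le.1 hT).1
    simp
    nlinarith

/-- The contour integral of a power is a difference of ray integrals. -/
theorem contourIntegral_cpow_eq_sub {η T : ℝ} (hη : 0 < η) (hη1 : η ≤ 1) {q a L : ℂ}
    (hT : |q.im| ≤ T) (hL : |L.im| ≤ Real.pi) (hLre : Real.pi + 2 * ‖a‖ < η * L.re) {δ : ℝ}
    (hδ : 0 < δ) :
    contourIntegral η T (fun s => (s - q) ^ a * Complex.exp (s * L)) (q.re + δ) =
      rayIntegral (Complex.I - η) (fun s => (s - q) ^ a * Complex.exp (s * L)) (q + δ) -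
        rayIntegral (-Complex.I - η) (fun s => (s - q) ^ a * Complex.exp (s * L)) (q + δ) := by
  set f : ℂ → ℂ := fun s => (s - q) ^ a * Complex.exp (s * L) with hf
  have h := contourDecay_cpow_mul_exp hη hη1 hT hL hLre (q.re + δ + 1)
  have hT' := abs_le.1 hT
  have h1 := h.upper.rayIntegral_sub_rayIntegral (p := ((q.re + δ : ℝ) : ℂ)) (v := Complex.I)
    (a := q.im) (b := T) (fun y hy => by
      rw [uIcc_of_le hT'.2] at hy
      rw [mem_slantedHalfPlane]
      simp
      nlinarith [hy.1])
  have h2 := h.lower.rayIntegral_sub_rayIntegral (p := ((q.re + δ : ℝ) : ℂ)) (v := Complex.I)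
    (a := q.im) (b := -T) (fun y hy => by
      rw [uIcc_of_ge hT'.1] at hy
      rw [mem_slantedHalfPlane]
      simp
      nlinarith [hy.2])
  have hc : ∀ c d : ℝ, IntervalIntegrable (fun y : ℝ => f ((q.re + δ : ℝ) + y * Complex.I) * Complex.I)
      volume c d := fun c d => by
    refine Continuous.intervalIntegrable (Continuous.mul (Continuous.mul
      (continuous_iff_continuousAt.2 fun y => ?_) (by fun_prop)) continuous_const) c d
    exact ContinuousAt.cpow (by fun_prop) continuousAt_const (Or.inl (by simpa using hδ))
  have hq : ((q.re + δ : ℝ) : ℂ) + q.im * Complex.I = q + δ := by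
    apply Complex.ext <;> simp
  rw [hq] at h1 h2
  have h3 := intervalIntegral.integral_add_adjacent_intervals (hc (-T) q.im) (hc q.im T)
  rw [intervalIntegral.integral_symm] at h2
  rw [contourIntegral, ← h3]
  linear_combination h1 - h2

/-- Dominated convergence; `Re a ≥ 0` keeps the power bounded near the vertex, and the decay of the
exponential dominates its growth elsewhere. -/
theorem tendsto_rayIntegral_cpow {e η : ℝ} (he : e * e = 1) (hη : 0 < η) (hη1 : η ≤ 1) {q a L : ℂ}
    (ha : 0 ≤ a.re) (hL : |L.im| ≤ Real.pi) (hLre : Real.pi + 2 * ‖a‖ < η * L.re) :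
    Tendsto (fun δ : ℝ => rayIntegral (e * Complex.I - η)
      (fun s => (s - q) ^ a * Complex.exp (s * L)) (q + δ)) (𝓝[>] 0)
      (𝓝 (rayIntegral (e * Complex.I - η) (fun s => (s - q) ^ a * Complex.exp (s * L)) q)) := by
  have hre := re_direction_mul_le (η := η) he hL
  have hmem : ∀ᶠ δ : ℝ in 𝓝[>] 0, δ ∈ Ioo (0 : ℝ) 1 := Ioo_mem_nhdsGT one_pos
  have hm : ∀ δ : ℝ, 0 < δ → q + δ ∈ slantedHalfPlane e η q := fun δ hδ => by
    rw [mem_slantedHalfPlane]; simpa using hδ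
  set C : ℝ := Real.exp (‖a‖ * (Real.pi + 1)) * Real.exp ((q * L).re + |L.re|) *
    ‖(e * Complex.I - η : ℂ)‖ with hC
  refine tendsto_integral_filter_of_dominated_convergence
    (fun t => C * Real.exp (-(η * L.re - Real.pi - 2 * ‖a‖) * t)) ?_ ?_ ?_ ?_
  · filter_upwards [hmem] with δ hδ
    exact (((rayDecay_cpow_mul_exp he hη hη1 q a hL hLre).integrableOn (hm δ hδ.1)).mul_const
      _).aestronglyMeasurable
  · filter_upwards [hmem] with δ hδ
    filter_upwards [ae_restrict_mem measurableSet_Ioi] with t ht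
    have ht0 : 0 ≤ t := le_of_lt ht
    have hne := Complex.slitPlane_ne_zero (sub_mem_slitPlane
      (add_mem_slantedHalfPlane he (hm δ hδ.1) t))
    rw [norm_mul, norm_mul, Complex.norm_exp]
    have h1 := norm_cpow_le_exp_of_re_nonneg hne ha
    have h2 : ‖q + δ + t * (e * Complex.I - η) - q‖ ≤ 1 + 2 * t := by
      have := norm_ray_le he hη.le hη1 (δ : ℂ) ht0
      rw [Complex.norm_real, Real.norm_of_nonneg hδ.1.le] at this
      rw [show q + δ + t * (e * Complex.I - η) - q = δ + t * (e * Complex.I - η) by ring]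
      linarith [hδ.2]
    have h3 : ((q + δ + t * (e * Complex.I - η)) * L).re ≤
        (q * L).re + |L.re| + t * (Real.pi - η * L.re) := by
      rw [add_mul, add_mul, Complex.add_re, Complex.add_re, mul_assoc, Complex.re_ofReal_mul,
        Complex.re_ofReal_mul]
      have h4 : δ * L.re ≤ |L.re| :=
        (le_abs_self _).trans (by
          rw [abs_mul, abs_of_pos hδ.1]; nlinarith [abs_nonneg L.re, hδ.2])
      nlinarith
    calc _ ≤ Real.exp (‖a‖ * (Real.pi + (1 + 2 * t))) *
        Real.exp ((q * L).re + |L.re| + t * (Real.pi - η * L.re)) *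
          ‖(e * Complex.I - η : ℂ)‖ := by
          refine mul_le_mul_of_nonneg_right (mul_le_mul (h1.trans (Real.exp_le_exp.2 ?_))
            (Real.exp_le_exp.2 h3) (Real.exp_pos _).le (Real.exp_pos _).le) (norm_nonneg _)
          exact mul_le_mul_of_nonneg_left (by linarith) (norm_nonneg _)
      _ = _ := by
          rw [hC, mul_right_comm _ _ (Real.exp (-_ * t)), ← Real.exp_add, ← Real.exp_add,
            ← Real.exp_add]
          ring_nf
  · exact (integrableOn_exp_mul_Ioi (by linarith) 0).const_mul C
  · filter_upwards [ae_restrict_mem measurableSet_Ioi] with t ht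
    have ht0 : 0 < t := ht
    have hcont : ContinuousAt (fun δ : ℝ => (q + δ + t * (e * Complex.I - η) - q) ^ a *
        Complex.exp ((q + δ + t * (e * Complex.I - η)) * L) * (e * Complex.I - η)) 0 := by
      refine ContinuousAt.mul (ContinuousAt.mul (ContinuousAt.cpow (by fun_prop) continuousAt_const
        ?_) (by fun_prop)) continuousAt_const
      rw [Complex.mem_slitPlane_iff]
      right
      simp only [Complex.sub_im, Complex.add_im, Complex.mul_im, Complex.ofReal_im,
        Complex.ofReal_re, Complex.I_im, Complex.I_re, Complex.sub_re, Complex.mul_re]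
      intro h
      have h0 : t * e = 0 := by linarith
      rcases mul_eq_zero.1 h0 with h | h
      · linarith
      · rw [h] at he; norm_num at he
    simpa using (hcont.tendsto).mono_left nhdsWithin_le_nhds

/-- The contour is collapsed onto the two rays from the branch point. Their integrals differ only in
the phases `e^{±πi(a+1)}`, and the reflection formula evaluates the difference. -/
theorem contourIntegral_cpow_of_re_nonneg {η T : ℝ} (hη : 0 < η) (hη1 : η ≤ 1) {q a L : ℂ}
    (ha : 0 ≤ a.re)
    (hT : |q.im| ≤ T) (hL : |L.im| ≤ Real.pi) (hLre : Real.pi + 2 * ‖a‖ < η * L.re) {x : ℝ}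
    (hx : q.re < x) :
    contourIntegral η T (fun s => (s - q) ^ a * Complex.exp (s * L)) x =
      2 * Real.pi * Complex.I * Complex.exp (q * L) * L ^ (-a - 1) * (Complex.Gamma (-a))⁻¹ := by
  have hLre' : Real.pi < η * L.re := by linarith [norm_nonneg a]
  have h1 := tendsto_rayIntegral_cpow (e := 1) (by norm_num) hη hη1 (q := q) ha hL hLre
  have h2 := tendsto_rayIntegral_cpow (e := -1) (by norm_num) hη hη1 (q := q) ha hL hLre
  rw [rayIntegral_cpow_vertex (Or.inl rfl) hη ha hL hLre'] at h1
  rw [rayIntegral_cpow_vertex (Or.inr rfl) hη ha hL hLre'] at h2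
  rw [ofReal_one_mul_I_sub] at h1
  rw [ofReal_neg_one_mul_I_sub] at h2
  have h3 : ∀ᶠ δ : ℝ in 𝓝[>] 0, contourIntegral η T (fun s => (s - q) ^ a * Complex.exp (s * L)) x =
      rayIntegral (Complex.I - η) (fun s => (s - q) ^ a * Complex.exp (s * L)) (q + δ) -
        rayIntegral (-Complex.I - η) (fun s => (s - q) ^ a * Complex.exp (s * L)) (q + δ) := by
    filter_upwards [self_mem_nhdsWithin] with δ hδ
    have hδ' : 0 < δ := hδ
    rw [← contourIntegral_cpow_eq_sub hη hη1 hT hL hLre hδ]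
    exact (contourDecay_cpow_mul_exp hη hη1 hT hL hLre (max x (q.re + δ) + 1)).contourIntegral_eq hx
      (by linarith [le_max_left x (q.re + δ)]) (by linarith) (by linarith [le_max_right x (q.re + δ)])
  have h4 := tendsto_nhds_unique (tendsto_const_nhds.congr' h3) (h1.sub h2)
  rw [h4]
  have h5 := Gamma_mul_exp_sub_exp ha
  have h6 : (a + 1) * ((-1 : ℝ) * Real.pi * Complex.I) = -((a + 1) * (Real.pi * Complex.I)) := by
    push_cast; ring
  rw [h6, Complex.ofReal_one, one_mul]
  linear_combination (Complex.exp (q * L) * L ^ (-a - 1)) * h5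

theorem differentiable_const_cpow {w : ℂ} (hw : w ≠ 0) : Differentiable ℂ fun a : ℂ => w ^ a :=
  fun _ => DifferentiableAt.const_cpow differentiableAt_id (Or.inl hw)

/-- The vertex `p` lies off the branch point, so no condition on `Re a` is required. One lower bound
for `Re L` serves the whole disc of exponents, which prepares the analytic continuation in `a`. -/
theorem differentiableOn_rayIntegral_cpow {e η : ℝ} (he : e * e = 1) (hη : 0 < η) (hη1 : η ≤ 1)
    {q L p : ℂ} {ρ : ℝ} (hL : |L.im| ≤ Real.pi) (hLre : Real.pi + 2 * ρ < η * L.re)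
    (hp : p ∈ slantedHalfPlane e η q) :
    DifferentiableOn ℂ (fun a : ℂ => rayIntegral (e * Complex.I - η)
      (fun s => (s - q) ^ a * Complex.exp (s * L)) p) (Metric.ball 0 ρ) := by
  intro a ha
  have hre := re_direction_mul_le (η := η) he hL
  have hball : ∀ a ∈ Metric.ball (0 : ℂ) ρ, ‖a‖ ≤ ρ := fun _ ha => (mem_ball_zero_iff.1 ha).le
  refine (hasDerivAt_integral_of_holomorphic (μ := (volume : Measure ℝ).restrict (Ioi 0))
    (F := fun (a : ℂ) (t : ℝ) => (p + t * (e * Complex.I - η) - q) ^ a *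
      Complex.exp ((p + t * (e * Complex.I - η)) * L) * (e * Complex.I - η))
    (bound := fun t => Real.exp (ρ * (Real.pi + ‖p - q‖ + 2 / ((p - q).re + e * η * (p - q).im))) *
      Real.exp ((p * L).re) * ‖(e * Complex.I - η : ℂ)‖ *
      Real.exp (-(η * L.re - Real.pi - 2 * ρ) * t)) Metric.isOpen_ball
    (fun a' ha' => ?_) (Eventually.of_forall fun t => ?_) ?_ ?_ ha).2.differentiableAt.differentiableWithinAt
  · exact (((rayDecay_cpow_mul_exp he hη hη1 q a' hL (by linarith [hball _ ha'])).integrableOn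
      hp).mul_const _).aestronglyMeasurable
  · exact ((((differentiable_const_cpow (Complex.slitPlane_ne_zero (sub_mem_slitPlane
      (add_mem_slantedHalfPlane he hp t)))).mul_const _).mul_const _)).differentiableOn
  · filter_upwards [ae_restrict_mem measurableSet_Ioi] with t ht a ha
    have ht0 : 0 ≤ t := le_of_lt ht
    rw [norm_mul, norm_mul, Complex.norm_exp]
    have h1 := norm_cpow_ray_le he hη hη1 (hball a ha) hp ht0
    have h3 : ((p + t * (e * Complex.I - η)) * L).re ≤ (p * L).re + t * (Real.pi - η * L.re) := by
      rw [add_mul, Complex.add_re, mul_assoc, Complex.re_ofReal_mul]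
      nlinarith
    refine (mul_le_mul_of_nonneg_right (mul_le_mul h1 (Real.exp_le_exp.2 h3) (Real.exp_pos _).le
      (by positivity)) (norm_nonneg _)).trans (le_of_eq ?_)
    rw [mul_right_comm _ _ (Real.exp (-_ * t)), mul_assoc, mul_assoc (Real.exp (ρ * _)),
      mul_assoc (Real.exp (ρ * _)), mul_assoc (Real.exp (ρ * _))]
    congr 1
    rw [← mul_assoc]
    congr 1
    rw [← Real.exp_add, ← Real.exp_add]
    ring_nf
  · exact (integrableOn_exp_mul_Ioi (by linarith) 0).const_mul _

/-- Hankel's formula: the contour integral of a power times an exponential. -/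
theorem contourIntegral_cpow {η T : ℝ} (hη : 0 < η) (hη1 : η ≤ 1) {q a L : ℂ}
    (hT : |q.im| ≤ T) (hL : |L.im| ≤ Real.pi) (hLre : Real.pi + 2 * (‖a‖ + 1) < η * L.re) {x : ℝ}
    (hx : q.re < x) :
    contourIntegral η T (fun s => (s - q) ^ a * Complex.exp (s * L)) x =
      2 * Real.pi * Complex.I * Complex.exp (q * L) * L ^ (-a - 1) * (Complex.Gamma (-a))⁻¹ := by
  set ρ := ‖a‖ + 1
  have hρ : 0 < ρ := by positivity
  have hball : ∀ a ∈ Metric.ball (0 : ℂ) ρ, ‖a‖ ≤ ρ := fun a ha => (mem_ball_zero_iff.1 ha).le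
  have hL0 : L ≠ 0 := fun h => by
    rw [h] at hLre; simp at hLre; linarith [Real.pi_pos]
  have hdec := contourDecay_cpow_mul_exp hη hη1 hT hL (a := a) (by linarith [norm_nonneg a]) (x + 1)
  have hup := hdec.mem_upper x hx (by linarith)
  have hlo := hdec.mem_lower x hx (by linarith)
  have d1 := differentiableOn_rayIntegral_cpow (e := 1) (by norm_num) hη hη1 hL hLre hup
  have d2 := differentiableOn_rayIntegral_cpow (e := -1) (by norm_num) hη hη1 hL hLre hlo
  rw [ofReal_one_mul_I_sub] at d1
  rw [ofReal_neg_one_mul_I_sub] at d2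
  have hslit : ∀ y : ℝ, (x : ℂ) + y * Complex.I - q ∈ Complex.slitPlane := fun y =>
    Or.inl (by simpa using hx)
  have d3 : DifferentiableOn ℂ (fun a : ℂ => ∫ y in (-T)..T,
      ((x + y * Complex.I - q) ^ a * Complex.exp ((x + y * Complex.I) * L)) * Complex.I)
      (Metric.ball 0 ρ) := by
    intro a ha
    have hTT : -T ≤ T := by linarith [hdec.nonneg]
    simp only [intervalIntegral.integral_of_le hTT]
    have hcont : ContinuousOn (fun y : ℝ =>
        Real.exp (ρ * (Real.pi + ‖(x : ℂ) + y * Complex.I - q‖ + 1 / ‖(x : ℂ) + y * Complex.I - q‖)) *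
          Real.exp (((x + y * Complex.I) * L).re)) (Icc (-T) T) := by
      refine Continuous.continuousOn (Continuous.mul (Real.continuous_exp.comp (continuous_const.mul
        (Continuous.add (by fun_prop) (continuous_const.div (by fun_prop) fun y => ?_))))
        (by fun_prop))
      exact norm_ne_zero_iff.2 (Complex.slitPlane_ne_zero (hslit y))
    refine (hasDerivAt_integral_of_holomorphic (μ := (volume : Measure ℝ).restrict (Ioc (-T) T))
      (F := fun (a : ℂ) (y : ℝ) => ((x + y * Complex.I - q) ^ a * Complex.exp ((x + y * Complex.I) * L)) *
        Complex.I) (bound := fun y : ℝ =>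
        Real.exp (ρ * (Real.pi + ‖(x : ℂ) + y * Complex.I - q‖ + 1 / ‖(x : ℂ) + y * Complex.I - q‖)) *
          Real.exp (((x + y * Complex.I) * L).re)) Metric.isOpen_ball
      (fun _ _ => ?_) (Eventually.of_forall fun t => ?_) (Eventually.of_forall fun t a ha => ?_) ?_
      ha).2.differentiableAt.differentiableWithinAt
    · refine Continuous.aestronglyMeasurable (Continuous.mul (Continuous.mul
        (continuous_iff_continuousAt.2 fun y => ?_) (by fun_prop)) continuous_const)
      exact ContinuousAt.cpow (by fun_prop) continuousAt_const (hslit y)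
    · exact ((((differentiable_const_cpow (Complex.slitPlane_ne_zero (hslit t))).mul_const
        _).mul_const _)).differentiableOn
    · rw [norm_mul, norm_mul, Complex.norm_exp, Complex.norm_I, mul_one]
      exact mul_le_mul_of_nonneg_right (norm_cpow_le_exp (Complex.slitPlane_ne_zero (hslit t))
        (hball a ha)) (Real.exp_pos _).le
    · exact (hcont.integrableOn_Icc).mono_set Ioc_subset_Icc_self
  have d4 : DifferentiableOn ℂ (fun a => 2 * Real.pi * Complex.I * Complex.exp (q * L) *
      L ^ (-a - 1) * (Complex.Gamma (-a))⁻¹) (Metric.ball 0 ρ) := by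
    refine Differentiable.differentiableOn (Differentiable.mul (Differentiable.mul (by fun_prop) ?_)
      (Complex.differentiable_one_div_Gamma.comp differentiable_neg))
    exact (differentiable_const_cpow hL0).comp (by fun_prop : Differentiable ℂ fun a : ℂ => -a - 1)
  -- Identity theorem in the exponent, on the disc of radius `‖a‖ + 1`. Near its point `ρ / 2` the
  -- real part is positive, and there the collapsed contour has already given the formula.
  refine (((d1.sub d2).add d3).analyticOnNhd Metric.isOpen_ball).eqOn_of_preconnected_of_eventuallyEq
    (d4.analyticOnNhd Metric.isOpen_ball) (convex_ball 0 ρ).isPreconnected (z₀ := ((ρ / 2 : ℝ) : ℂ))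
    ?_ ?_ (mem_ball_zero_iff.2 (by linarith : ‖a‖ < ‖a‖ + 1))
  · rw [mem_ball_zero_iff, Complex.norm_real, Real.norm_of_nonneg (by positivity)]; linarith
  · have hev : ∀ᶠ b : ℂ in 𝓝 ((ρ / 2 : ℝ) : ℂ), 0 < b.re ∧ ‖b‖ < ρ := by
      refine (Complex.continuous_re.continuousAt.eventually_const_lt ?_).and
        (continuous_norm.continuousAt.eventually_lt_const ?_)
      · simp; positivity
      · change ‖((ρ / 2 : ℝ) : ℂ)‖ < ρ
        rw [Complex.norm_real, Real.norm_of_nonneg (by positivity)]; linarith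
    filter_upwards [hev] with b hb
    exact contourIntegral_cpow_of_re_nonneg hη hη1 hb.1.le hT hL (by linarith) hx

/-! ### Linearity of contour integrals -/

theorem contourIntegral_const_mul (η T : ℝ) (c : ℂ) (f : ℂ → ℂ) (x : ℝ) :
    contourIntegral η T (fun s => c * f s) x = c * contourIntegral η T f x := by
  simp only [contourIntegral, rayIntegral, mul_assoc, integral_const_mul,
    intervalIntegral.integral_const_mul]
  ring

theorem ContourDecay.contourIntegral_add {η T a b : ℝ} {f g : ℂ → ℂ} {V W : Set ℂ}
    (hf : ContourDecay η T a b f V W) (hg : ContourDecay η T a b g V W) {x : ℝ} (hx : a < x)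
    (hxb : x < b) : contourIntegral η T (fun s => f s + g s) x =
      contourIntegral η T f x + contourIntegral η T g x := by
  have hc : ∀ {f}, ContourDecay η T a b f V W → IntervalIntegrable
      (fun y : ℝ => f (x + y * Complex.I) * Complex.I) volume (-T) T := fun {f} hf => by
    refine ContinuousOn.intervalIntegrable (ContinuousOn.mul (fun y hy => ?_) continuousOn_const)
    rw [uIcc_of_le (by linarith [hf.nonneg])] at hy
    have := hf.strip (x + y * Complex.I) (by simpa using hx) (by simpa using hxb)
      (by simpa using abs_le.2 hy)
    exact (ContinuousAt.comp (f := fun y : ℝ => (x : ℂ) + y * Complex.I) this.continuousAt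
      (by fun_prop)).continuousWithinAt
  have h1 := intervalIntegral.integral_add (hc hf) (hc hg)
  have h2 := integral_add ((hf.upper.integrableOn (hf.mem_upper x hx hxb)).mul_const
    (Complex.I - η)) ((hg.upper.integrableOn (hg.mem_upper x hx hxb)).mul_const (Complex.I - η))
  have h3 := integral_add ((hf.lower.integrableOn (hf.mem_lower x hx hxb)).mul_const
    (-Complex.I - η)) ((hg.lower.integrableOn (hg.mem_lower x hx hxb)).mul_const (-Complex.I - η))
  simp only [contourIntegral, rayIntegral, add_mul]
  linear_combination h1 + h2 - h3

theorem analyticAt_iteratedDeriv {f : ℂ → ℂ} {s : ℂ} (h : AnalyticAt ℂ f s) (n : ℕ) :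
    AnalyticAt ℂ (iteratedDeriv n f) s := by
  rw [iteratedDeriv_eq_iterate]
  exact h.iterated_deriv n

theorem RayDecay.const_mul {u : ℂ} {f : ℂ → ℂ} {U : Set ℂ} (h : RayDecay u f U) (c : ℂ) :
    RayDecay u (fun s => c * f s) U where
  isOpen := h.isOpen
  diff := h.diff.const_mul c
  ray := h.ray
  decay := by
    obtain ⟨K, ε, hε, hK, hb⟩ := h.decay
    refine ⟨fun s => ‖c‖ * K s, ε, hε, continuousOn_const.mul hK, fun s hs t ht => ?_⟩
    rw [norm_mul, mul_assoc]
    exact mul_le_mul_of_nonneg_left (hb s hs t ht) (norm_nonneg _)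

theorem ContourDecay.const_mul {η T a b : ℝ} {f : ℂ → ℂ} {V W : Set ℂ}
    (h : ContourDecay η T a b f V W) (c : ℂ) : ContourDecay η T a b (fun s => c * f s) V W where
  upper := h.upper.const_mul c
  lower := h.lower.const_mul c
  strip := fun s h1 h2 h3 => analyticAt_const.mul (h.strip s h1 h2 h3)
  nonneg := h.nonneg
  mem_upper := h.mem_upper
  mem_lower := h.mem_lower

/-- The function `f₀` only supplies the geometry: that the contour stays in `V`, the strip and `W`.
No decay of `f` or `g` is assumed. -/
theorem ContourDecay.contourIntegral_congr {η T a b : ℝ} {f₀ f g : ℂ → ℂ} {V W : Set ℂ}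
    (h : ContourDecay η T a b f₀ V W) (hV : EqOn f g V) (hW : EqOn f g W)
    (hs : ∀ s : ℂ, a < s.re → s.re < b → |s.im| ≤ T → f s = g s) {x : ℝ} (hx : a < x)
    (hxb : x < b) : contourIntegral η T f x = contourIntegral η T g x := by
  have h1 : rayIntegral (Complex.I - η) f (x + T * Complex.I) =
      rayIntegral (Complex.I - η) g (x + T * Complex.I) :=
    setIntegral_congr_fun measurableSet_Ioi fun t ht => by
      simp only [hV (h.upper.ray _ (h.mem_upper x hx hxb) t (le_of_lt ht))]
  have h2 : rayIntegral (-Complex.I - η) f (x + (-T : ℝ) * Complex.I) =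
      rayIntegral (-Complex.I - η) g (x + (-T : ℝ) * Complex.I) :=
    setIntegral_congr_fun measurableSet_Ioi fun t ht => by
      simp only [hW (h.lower.ray _ (h.mem_lower x hx hxb) t (le_of_lt ht))]
  have h3 : ∫ y in (-T)..T, f (x + y * Complex.I) * Complex.I =
      ∫ y in (-T)..T, g (x + y * Complex.I) * Complex.I :=
    intervalIntegral.integral_congr fun y hy => by
      rw [uIcc_of_le (by linarith [h.nonneg])] at hy
      simp only [hs (x + y * Complex.I) (by simpa using hx) (by simpa using hxb)
        (by simpa using abs_le.2 hy)]
  rw [contourIntegral, contourIntegral, h1, h2, h3]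

/-! ### Integration by parts along slanted contours -/

/-- The part of a slanted half-plane with `e Im s > y`. -/
def slantedRegion (e η v y : ℝ) : Set ℂ :=
  {s | v < s.re + e * η * s.im ∧ y < e * s.im}

theorem isOpen_slantedRegion (e η v y : ℝ) : IsOpen (slantedRegion e η v y) :=
  (isOpen_lt (f := fun _ => v) (g := fun s : ℂ => s.re + e * η * s.im) continuous_const
    (by fun_prop)).inter (isOpen_lt (f := fun _ => y) (g := fun s : ℂ => e * s.im) continuous_const
    (by fun_prop))

theorem add_mem_slantedRegion {e η v y : ℝ} (he : e * e = 1) {s : ℂ}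
    (hs : s ∈ slantedRegion e η v y) {t : ℝ} (ht : 0 ≤ t) :
    s + t * (e * Complex.I - η) ∈ slantedRegion e η v y := by
  have h1 : v < s.re + e * η * s.im := hs.1
  have h2 : y < e * s.im := hs.2
  constructor
  · simp
    have : e * η * (t * e) = η * t := by linear_combination η * t * he
    linarith
  · simp
    have : e * (t * e) = t := by linear_combination t * he
    linarith

/-- Room for Cauchy's estimate on unit discs: `Re s` and `e η Im s` each change by at most `1`,
hence the loss of `2` in `v`. -/
theorem closedBall_subset_slantedRegion {e η v y : ℝ} (he : e * e = 1) (hη : 0 ≤ η) (hη1 : η ≤ 1)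
    {s : ℂ} (hs : s ∈ slantedRegion e η (v + 2) (y + 1)) :
    Metric.closedBall s 1 ⊆ slantedRegion e η v y := by
  intro z hz
  have h3 : |e| = 1 := by
    rw [← sq_eq_sq₀ (abs_nonneg e) one_pos.le, sq_abs]; linarith [he, sq e]
  rw [mem_closedBall_iff_norm, ← norm_neg, neg_sub] at hz
  have hre : |s.re - z.re| ≤ 1 := (Complex.abs_re_le_norm (s - z)).trans hz
  have him : |e * (s.im - z.im)| ≤ 1 := by
    rw [abs_mul, h3, one_mul]
    exact (Complex.abs_im_le_norm (s - z)).trans hz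
  have h1 : v + 2 < s.re + e * η * s.im := hs.1
  have h2 : y + 1 < e * s.im := hs.2
  rw [abs_le] at hre him
  constructor
  · nlinarith
  · linarith

/-- `f` is holomorphic to the right of the contours of `contourIntegral η T`, as far as these have
`σ < x < b`, and grows at most exponentially. -/
structure SlantedExpBound (η v y σ b T : ℝ) (f : ℂ → ℂ) : Prop where
  diff : ∀ e : ℝ, e * e = 1 → DifferentiableOn ℂ f (slantedRegion e η v y)
  bound : ∃ C B : ℝ, 0 ≤ C ∧ 0 ≤ B ∧ ∀ e : ℝ, e * e = 1 → ∀ s ∈ slantedRegion e η v y,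
    ‖f s‖ ≤ C * Real.exp (B * ‖s‖)
  strip : ∀ s : ℂ, σ < s.re → s.re < b → |s.im| ≤ T → AnalyticAt ℂ f s

namespace SlantedExpBound

variable {η v y σ b T : ℝ} {f g : ℂ → ℂ}

theorem const_mul (c : ℂ) (hf : SlantedExpBound η v y σ b T f) :
    SlantedExpBound η v y σ b T (fun s => c * f s) where
  diff := fun e he => (hf.diff e he).const_mul c
  bound := by
    obtain ⟨C, B, hC, hB, h⟩ := hf.bound
    refine ⟨‖c‖ * C, B, by positivity, hB, fun e he s hs => ?_⟩
    rw [norm_mul, mul_assoc]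
    exact mul_le_mul_of_nonneg_left (h e he s hs) (norm_nonneg _)
  strip := fun s h1 h2 h3 => analyticAt_const.mul (hf.strip s h1 h2 h3)

theorem add (hf : SlantedExpBound η v y σ b T f) (hg : SlantedExpBound η v y σ b T g) :
    SlantedExpBound η v y σ b T (fun s => f s + g s) where
  diff := fun e he => (hf.diff e he).add (hg.diff e he)
  bound := by
    obtain ⟨C, B, hC, hB, h⟩ := hf.bound
    obtain ⟨C', B', hC', hB', h'⟩ := hg.bound
    refine ⟨C + C', max B B', by positivity, le_max_of_le_left hB, fun e he s hs => ?_⟩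
    have h1 : C * Real.exp (B * ‖s‖) ≤ C * Real.exp (max B B' * ‖s‖) := by
      gcongr; exact le_max_left _ _
    have h2 : C' * Real.exp (B' * ‖s‖) ≤ C' * Real.exp (max B B' * ‖s‖) := by
      gcongr; exact le_max_right _ _
    rw [add_mul]
    exact (norm_add_le _ _).trans
      (add_le_add ((h e he s hs).trans h1) ((h' e he s hs).trans h2))
  strip := fun s h1 h2 h3 => (hf.strip s h1 h2 h3).add (hg.strip s h1 h2 h3)

theorem zero : SlantedExpBound η v y σ b T (fun _ => 0) where
  diff := fun e he => differentiableOn_const _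
  bound := ⟨0, 0, le_rfl, le_rfl, fun e he s hs => by simp⟩
  strip := fun s h1 h2 h3 => analyticAt_const

theorem finsetSum {ι : Type*} (S : Finset ι) {f : ι → ℂ → ℂ}
    (hf : ∀ i ∈ S, SlantedExpBound η v y σ b T (f i)) :
    SlantedExpBound η v y σ b T (fun s => ∑ i ∈ S, f i s) := by
  classical
  induction S using Finset.induction_on with
  | empty => simpa using zero
  | insert i S hi ih =>
    simp only [Finset.sum_insert hi]
    exact (hf i (Finset.mem_insert_self i S)).add
      (ih fun j hj => hf j (Finset.mem_insert_of_mem hj))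

theorem contourDecay (hf : SlantedExpBound η v y σ b T f) (hη : 0 ≤ η) (hη1 : η ≤ 1) (hT : 0 ≤ T)
    (hv : v < σ + η * T) (hy : y < T) :
    ∃ R : ℝ, ∀ L : ℂ, |L.im| ≤ Real.pi → R < η * L.re →
      ContourDecay η T σ b (fun s => f s * Complex.exp (s * L)) (slantedRegion 1 η v y)
        (slantedRegion (-1) η v y) := by
  obtain ⟨C, B, hC, hB, h⟩ := hf.bound
  have hray : ∀ e : ℝ, e * e = 1 →
      RayBound (e * Complex.I - η) f (slantedRegion e η v y) (2 * B) := fun e he =>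
    { isOpen := isOpen_slantedRegion e η v y
      diff := hf.diff e he
      ray := fun s hs t ht => add_mem_slantedRegion he hs ht
      bound := by
        refine ⟨fun s => C * Real.exp (B * ‖s‖), by fun_prop, fun s hs t ht => ?_⟩
        refine (h e he _ (add_mem_slantedRegion he hs ht)).trans ?_
        rw [mul_assoc, ← Real.exp_add]
        gcongr
        nlinarith [norm_ray_le he hη hη1 s ht] }
  refine ⟨Real.pi + 2 * B, fun L hL hLre => ⟨?_, ?_, fun s h1 h2 h3 =>
    (hf.strip s h1 h2 h3).mul (by fun_prop), hT, fun x hx _ => ?_, fun x hx _ => ?_⟩⟩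
  · rw [← ofReal_one_mul_I_sub]
    exact (hray 1 (by norm_num)).rayDecay
      (by linarith [re_direction_mul_le (η := η) (e := 1) (by norm_num) hL])
  · rw [← ofReal_neg_one_mul_I_sub]
    exact (hray (-1) (by norm_num)).rayDecay
      (by linarith [re_direction_mul_le (η := η) (e := -1) (by norm_num) hL])
  · constructor <;> simp <;> linarith
  · constructor <;> simp <;> linarith

/-- Cauchy's estimate on unit discs. All orders are obtained directly from `f`, so the margins `v +
2` and `y + 1` do not depend on `n`. -/
theorem iteratedDeriv (hf : SlantedExpBound η v y σ b T f) (hη : 0 ≤ η) (hη1 : η ≤ 1) (n : ℕ) :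
    SlantedExpBound η (v + 2) (y + 1) σ b T (iteratedDeriv n f) where
  diff := fun e he s hs => by
    have h1 := closedBall_subset_slantedRegion he hη hη1 hs (Metric.mem_closedBall_self one_pos.le)
    have h2 : AnalyticAt ℂ f s := (hf.diff e he).analyticAt ((isOpen_slantedRegion e η v y).mem_nhds h1)
    exact (analyticAt_iteratedDeriv h2 n).differentiableAt.differentiableWithinAt
  bound := by
    obtain ⟨C, B, hC, hB, h⟩ := hf.bound
    refine ⟨n.factorial * (C * Real.exp B), B, by positivity, hB, fun e he s hs => ?_⟩
    have h1 := closedBall_subset_slantedRegion he hη hη1 hs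
    refine (Complex.norm_iteratedDeriv_le_of_forall_mem_sphere_norm_le (R := 1)
      (C := C * Real.exp (B * (‖s‖ + 1))) n one_pos ?_ fun z hz => ?_).trans (le_of_eq ?_)
    · refine DifferentiableOn.diffContOnCl ((hf.diff e he).mono ?_)
      rwa [closure_ball _ one_ne_zero]
    · refine (h e he z (h1 (Metric.sphere_subset_closedBall hz))).trans ?_
      gcongr
      rw [mem_sphere_iff_norm] at hz
      calc ‖z‖ = ‖s + (z - s)‖ := by ring_nf
        _ ≤ _ := (norm_add_le _ _).trans (by rw [hz])
    · rw [one_pow, div_one, mul_add, Real.exp_add]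
      ring_nf
  strip := fun s h1 h2 h3 => analyticAt_iteratedDeriv (hf.strip s h1 h2 h3) n

/-- Integration by parts along the contour. -/
theorem contourIntegral_deriv_mul_exp (hf : SlantedExpBound η v y σ b T f)
    (hf' : SlantedExpBound η v y σ b T (deriv f)) (hη : 0 ≤ η)
    (hη1 : η ≤ 1) (hT : 0 ≤ T) (hv : v < σ + η * T) (hy : y < T) :
    ∃ R : ℝ, ∀ L : ℂ, |L.im| ≤ Real.pi → R < η * L.re → ∀ x, σ < x → x < b →
      contourIntegral η T (fun s => deriv f s * Complex.exp (s * L)) x =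
        -L * contourIntegral η T (fun s => f s * Complex.exp (s * L)) x := by
  obtain ⟨R, hR⟩ := hf.contourDecay hη hη1 hT hv hy
  obtain ⟨R', hR'⟩ := hf'.contourDecay hη hη1 hT hv hy
  refine ⟨max R R', fun L hL hLre x hx hxb => ?_⟩
  have h := hR L hL ((le_max_left _ _).trans_lt hLre)
  have h' := hR' L hL ((le_max_right _ _).trans_lt hLre)
  have h1 := h'.contourIntegral_add (h.const_mul L) hx hxb
  have h2 := h.contourIntegral_deriv hx hxb
  have hd : ∀ s, DifferentiableAt ℂ f s → deriv (fun s => f s * Complex.exp (s * L)) s =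
      deriv f s * Complex.exp (s * L) + L * (f s * Complex.exp (s * L)) := fun s hs => by
    have h3 : HasDerivAt (fun s => Complex.exp (s * L)) (Complex.exp (s * L) * L) s := by
      simpa using ((hasDerivAt_id s).mul_const L).cexp
    refine (hs.hasDerivAt.mul h3).deriv.trans ?_
    ring
  have h4 := h.contourIntegral_congr (g := fun s => deriv f s * Complex.exp (s * L) +
    L * (f s * Complex.exp (s * L))) (f := deriv (fun s => f s * Complex.exp (s * L))) ?_ ?_ ?_ hx hxb
  · rw [contourIntegral_const_mul] at h1
    linear_combination -h1 - h4 + h2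
  · exact fun s hs => hd s ((hf.diff 1 (by norm_num)).differentiableAt
      ((isOpen_slantedRegion 1 η v y).mem_nhds hs))
  · exact fun s hs => hd s ((hf.diff (-1) (by norm_num)).differentiableAt
      ((isOpen_slantedRegion (-1) η v y).mem_nhds hs))
  · exact fun s hs1 hs2 hs3 => hd s (hf.strip s hs1 hs2 hs3).differentiableAt

/-- Iterated integration by parts. Only the threshold `R` grows with `n`; the region stays the same
throughout the induction. -/
theorem contourIntegral_iteratedDeriv_mul_exp (hf : SlantedExpBound η v y σ b T f) (hη : 0 ≤ η)
    (hη1 : η ≤ 1) (hT : 0 ≤ T) (hv : v + 2 < σ + η * T) (hy : y + 1 < T) (n : ℕ) :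
    ∃ R : ℝ, ∀ L : ℂ, |L.im| ≤ Real.pi → R < η * L.re → ∀ x, σ < x → x < b →
      contourIntegral η T (fun s => _root_.iteratedDeriv n f s * Complex.exp (s * L)) x =
        (-L) ^ n * contourIntegral η T (fun s => f s * Complex.exp (s * L)) x := by
  induction n with
  | zero => exact ⟨0, fun L _ _ x _ _ => by simp⟩
  | succ n ih =>
    obtain ⟨R, hR⟩ := ih
    have h1 := hf.iteratedDeriv hη hη1 (n + 1)
    rw [iteratedDeriv_succ] at h1
    obtain ⟨R', hR'⟩ := (hf.iteratedDeriv hη hη1 n).contourIntegral_deriv_mul_exp h1 hη hη1 hT hv hy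
    refine ⟨max R R', fun L hL hLre x hx hxb => ?_⟩
    rw [iteratedDeriv_succ, hR' L hL ((le_max_right _ _).trans_lt hLre) x hx hxb,
      hR L hL ((le_max_left _ _).trans_lt hLre) x hx hxb, pow_succ]
    ring

/-- If the `n`-th derivative of `f` is bounded on the strip, then the contour integral of
`f(s) exp(s L)` is `O(exp(σ Re L) |L|^{-n})`. -/
theorem norm_contourIntegral_le (hf : SlantedExpBound η v y σ b T f) (hη : 0 < η)
    (hη1 : η ≤ 1) (hT : 0 ≤ T) (hv : v + 2 < σ + η * T) (hy : y + 1 < T) (hb : σ < b) (n : ℕ)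
    (hn : ∃ C : ℝ, ∃ b' > σ, ∀ s : ℂ, σ < s.re → s.re < b' → |s.im| ≤ T →
      ‖_root_.iteratedDeriv n f s‖ ≤ C) :
    ∃ C R : ℝ, 0 ≤ C ∧ ∀ L : ℂ, |L.im| ≤ Real.pi → R < η * L.re → ∀ x, σ < x → x < b →
      ‖contourIntegral η T (fun s => f s * Complex.exp (s * L)) x‖ * ‖L‖ ^ n ≤
        C * Real.exp (σ * L.re) := by
  obtain ⟨C₀, b', hb', hC₀⟩ := hn
  have hC₀' : 0 ≤ C₀ := by
    refine (norm_nonneg _).trans (hC₀ (((σ + b') / 2 : ℝ) : ℂ) ?_ ?_ ?_)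
    · rw [Complex.ofReal_re]; linarith
    · rw [Complex.ofReal_re]; linarith
    · rw [Complex.ofReal_im, abs_zero]; exact hT
  have hf' := hf.iteratedDeriv hη.le hη1 n
  set g := _root_.iteratedDeriv n f with hg
  obtain ⟨R₁, hR₁⟩ := hf.contourIntegral_iteratedDeriv_mul_exp hη.le hη1 hT hv hy n
  obtain ⟨R₂, hR₂⟩ := hf'.contourDecay hη.le hη1 hT hv hy
  obtain ⟨C, B, hC, hB, hbd⟩ := hf'.bound
  set C₁ : ℝ := C * Real.exp (B * (|σ| + 1 + T)) * Real.exp (1 + T * Real.pi) with hC₁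
  -- The entries of the threshold give, in turn: the integration by parts, the convergence of the
  -- integral, decay at least `e^{-t}` on the rays, `σ + 1 / Re L` below `b` and below `b'`, and `Re
  -- L > 1`.
  refine ⟨C₁ * 2 + C₁ * 2 + C₀ * Real.exp (1 + T * Real.pi) * (2 * T),
    max (max R₁ R₂) (max (Real.pi + 2 * B + 1) (max (2 * η / (b - σ)) (max (2 * η / (b' - σ)) η))),
    by positivity, fun L hL hLre x hx hxb => ?_⟩
  simp only [max_lt_iff] at hLre
  obtain ⟨⟨hL1, hL2⟩, hL3, hL4, hL5, hL6⟩ := hLre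
  have hLpos : 1 < L.re := by by_contra! h; nlinarith
  have hinv : 0 < 1 / L.re := by positivity
  have hinv1 : 1 / L.re ≤ 1 := by rw [div_le_one (by linarith)]; exact hLpos.le
  have key : ∀ b > σ, 2 * η / (b - σ) < η * L.re → σ + 1 / L.re < b := fun b hb h => by
    rw [div_lt_iff₀ (by linarith)] at h
    have h2 : 2 < L.re * (b - σ) := by
      by_contra! h3; nlinarith
    have : 1 / L.re < b - σ := by
      rw [div_lt_iff₀ (by linarith)]; linarith
    linarith
  -- The contour moves to abscissa `σ + 1 / Re L`. There `e^{x Re L}` exceeds `e^{σ Re L}` only by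
  -- the factor `e`, so the line `Re s = σ` itself, where `f` may be singular, is not needed.
  have hx₀ : σ < σ + 1 / L.re := by linarith
  have hb₀ := key b hb hL4
  have hb₀' := key b' hb' hL5
  set x₀ := σ + 1 / L.re with hx₀'
  have hxL : x₀ * L.re = σ * L.re + 1 := by
    rw [hx₀', add_mul, one_div, inv_mul_cancel₀ (by linarith)]
  have hdec := hR₂ L hL hL2
  have h1 := hR₁ L hL hL1 x hx hxb
  have h2 := hdec.contourIntegral_eq hx hxb hx₀ hb₀
  have h3 : ‖contourIntegral η T (fun s => f s * Complex.exp (s * L)) x‖ * ‖L‖ ^ n =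
      ‖contourIntegral η T (fun s => g s * Complex.exp (s * L)) x₀‖ := by
    rw [← h2, h1, norm_mul, norm_pow, norm_neg, mul_comm]
  have him : ∀ r : ℝ, |r| ≤ T → -(r * L.im) ≤ T * Real.pi := fun r hr => by
    refine (neg_le_abs _).trans ?_
    rw [abs_mul]
    exact mul_le_mul hr hL (abs_nonneg _) hT
  have hexp : ∀ r : ℝ, |r| ≤ T → ((x₀ + r * Complex.I) * L).re ≤ σ * L.re + (1 + T * Real.pi) :=
    fun r hr => by
      have := him r hr
      simp
      linarith
  have hray : ∀ e : ℝ, e * e = 1 → ∀ r : ℝ, |r| ≤ T →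
      (x₀ + r * Complex.I : ℂ) ∈ slantedRegion e η (v + 2) (y + 1) →
      ‖rayIntegral (e * Complex.I - η) (fun s => g s * Complex.exp (s * L)) (x₀ + r * Complex.I)‖ ≤
        C₁ * 2 * Real.exp (σ * L.re) := by
    intro e he r hr hmem
    refine (norm_rayIntegral_le (M := C₁ * Real.exp (σ * L.re)) one_pos fun t ht => ?_).trans ?_
    · rw [norm_mul, Complex.norm_exp]
      have a1 := hbd e he _ (add_mem_slantedRegion he hmem ht.le)
      have a2 := norm_ray_le he hη.le hη1 (x₀ + r * Complex.I : ℂ) ht.le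
      have a3 : ‖(x₀ + r * Complex.I : ℂ)‖ ≤ |σ| + 1 + T := by
        refine (norm_add_le _ _).trans ?_
        rw [norm_mul, Complex.norm_I, mul_one, Complex.norm_real, Complex.norm_real,
          Real.norm_eq_abs, Real.norm_eq_abs]
        have : |x₀| ≤ |σ| + 1 := (abs_add_le _ _).trans (by rw [abs_of_pos hinv]; linarith)
        linarith
      have a4 : ((x₀ + r * Complex.I + t * (e * Complex.I - η)) * L).re ≤
          σ * L.re + (1 + T * Real.pi) + t * (Real.pi - η * L.re) := by
        rw [add_mul, Complex.add_re, mul_assoc (t : ℂ), Complex.re_ofReal_mul]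
        have := hexp r hr
        have := re_direction_mul_le (η := η) he hL
        nlinarith
      calc _ ≤ (C * Real.exp (B * (|σ| + 1 + T + 2 * t))) *
            Real.exp (σ * L.re + (1 + T * Real.pi) + t * (Real.pi - η * L.re)) := by
            refine mul_le_mul (a1.trans ?_) (Real.exp_le_exp.2 a4) (Real.exp_pos _).le (by positivity)
            gcongr; linarith
        _ ≤ (C * Real.exp (B * (|σ| + 1 + T + 2 * t))) *
            Real.exp (σ * L.re + (1 + T * Real.pi) + t * (-(2 * B) - 1)) := by
            have := mul_le_mul_of_nonneg_left (by linarith : Real.pi - η * L.re ≤ -(2 * B) - 1) ht.le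
            gcongr
        _ = _ := by
            rw [hC₁, mul_assoc, mul_assoc, mul_assoc, mul_assoc, ← Real.exp_add, ← Real.exp_add,
              ← Real.exp_add, ← Real.exp_add]
            ring_nf
    · have := norm_direction_le he hη.le hη1
      rw [div_one]
      have h5 : 0 ≤ C₁ * Real.exp (σ * L.re) := by positivity
      nlinarith
  have hup := hray 1 (by norm_num) T (abs_of_nonneg hT).le (hdec.mem_upper x₀ hx₀ hb₀)
  have hlo := hray (-1) (by norm_num) (-T) (by rw [abs_neg, abs_of_nonneg hT])
    (hdec.mem_lower x₀ hx₀ hb₀)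
  rw [ofReal_one_mul_I_sub] at hup
  rw [ofReal_neg_one_mul_I_sub] at hlo
  have hseg : ‖∫ r in (-T)..T, g (x₀ + r * Complex.I) * Complex.exp ((x₀ + r * Complex.I) * L) *
      Complex.I‖ ≤ C₀ * Real.exp (1 + T * Real.pi) * (2 * T) * Real.exp (σ * L.re) := by
    refine (intervalIntegral.norm_integral_le_of_norm_le_const
      (C := C₀ * Real.exp (σ * L.re + (1 + T * Real.pi))) fun r hr => ?_).trans (le_of_eq ?_)
    · rw [uIoc_of_le (by linarith)] at hr
      have hr' : |r| ≤ T := abs_le.2 ⟨hr.1.le, hr.2⟩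
      rw [norm_mul, norm_mul, Complex.norm_I, mul_one, Complex.norm_exp]
      refine mul_le_mul (hC₀ _ (by simpa using hx₀) (by simpa using hb₀') (by simpa using hr'))
        (Real.exp_le_exp.2 (hexp r hr')) (Real.exp_pos _).le hC₀'
    · rw [sub_neg_eq_add, abs_of_nonneg (by linarith), Real.exp_add]
      ring
  rw [h3, contourIntegral]
  refine (norm_add_le _ _).trans ((add_le_add (norm_sub_le _ _) le_rfl).trans ?_)
  linarith

/-- The margin `1` in `v` keeps the slanted regions away from `q`, so that powers of `s - q` are
exponentially bounded there even if the exponent has negative real part. -/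
theorem _root_.one_lt_of_mem_slantedRegion {e : ℝ} (he : e * e = 1) (hη : 0 ≤ η) {q s : ℂ}
    (hv : q.re + η * |q.im| + 1 ≤ v) (hs : s ∈ slantedRegion e η v y) :
    1 < (s - q).re + e * η * (s - q).im := by
  have h3 : |e| = 1 := by
    rw [← sq_eq_sq₀ (abs_nonneg e) one_pos.le, sq_abs]; linarith [he, sq e]
  have h1 : v < s.re + e * η * s.im := hs.1
  have h2 : e * η * q.im ≤ η * |q.im| := by
    refine (le_abs_self _).trans (le_of_eq ?_)
    rw [abs_mul, abs_mul, h3, abs_of_nonneg hη, one_mul]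
  rw [Complex.sub_re, Complex.sub_im]
  linarith

/-- Powers are bounded exponentially to the right of the contours. -/
theorem cpow (hη : 0 < η) (hη1 : η ≤ 1) {q : ℂ} (hq : q.re ≤ σ) (a : ℂ) (b T y : ℝ)
    (hv : q.re + η * |q.im| + 1 ≤ v) : SlantedExpBound η v y σ b T (fun s => (s - q) ^ a) where
  diff := fun e he s hs => ((((differentiableAt_id (𝕜 := ℂ) (x := s)).sub_const q).cpow_const
    (sub_mem_slitPlane (lt_trans one_pos
      (one_lt_of_mem_slantedRegion he hη.le hv hs))))).differentiableWithinAt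
  bound := by
    refine ⟨Real.exp (‖a‖ * (Real.pi + ‖q‖ + 2)), ‖a‖, by positivity, norm_nonneg a,
      fun e he s hs => ?_⟩
    have h1 := one_lt_of_mem_slantedRegion he hη.le hv hs
    have h2 := le_norm_of_slanted he hη hη1 (s - q)
    have h3 : 1 / ‖s - q‖ ≤ 2 := by
      rw [div_le_iff₀ (by linarith)]; linarith
    have h4 := norm_sub_le s q
    refine (norm_cpow_le_exp (norm_pos_iff.1 (by linarith)) le_rfl).trans ?_
    rw [← Real.exp_add, ← mul_add]
    exact Real.exp_le_exp.2 (mul_le_mul_of_nonneg_left (by linarith) (norm_nonneg a))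
  strip := fun s h1 h2 h3 => by
    refine AnalyticAt.cpow (by fun_prop) analyticAt_const (Or.inl ?_)
    simp; linarith

end SlantedExpBound

/-! ### Cones at the branch points and local estimates -/

/-- The cone `Re (s - q) > -κ |s - q|`. -/
def rightCone (κ : ℝ) (q : ℂ) : Set ℂ := {s | -κ * ‖s - q‖ < (s - q).re}

theorem isOpen_rightCone (κ : ℝ) (q : ℂ) : IsOpen (rightCone κ q) :=
  isOpen_lt (f := fun s => -κ * ‖s - q‖) (g := fun s => (s - q).re) (by fun_prop) (by fun_prop)

theorem mem_rightCone_of_re_lt {κ : ℝ} (hκ : 0 ≤ κ) {q s : ℂ} (h : q.re < s.re) :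
    s ∈ rightCone κ q := by
  change -κ * ‖s - q‖ < (s - q).re
  rw [Complex.sub_re]
  nlinarith [norm_nonneg (s - q)]

theorem ne_of_mem_rightCone {κ : ℝ} {q s : ℂ} (h : s ∈ rightCone κ q) : s ≠ q := by
  rintro rfl
  simp [rightCone] at h

/-- In polar form the cone is `cos (arg (s - q)) > -κ`, and `-κ ≥ -cos ω = cos (π - |ω|)`. -/
theorem abs_arg_lt_of_mem_rightCone {ω κ : ℝ} (hω : |ω| < Real.pi / 2) (hκ : κ ≤ Real.cos ω)
    {q s : ℂ} (h : s ∈ rightCone κ q) : |(s - q).arg| < Real.pi - |ω| := by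
  have hw : -κ * ‖s - q‖ < (s - q).re := h
  by_contra! h1
  have h2 : Real.cos |(s - q).arg| ≤ Real.cos (Real.pi - |ω|) :=
    Real.cos_le_cos_of_nonneg_of_le_pi (by linarith [abs_nonneg ω, Real.pi_pos])
      (Complex.abs_arg_le_pi _) h1
  rw [Real.cos_abs, Real.cos_pi_sub, Real.cos_abs] at h2
  have h3 : (s - q).re = ‖s - q‖ * Real.cos (s - q).arg := (Complex.norm_mul_cos_arg _).symm
  nlinarith [norm_nonneg (s - q)]

/-- Rotation by `-ω` keeps arguments of absolute value below `π - |ω|` within `(-π, π)`. So in the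
cone the branch adapted to the cut is the principal one. -/
theorem branchLog_eq_log {ω κ : ℝ} (hω : |ω| < Real.pi / 2) (hκ : κ ≤ Real.cos ω)
    {q s : ℂ} (h : s ∈ rightCone κ q) : branchLog ω (s - q) = Complex.log (s - q) := by
  have hne : s - q ≠ 0 := sub_ne_zero.2 (ne_of_mem_rightCone h)
  have h1 := abs_lt.1 (abs_arg_lt_of_mem_rightCone hω hκ h)
  have h2 : Complex.log (Complex.exp (-((ω : ℂ) * Complex.I))) = -((ω : ℂ) * Complex.I) := by
    rw [abs_lt] at hω
    apply Complex.log_exp <;> simp <;> linarith [Real.pi_pos]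
  have h3 : (Complex.exp (-((ω : ℂ) * Complex.I))).arg = -ω := by
    rw [← Complex.log_im, h2]; simp
  rw [branchLog, (Complex.log_mul_eq_add_log_iff hne (Complex.exp_ne_zero _)).2, h2]
  · ring
  · rw [h3]
    constructor <;> linarith [le_abs_self ω, neg_abs_le ω]

theorem branchPow_eq_cpow {ω κ : ℝ} (hω : |ω| < Real.pi / 2) (hκ : κ ≤ Real.cos ω)
    {q s : ℂ} (h : s ∈ rightCone κ q) (a : ℂ) : branchPow ω (s - q) a = (s - q) ^ a := by
  rw [branchPow, branchLog_eq_log hω hκ h,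
    Complex.cpow_def_of_ne_zero (sub_ne_zero.2 (ne_of_mem_rightCone h)), mul_comm]

/-- A point of the cut at distance `r` from `q` has `Re (s - q) = -r cos ω ≤ -κ r`. -/
theorem notMem_branchCut {ω κ : ℝ} (hκ : κ ≤ Real.cos ω)
    {q s : ℂ} (h : s ∈ rightCone κ q) : s ∉ branchCut q ω := by
  rintro ⟨r, hr, rfl⟩
  have hw : -κ * ‖q - r * Complex.exp (ω * Complex.I) - q‖ <
    (q - r * Complex.exp (ω * Complex.I) - q).re := h
  rw [show q - r * Complex.exp (ω * Complex.I) - q = -(r * Complex.exp (ω * Complex.I)) by ring,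
    norm_neg, norm_mul, Complex.norm_exp_ofReal_mul_I, Complex.norm_real, Real.norm_of_nonneg hr,
    Complex.neg_re, Complex.re_ofReal_mul, Complex.exp_ofReal_mul_I_re] at hw
  nlinarith

theorem mem_slitPlane_of_mem_rightCone {κ : ℝ} (hκ : κ ≤ 1) {q s : ℂ} (h : s ∈ rightCone κ q) :
    s - q ∈ Complex.slitPlane := by
  have hw : -κ * ‖s - q‖ < (s - q).re := h
  rw [Complex.mem_slitPlane_iff]
  by_contra! h1
  have h2 : ‖s - q‖ = -(s - q).re := by
    have h3 : s - q = ((s - q).re : ℂ) := by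
      apply Complex.ext <;> simp [h1.2]
    rw [h3, Complex.norm_real, Complex.ofReal_re, Real.norm_of_nonpos h1.1]
  rw [h2] at hw
  nlinarith [h1.1]

/-- Taylor's theorem in terms of `taylorCoeffAt`. -/
theorem isBigO_sub_taylor {f : ℂ → ℂ} {c : ℂ} (hf : AnalyticAt ℂ f c) (n : ℕ) :
    (fun w => f (c + w) - ∑ k ∈ Finset.range n, taylorCoeffAt f c k * w ^ k) =O[𝓝 0]
      fun w => ‖w‖ ^ n := by
  have := hf.hasFPowerSeriesAt.isBigO_sub_partialSum_pow n
  refine this.congr_left fun w => ?_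
  simp only [FormalMultilinearSeries.partialSum, FormalMultilinearSeries.ofScalars_apply_eq,
    taylorCoeffAt, smul_eq_mul]

/-- At a zero of the sine the factor `s - q` is absorbed into the difference quotient of the sine,
whose value at `q` is the derivative and hence nonzero, the zero being simple. -/
theorem exists_analyticAt_csc (q : ℂ) :
    ∃ r : ℂ → ℂ, AnalyticAt ℂ r q ∧ ∀ᶠ s in 𝓝[≠] q,
      r s = (s - q) * (Real.pi / Complex.sin (Real.pi * s)) := by
  set S : ℂ → ℂ := fun s => Complex.sin (Real.pi * s) with hS
  have hSa : AnalyticAt ℂ S q := by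
    have : Differentiable ℂ S := by fun_prop
    exact this.analyticAt q
  by_cases h0 : S q = 0
  · have hd : HasDerivAt S (Complex.cos (Real.pi * q) * Real.pi) q := by
      simpa using ((hasDerivAt_id q).const_mul (Real.pi : ℂ)).csin
    have hne : Complex.cos (Real.pi * q) * Real.pi ≠ 0 := by
      refine mul_ne_zero (fun h => ?_) (by exact_mod_cast Real.pi_ne_zero)
      have := Complex.sin_sq_add_cos_sq (Real.pi * q)
      rw [h, show Complex.sin (Real.pi * q) = 0 from h0] at this
      norm_num at this
    have hda : AnalyticAt ℂ (dslope S q) q := by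
      have h1 : DifferentiableOn ℂ (dslope S q) univ :=
        (Complex.differentiableOn_dslope univ_mem).2
          (by fun_prop : Differentiable ℂ S).differentiableOn
      exact h1.analyticAt univ_mem
    refine ⟨fun s => Real.pi / dslope S q s, analyticAt_const.div hda ?_, ?_⟩
    · rw [dslope_same, hd.deriv]; exact hne
    · filter_upwards [self_mem_nhdsWithin] with s hs
      rw [dslope_of_ne _ hs, slope_def_field, h0, sub_zero]
      simp only [hS]
      have hs' : s - q ≠ 0 := sub_ne_zero.2 hs
      field_simp
  · refine ⟨fun s => (s - q) * (Real.pi / S s), ?_, Eventually.of_forall fun s => rfl⟩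
    exact (analyticAt_id.sub analyticAt_const).mul (analyticAt_const.div hSa h0)

theorem analyticAt_regularizedCsc (q : ℂ) : AnalyticAt ℂ (regularizedCsc q) q := by
  obtain ⟨r, hr, he⟩ := exists_analyticAt_csc q
  refine hr.congr ?_
  have hlim : limUnder (𝓝[≠] q) (fun s => (s - q) * (Real.pi / Complex.sin (Real.pi * s))) = r q :=
    ((hr.continuousAt.tendsto.mono_left nhdsWithin_le_nhds).congr' he).limUnder_eq
  rw [eventually_nhdsWithin_iff] at he
  filter_upwards [he] with s hs
  by_cases h : s = q
  · rw [h, regularizedCsc, Function.update_self, hlim]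
  · rw [regularizedCsc, Function.update_of_ne h, hs h]

theorem regularizedCsc_of_ne {q s : ℂ} (h : s ≠ q) :
    regularizedCsc q s = (s - q) * (Real.pi / Complex.sin (Real.pi * s)) := by
  rw [regularizedCsc, Function.update_of_ne h]

/-- Cauchy's estimate in a cone. -/
theorem eventually_norm_iteratedDeriv_le_of_isBigO {κ : ℝ} (hκ : 0 < κ) (hκ1 : κ ≤ 1) {q : ℂ}
    {h : ℂ → ℂ} (n : ℕ) (hd : ∀ᶠ s in 𝓝 q, s ∈ rightCone κ q → DifferentiableAt ℂ h s)
    (hO : h =O[𝓝[rightCone κ q] q] fun s => ‖s - q‖ ^ n) :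
    ∃ C : ℝ, ∀ᶠ s in 𝓝 q, q.re < s.re → ‖iteratedDeriv n h s‖ ≤ C := by
  obtain ⟨C, hC⟩ := hO.bound
  rw [eventually_nhdsWithin_iff] at hC
  obtain ⟨r, hr, hball⟩ := Metric.eventually_nhds_iff_ball.1 (hd.and hC)
  have hC0 : ∀ s ∈ Metric.ball q r, s ∈ rightCone κ q → ‖h s‖ ≤ |C| * ‖s - q‖ ^ n :=
    fun s hs hc => by
      have := (hball s hs).2 hc
      rw [norm_pow, norm_norm] at this
      exact this.trans (mul_le_mul_of_nonneg_right (le_abs_self C) (by positivity))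
  refine ⟨n.factorial * (|C| * 2 ^ n) / (κ / 2) ^ n, ?_⟩
  filter_upwards [Metric.ball_mem_nhds q (half_pos hr)] with s hs hre
  rw [mem_ball_iff_norm] at hs
  have hpos : 0 < ‖s - q‖ := norm_pos_iff.2 (sub_ne_zero.2 fun h => by simp [h] at hre)
  -- Since `Re (s - q) > 0`, this disc stays in the cone. Its radius is proportional to `‖s - q‖`,
  -- so in Cauchy's estimate the power `‖s - q‖ ^ n` cancels.
  have hsub : ∀ z ∈ Metric.closedBall s (κ / 2 * ‖s - q‖),
      z ∈ Metric.ball q r ∧ z ∈ rightCone κ q ∧ ‖z - q‖ ≤ 2 * ‖s - q‖ := fun z hz => by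
    rw [mem_closedBall_iff_norm] at hz
    have h1 : ‖z - q‖ ≤ ‖z - s‖ + ‖s - q‖ := by
      simpa using norm_add_le (z - s) (s - q)
    have h2 : ‖s - q‖ ≤ ‖z - s‖ + ‖z - q‖ := by
      have := norm_add_le (s - z) (z - q)
      rwa [norm_sub_rev s z, sub_add_sub_cancel] at this
    have h3 : |(z - s).re| ≤ κ / 2 * ‖s - q‖ := (Complex.abs_re_le_norm _).trans hz
    rw [Complex.sub_re, abs_le] at h3
    refine ⟨?_, ?_, by nlinarith⟩
    · rw [mem_ball_iff_norm]; nlinarith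
    · change -κ * ‖z - q‖ < (z - q).re
      rw [Complex.sub_re]
      have h4 : ‖s - q‖ ≤ 2 * ‖z - q‖ := by nlinarith
      nlinarith
  have hR : 0 < κ / 2 * ‖s - q‖ := by positivity
  refine (Complex.norm_iteratedDeriv_le_of_forall_mem_sphere_norm_le (R := κ / 2 * ‖s - q‖)
    (C := |C| * (2 * ‖s - q‖) ^ n) n hR ?_ fun z hz => ?_).trans (le_of_eq ?_)
  · refine DifferentiableOn.diffContOnCl fun z hz => ?_
    rw [closure_ball _ hR.ne'] at hz
    exact ((hball z (hsub z hz).1).1 (hsub z hz).2.1).differentiableWithinAt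
  · have := hsub z (Metric.sphere_subset_closedBall hz)
    refine (hC0 z this.1 this.2.1).trans ?_
    have := this.2.2
    gcongr
  · rw [mul_pow, mul_pow]
    field_simp

/-- A function that is locally bounded at the closed left side of a strip is bounded on some strip. -/
theorem exists_bound_strip {f : ℂ → ℂ} {σ T : ℝ}
    (h : ∀ p : ℂ, p.re = σ → |p.im| ≤ T → ∃ C : ℝ, ∀ᶠ s in 𝓝 p, σ < s.re → ‖f s‖ ≤ C) :
    ∃ C : ℝ, ∃ b' > σ, ∀ s : ℂ, σ < s.re → s.re < b' → |s.im| ≤ T → ‖f s‖ ≤ C := by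
  have hK : IsCompact ({σ} ×ℂ Icc (-T) T) := isCompact_singleton.reProdIm isCompact_Icc
  have key : ∃ C : ℝ, ∃ U : Set ℂ, IsOpen U ∧ {σ} ×ℂ Icc (-T) T ⊆ U ∧
      ∀ s ∈ U, σ < s.re → ‖f s‖ ≤ C := by
    refine hK.induction_on (p := fun K => ∃ C : ℝ, ∃ U : Set ℂ, IsOpen U ∧ K ⊆ U ∧
      ∀ s ∈ U, σ < s.re → ‖f s‖ ≤ C) ⟨0, ∅, isOpen_empty, le_rfl, by simp⟩ ?_ ?_ ?_
    · rintro s t hst ⟨C, U, hU, htU, hb⟩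
      exact ⟨C, U, hU, hst.trans htU, hb⟩
    · rintro s t ⟨C, U, hU, hsU, hb⟩ ⟨C', U', hU', htU', hb'⟩
      refine ⟨max C C', U ∪ U', hU.union hU', union_subset_union hsU htU', ?_⟩
      rintro z (hz | hz) hre
      · exact (hb z hz hre).trans (le_max_left _ _)
      · exact (hb' z hz hre).trans (le_max_right _ _)
    · intro p hp
      rw [Complex.mem_reProdIm] at hp
      obtain ⟨C, hC⟩ := h p hp.1 (abs_le.2 hp.2)
      obtain ⟨U, hU, hUo, hpU⟩ := eventually_nhds_iff.1 hC
      exact ⟨U, mem_nhdsWithin_of_mem_nhds (hUo.mem_nhds hpU), C, U, hUo, le_rfl, hU⟩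
  obtain ⟨C, U, hU, hKU, hb⟩ := key
  -- A uniform neighbourhood of the compact segment contains the part of a strip of width `δ` at
  -- these heights.
  obtain ⟨δ, hδ, hsub⟩ := hK.exists_thickening_subset_open hU hKU
  refine ⟨C, σ + δ, by linarith, fun s h1 h2 h3 => hb s (hsub ?_) h1⟩
  rw [Metric.mem_thickening_iff]
  refine ⟨⟨σ, s.im⟩, ?_, ?_⟩
  · rw [Complex.mem_reProdIm]; exact ⟨rfl, abs_le.1 h3⟩
  · rw [Complex.dist_of_im_eq (z := s) (w := ⟨σ, s.im⟩) rfl, Real.dist_eq, abs_of_pos (by simpa using h1)]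
    simp only; linarith

/-! ### Truncated expansion at a branch point -/

/-- The pairs `(k, j)` with `k < K` and `-1 ≤ j < J - 1`. -/
def expansionIndex (K J : ℕ) : Finset (ℕ × ℤ) :=
  Finset.range K ×ˢ Finset.Ico (-1 : ℤ) (J - 1)

theorem sum_expansionIndex (K J : ℕ) (f : ℕ × ℤ → ℂ) :
    ∑ p ∈ expansionIndex K J, f p =
      ∑ k ∈ Finset.range K, ∑ i ∈ Finset.range J, f (k, (i : ℤ) - 1) := by
  rw [expansionIndex, Finset.sum_product]
  refine Finset.sum_congr rfl fun k _ => ?_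
  refine Finset.sum_nbij' (fun j => (j + 1).toNat) (fun i => (i : ℤ) - 1) ?_ ?_ ?_ ?_ ?_
  · intro j hj
    simp only [Finset.mem_Ico, Finset.mem_range] at hj ⊢
    omega
  · intro i hi
    simp only [Finset.mem_Ico, Finset.mem_range] at hi ⊢
    omega
  · intro j hj
    simp only [Finset.mem_Ico] at hj
    omega
  · intro i hi
    simp
  · intro j hj
    simp only [Finset.mem_Ico] at hj
    congr 2
    omega

theorem cscCoeff_sub_one (q : ℂ) (i : ℕ) :
    cscCoeff q ((i : ℤ) - 1) = taylorCoeffAt (regularizedCsc q) q i := by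
  rw [cscCoeff, if_neg (by omega)]
  congr 1
  omega

/-- The truncated expansion of `φ(s) π / sin (π s)` at a singularity of algebraic type. -/
def localExpansion (q lam θ : ℂ) (ψ : ℂ → ℂ) (S : Finset (ℕ × ℤ)) (s : ℂ) : ℂ :=
  ∑ p ∈ S, taylorCoeffAt ψ 0 p.1 * cscCoeff q p.2 * (s - q) ^ (θ * p.1 + p.2 - lam)

theorem localExpansion_expansionIndex {q s : ℂ} (hs : s ≠ q) (lam θ : ℂ) (ψ : ℂ → ℂ) (K J : ℕ) :
    localExpansion q lam θ ψ (expansionIndex K J) s = (s - q) ^ (-lam) * (s - q)⁻¹ *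
      ((∑ k ∈ Finset.range K, taylorCoeffAt ψ 0 k * ((s - q) ^ θ) ^ k) *
        ∑ i ∈ Finset.range J, taylorCoeffAt (regularizedCsc q) q i * (s - q) ^ i) := by
  have hw : s - q ≠ 0 := sub_ne_zero.2 hs
  rw [localExpansion, sum_expansionIndex, Finset.sum_mul_sum, Finset.mul_sum]
  refine Finset.sum_congr rfl fun k _ => ?_
  rw [Finset.mul_sum]
  refine Finset.sum_congr rfl fun i _ => ?_
  have h : (s - q) ^ (θ * k + ((i : ℤ) - 1 : ℤ) - lam) =
      (s - q) ^ (-lam) * (s - q)⁻¹ * ((s - q) ^ θ) ^ k * (s - q) ^ i := by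
    rw [show θ * k + ((i : ℤ) - 1 : ℤ) - lam = -lam + (-1) + k * θ + i by push_cast; ring,
      Complex.cpow_add _ _ hw, Complex.cpow_add _ _ hw, Complex.cpow_add _ _ hw,
      Complex.cpow_neg_one, Complex.cpow_nat_mul, Complex.cpow_natCast]
  simp only [cscCoeff_sub_one, h]
  ring

theorem isBigO_cpow_rightCone (κ : ℝ) (q a : ℂ) :
    (fun s : ℂ => (s - q) ^ a) =O[𝓝[rightCone κ q] q] fun s => ‖s - q‖ ^ a.re := by
  refine IsBigO.of_bound (Real.exp (Real.pi * |a.im|)) ?_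
  filter_upwards [self_mem_nhdsWithin] with s hs
  have hw : s - q ≠ 0 := sub_ne_zero.2 (ne_of_mem_rightCone hs)
  rw [Complex.norm_cpow_of_ne_zero hw, Real.norm_of_nonneg (by positivity), div_eq_mul_inv,
    ← Real.exp_neg, mul_comm]
  gcongr
  refine (neg_le_abs _).trans ?_
  rw [abs_mul]
  exact mul_le_mul_of_nonneg_right (Complex.abs_arg_le_pi _) (abs_nonneg _)

theorem tendsto_norm_sub_rightCone (κ : ℝ) (q : ℂ) :
    Tendsto (fun s : ℂ => ‖s - q‖) (𝓝[rightCone κ q] q) (𝓝 0) := by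
  have : ContinuousAt (fun s : ℂ => ‖s - q‖) q := by fun_prop
  simpa [ContinuousAt] using this.mono_left (nhdsWithin_le_nhds (s := rightCone κ q))

theorem isBigO_rpow_rpow_rightCone (κ : ℝ) (q : ℂ) {x y : ℝ} (h : y ≤ x) :
    (fun s : ℂ => ‖s - q‖ ^ x) =O[𝓝[rightCone κ q] q] fun s => ‖s - q‖ ^ y := by
  refine IsBigO.of_bound 1 ?_
  filter_upwards [self_mem_nhdsWithin, (tendsto_norm_sub_rightCone κ q).eventually_le_const
    one_pos] with s hs h1
  have hw : 0 < ‖s - q‖ := norm_pos_iff.2 (sub_ne_zero.2 (ne_of_mem_rightCone hs))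
  rw [Real.norm_of_nonneg (by positivity), Real.norm_of_nonneg (by positivity), one_mul]
  exact Real.rpow_le_rpow_of_exponent_ge hw h1 h

/-- Taylor's theorem for `ψ` in the variable `(s - q) ^ θ` and for the regularised cosecant in `s -
q`. Errors of order `n + 1 + Re lam` are demanded because the prefactor `(s - q) ^ (-lam) (s - q)⁻¹`
costs `1 + Re lam`. -/
theorem isBigO_sub_localExpansion {κ : ℝ} {q lam θ : ℂ} {φ ψ : ℂ → ℂ} (hθ : 0 < θ.re)
    (hψ : AnalyticAt ℂ ψ 0)
    (hloc : ∀ᶠ s in 𝓝[rightCone κ q] q, φ s = (s - q) ^ (-lam) * ψ ((s - q) ^ θ))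
    {n K J : ℕ} (hK : n + 1 + lam.re ≤ θ.re * K) (hJ : n + 1 + lam.re ≤ J) :
    (fun s => φ s * (Real.pi / Complex.sin (Real.pi * s)) -
      localExpansion q lam θ ψ (expansionIndex K J) s) =O[𝓝[rightCone κ q] q]
        fun s => ‖s - q‖ ^ n := by
  set l := 𝓝[rightCone κ q] q with hl
  have hw0 : Tendsto (fun s : ℂ => s - q) l (𝓝 0) :=
    tendsto_zero_iff_norm_tendsto_zero.2 (tendsto_norm_sub_rightCone κ q)
  have hvO := isBigO_cpow_rightCone κ q θ
  have hv0 : Tendsto (fun s : ℂ => (s - q) ^ θ) l (𝓝 0) := by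
    refine hvO.trans_tendsto ?_
    have := (Real.continuousAt_rpow_const 0 θ.re (Or.inr hθ.le)).tendsto.comp
      (tendsto_norm_sub_rightCone κ q)
    rwa [Real.zero_rpow hθ.ne'] at this
  set P : ℂ → ℂ := fun v => ∑ k ∈ Finset.range K, taylorCoeffAt ψ 0 k * v ^ k with hP
  set Q : ℂ → ℂ := fun w => ∑ i ∈ Finset.range J, taylorCoeffAt (regularizedCsc q) q i * w ^ i
    with hQ
  have hA : (fun s => ψ ((s - q) ^ θ) - P ((s - q) ^ θ)) =O[l] fun s => ‖s - q‖ ^ (n + 1 + lam.re) := by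
    have h1 := (isBigO_sub_taylor hψ K).comp_tendsto hv0
    simp only [Function.comp_def, zero_add] at h1
    refine h1.trans ((hvO.norm_left.pow K).trans ?_)
    refine (IsBigO.of_bound 1 (Eventually.of_forall fun s => ?_)).trans
      (isBigO_rpow_rpow_rightCone κ q hK)
    rw [← Real.rpow_natCast, ← Real.rpow_mul (norm_nonneg _), one_mul]
  have hB : (fun s => regularizedCsc q s - Q (s - q)) =O[l] fun s => ‖s - q‖ ^ (n + 1 + lam.re) := by
    have h1 := (isBigO_sub_taylor (analyticAt_regularizedCsc q) J).comp_tendsto hw0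
    simp only [Function.comp_def, add_sub_cancel] at h1
    refine h1.trans ?_
    refine (IsBigO.of_bound 1 (Eventually.of_forall fun s => ?_)).trans
      (isBigO_rpow_rpow_rightCone κ q hJ)
    rw [← Real.rpow_natCast, one_mul]
  have hρ : (fun s => regularizedCsc q s) =O[l] fun _ => (1 : ℝ) :=
    ((analyticAt_regularizedCsc q).continuousAt.tendsto.mono_left nhdsWithin_le_nhds).isBigO_one ℝ
  have hP1 : (fun s => P ((s - q) ^ θ)) =O[l] fun _ => (1 : ℝ) := by
    have hc : Continuous P := by fun_prop
    exact ((hc.tendsto 0).comp hv0).isBigO_one ℝ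
  have hAB : (fun s => ψ ((s - q) ^ θ) * regularizedCsc q s - P ((s - q) ^ θ) * Q (s - q)) =O[l]
      fun s => ‖s - q‖ ^ (n + 1 + lam.re) := by
    have h1 := (hρ.mul hA).add (hP1.mul hB)
    simp only [one_mul] at h1
    refine (isBigO_refl _ _).congr_left (fun s => ?_) |>.trans h1
    ring
  have hw1 := isBigO_cpow_rightCone κ q (-lam)
  have hw2 := isBigO_cpow_rightCone κ q (-1)
  have htot := (hw1.mul hw2).mul hAB
  refine (htot.congr' ?_ ?_)
  · filter_upwards [hloc, self_mem_nhdsWithin] with s hs hc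
    have hne := ne_of_mem_rightCone hc
    have hw : s - q ≠ 0 := sub_ne_zero.2 hne
    rw [localExpansion_expansionIndex hne, hs, regularizedCsc_of_ne hne, Complex.cpow_neg_one]
    simp only [hP, hQ]
    field_simp
  · filter_upwards [self_mem_nhdsWithin] with s hc
    have hw : 0 < ‖s - q‖ := norm_pos_iff.2 (sub_ne_zero.2 (ne_of_mem_rightCone hc))
    rw [← Real.rpow_add hw, ← Real.rpow_add hw, ← Real.rpow_natCast]
    congr 1
    simp
    ring

/-! ### Bounds for the cosecant -/

theorem sin_pi_mul_eq_zero_iff (s : ℂ) : Complex.sin (Real.pi * s) = 0 ↔ ∃ k : ℤ, s = k := by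
  have hpi : (Real.pi : ℂ) ≠ 0 := by exact_mod_cast Real.pi_ne_zero
  rw [Complex.sin_eq_zero_iff]
  refine exists_congr fun k => ⟨fun h => ?_, fun h => by rw [h, mul_comm]⟩
  exact mul_left_cancel₀ hpi (by rw [h, mul_comm])

theorem norm_csc_le_of_one_le {s : ℂ} (hs : 1 ≤ |s.im|) :
    ‖(Real.pi : ℂ) / Complex.sin (Real.pi * s)‖ ≤ 16 * Real.exp (-Real.pi * |s.im|) := by
  have hpi := Real.pi_gt_three
  have hpi' := Real.pi_le_four
  have key : ∀ y : ℝ, 0 ≤ y → 3 ≤ y → Real.exp y / 4 ≤ (Real.exp y - Real.exp (-y)) / 2 :=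
    fun y h0 h3 => by
      have h1 : Real.exp (-y) ≤ 1 := Real.exp_le_one_iff.2 (by linarith)
      have h2 := Real.add_one_le_exp y
      linarith
  -- The reverse triangle inequality gives `sinh (π |Im s|)`, and `π |Im s| ≥ 3` leaves half of its
  -- leading term. The constant `16` then comes from `π ≤ 4`.
  have hsin : Real.exp (Real.pi * |s.im|) / 4 ≤ ‖Complex.sin (Real.pi * s)‖ := by
    refine (key _ (by positivity) (by nlinarith)).trans ?_
    have h2 : ‖Complex.sin (Real.pi * s)‖ = ‖Complex.exp (-(Real.pi * s) * Complex.I) -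
        Complex.exp (Real.pi * s * Complex.I)‖ / 2 := by
      rw [Complex.sin, norm_div, norm_mul, Complex.norm_I, mul_one]
      norm_num
    have h3 : ‖Complex.exp (-(Real.pi * s) * Complex.I)‖ = Real.exp (Real.pi * s.im) := by
      rw [Complex.norm_exp]; simp
    have h4 : ‖Complex.exp (Real.pi * s * Complex.I)‖ = Real.exp (-(Real.pi * s.im)) := by
      rw [Complex.norm_exp]; simp
    rw [h2]
    have h5 := abs_norm_sub_norm_le (Complex.exp (-(Real.pi * s) * Complex.I))
      (Complex.exp (Real.pi * s * Complex.I))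
    rw [h3, h4] at h5
    rcases abs_cases s.im with ⟨h, _⟩ | ⟨h, _⟩ <;> rw [h]
    · linarith [le_abs_self (Real.exp (Real.pi * s.im) - Real.exp (-(Real.pi * s.im)))]
    · rw [mul_neg, neg_neg]
      linarith [neg_abs_le (Real.exp (Real.pi * s.im) - Real.exp (-(Real.pi * s.im)))]
  have hpos : 0 < Real.exp (Real.pi * |s.im|) / 4 := by positivity
  rw [norm_div, Complex.norm_real, Real.norm_of_nonneg Real.pi_pos.le, neg_mul, Real.exp_neg,
    div_le_iff₀ (hpos.trans_le hsin)]
  calc Real.pi ≤ 16 * (Real.exp (Real.pi * |s.im|))⁻¹ * (Real.exp (Real.pi * |s.im|) / 4) := by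
        field_simp; linarith
    _ ≤ _ := by gcongr

/-- From `Re sin (π s) = sin (π Re s) cosh (π Im s)`. In contrast to the bound for `|Im s| ≥ 1` this
holds on whole vertical lines, and its constant is the same on lines that differ by an integer. -/
theorem norm_csc_le {s : ℂ} (hs : Real.sin (Real.pi * s.re) ≠ 0) :
    ‖(Real.pi : ℂ) / Complex.sin (Real.pi * s)‖ ≤
      2 * Real.pi / |Real.sin (Real.pi * s.re)| * Real.exp (-Real.pi * |s.im|) := by
  have hpos : 0 < |Real.sin (Real.pi * s.re)| := abs_pos.2 hs
  have h1 : (Complex.sin (Real.pi * s)).re = Real.sin (Real.pi * s.re) * Real.cosh (Real.pi * s.im) := by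
    rw [Complex.sin_eq, Complex.re_ofReal_mul, Complex.im_ofReal_mul, ← Complex.ofReal_sin,
      ← Complex.ofReal_cos, ← Complex.ofReal_cosh, ← Complex.ofReal_sinh]
    simp only [Complex.add_re, Complex.mul_re, Complex.ofReal_re, Complex.ofReal_im, Complex.I_re,
      Complex.I_im, Complex.mul_im]
    ring
  have h2 : Real.exp (Real.pi * |s.im|) / 2 ≤ Real.cosh (Real.pi * s.im) := by
    rw [← Real.cosh_abs, abs_mul, abs_of_pos Real.pi_pos, Real.cosh_eq]
    linarith [Real.exp_pos (-(Real.pi * |s.im|))]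
  have h3 : |Real.sin (Real.pi * s.re)| * (Real.exp (Real.pi * |s.im|) / 2) ≤
      ‖Complex.sin (Real.pi * s)‖ := by
    refine le_trans ?_ (Complex.abs_re_le_norm _)
    rw [h1, abs_mul, abs_of_pos (Real.cosh_pos _)]
    gcongr
  have h4 : 0 < |Real.sin (Real.pi * s.re)| * (Real.exp (Real.pi * |s.im|) / 2) := by positivity
  rw [norm_div, Complex.norm_real, Real.norm_of_nonneg Real.pi_pos.le, neg_mul, Real.exp_neg,
    div_le_iff₀ (h4.trans_le h3)]
  calc Real.pi = 2 * Real.pi / |Real.sin (Real.pi * s.re)| * (Real.exp (Real.pi * |s.im|))⁻¹ *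
      (|Real.sin (Real.pi * s.re)| * (Real.exp (Real.pi * |s.im|) / 2)) := by field_simp
    _ ≤ _ := by gcongr

/-! ### Holomorphy in `L` and rotation of the contour -/

theorem SlantedExpBound.rayBound {η v y σ b T : ℝ} {f : ℂ → ℂ}
    (hf : SlantedExpBound η v y σ b T f) (hη : 0 ≤ η) (hη1 : η ≤ 1) :
    ∃ B : ℝ, ∀ e : ℝ, e * e = 1 →
      RayBound (e * Complex.I - η) f (slantedRegion e η v y) B := by
  obtain ⟨C, B, hC, hB, h⟩ := hf.bound
  exact ⟨2 * B, fun e he =>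
    { isOpen := isOpen_slantedRegion e η v y
      diff := hf.diff e he
      ray := fun s hs t ht => add_mem_slantedRegion he hs ht
      bound := by
        refine ⟨fun s => C * Real.exp (B * ‖s‖), by fun_prop, fun s hs t ht => ?_⟩
        refine (h e he _ (add_mem_slantedRegion he hs ht)).trans ?_
        rw [mul_assoc, ← Real.exp_add]
        gcongr
        nlinarith [norm_ray_le he hη hη1 s ht] }⟩

/-- The condition for decay is open in `L`; half of the available rate serves as a majorant on a
small disc. -/
theorem RayBound.differentiableAt_rayIntegral {u : ℂ} {f : ℂ → ℂ} {U : Set ℂ} {B : ℝ}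
    (h : RayBound u f U B) {p : ℂ} (hp : p ∈ U) {L : ℂ} (hL : B + (u * L).re < 0) :
    DifferentiableAt ℂ (fun L => rayIntegral u (fun s => f s * Complex.exp (s * L)) p) L := by
  obtain ⟨K, -, hb⟩ := h.bound
  set ε : ℝ := -(B + (u * L).re) / 2 with hε
  have hev : ∀ᶠ L' in 𝓝 L, B + (u * L').re < -ε ∧ (p * L').re < (p * L).re + 1 := by
    have h1 : Continuous fun L' : ℂ => B + (u * L').re := by fun_prop
    have h2 : Continuous fun L' : ℂ => (p * L').re := by fun_prop
    exact ((h1.tendsto L).eventually_lt_const (by rw [hε]; linarith)).and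
      ((h2.tendsto L).eventually_lt_const (by linarith))
  obtain ⟨r, hr, hball⟩ := Metric.eventually_nhds_iff_ball.1 hev
  have hK : 0 ≤ K p := by
    have := (norm_nonneg _).trans (hb p hp 0 le_rfl)
    simpa using this
  refine (hasDerivAt_integral_of_holomorphic (μ := (volume : Measure ℝ).restrict (Ioi 0))
    (F := fun (L : ℂ) (t : ℝ) => f (p + t * u) * Complex.exp ((p + t * u) * L) * u)
    (bound := fun t => K p * Real.exp ((p * L).re + 1) * ‖u‖ * Real.exp (-ε * t))
    (Metric.isOpen_ball (x := L) (ε := r))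
    (fun L' hL' => ?_) (Eventually.of_forall fun t => by fun_prop) ?_ ?_
    (Metric.mem_ball_self hr)).2.differentiableAt
  · have := (h.rayDecay (L := L') (by linarith [(hball L' hL').1])).integrableOn hp
    exact (this.mul_const u).aestronglyMeasurable
  · filter_upwards [ae_restrict_mem measurableSet_Ioi] with t ht L' hL'
    have ht0 : 0 < t := ht
    have h1 := hb p hp t ht0.le
    have h2 := hball L' hL'
    rw [norm_mul, norm_mul, Complex.norm_exp]
    have h3 : ((p + t * u) * L').re ≤ (p * L).re + 1 + t * (-ε - B) := by
      rw [add_mul, Complex.add_re, mul_assoc, Complex.re_ofReal_mul]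
      nlinarith [h2.1, h2.2]
    calc _ ≤ K p * Real.exp (B * t) * Real.exp ((p * L).re + 1 + t * (-ε - B)) * ‖u‖ := by
          refine mul_le_mul_of_nonneg_right (mul_le_mul h1 (Real.exp_le_exp.2 h3)
            (Real.exp_pos _).le (by positivity)) (norm_nonneg _)
      _ = _ := by
          have h4 : Real.exp (B * t) * Real.exp ((p * L).re + 1 + t * (-ε - B)) =
              Real.exp ((p * L).re + 1) * Real.exp (-ε * t) := by
            rw [← Real.exp_add, ← Real.exp_add]; ring_nf
          linear_combination (K p * ‖u‖) * h4
  · refine (integrableOn_exp_mul_Ioi ?_ 0).const_mul _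
    rw [hε]; linarith

theorem differentiableAt_contourIntegral {η T x B : ℝ} {g : ℂ → ℂ} {V W : Set ℂ} (hT : 0 ≤ T)
    (hV : RayBound (Complex.I - η) g V B) (hW : RayBound (-Complex.I - η) g W B)
    (hp : (x + T * Complex.I : ℂ) ∈ V) (hp' : (x + (-T : ℝ) * Complex.I : ℂ) ∈ W)
    (hg : ∀ y : ℝ, |y| ≤ T → AnalyticAt ℂ g (x + y * Complex.I)) {L : ℂ}
    (hL : B + ((Complex.I - η) * L).re < 0) (hL' : B + ((-Complex.I - η) * L).re < 0) :
    DifferentiableAt ℂ (fun L => contourIntegral η T (fun s => g s * Complex.exp (s * L)) x) L := by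
  refine ((hV.differentiableAt_rayIntegral hp hL).sub
    (hW.differentiableAt_rayIntegral hp' hL')).add ?_
  have hTT : -T ≤ T := by linarith
  simp only [intervalIntegral.integral_of_le hTT]
  have hcont : ContinuousOn (fun y : ℝ => g (x + y * Complex.I)) (Icc (-T) T) := fun y hy =>
    (ContinuousAt.comp (f := fun y : ℝ => (x : ℂ) + y * Complex.I)
      (hg y (abs_le.2 hy)).continuousAt (by fun_prop)).continuousWithinAt
  refine (hasDerivAt_integral_of_holomorphic (μ := (volume : Measure ℝ).restrict (Ioc (-T) T))
    (F := fun (L : ℂ) (y : ℝ) => g (x + y * Complex.I) * Complex.exp ((x + y * Complex.I) * L) *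
      Complex.I)
    (bound := fun y => ‖g (x + y * Complex.I)‖ *
      Real.exp (‖(x + y * Complex.I : ℂ)‖ * (‖L‖ + 1)))
    (Metric.isOpen_ball (x := L) (ε := 1))
    (fun L' hL' => ?_) (Eventually.of_forall fun t => by fun_prop)
    (Eventually.of_forall fun y L' hL' => ?_) ?_ (Metric.mem_ball_self one_pos)).2.differentiableAt
  · exact (((hcont.mono Ioc_subset_Icc_self).mul (by fun_prop)).mul
      continuousOn_const).aestronglyMeasurable measurableSet_Ioc
  · rw [norm_mul, norm_mul, Complex.norm_exp, Complex.norm_I, mul_one]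
    refine mul_le_mul_of_nonneg_left (Real.exp_le_exp.2 ?_) (norm_nonneg _)
    refine (Complex.re_le_norm _).trans ?_
    rw [norm_mul]
    refine mul_le_mul_of_nonneg_left ?_ (norm_nonneg _)
    rw [mem_ball_iff_norm] at hL'
    have := norm_add_le (L' - L) L
    rw [sub_add_cancel] at this
    linarith
  · exact ((hcont.norm.mul (by fun_prop)).integrableOn_Icc).mono_set Ioc_subset_Icc_self

/-- When the vertex moves in the direction `v`, both ray integrals change by the same integral of
`f`. So their difference is constant, and its limit is `0`. -/
theorem rayIntegral_eq_rayIntegral {u u' v p : ℂ} {f : ℂ → ℂ} {V V' : Set ℂ}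
    (h : RayDecay u f V) (h' : RayDecay u' f V') (hp : ∀ t : ℝ, 0 ≤ t → p + t * v ∈ V)
    (hp' : ∀ t : ℝ, 0 ≤ t → p + t * v ∈ V')
    (hl : Tendsto (fun t : ℝ => rayIntegral u f (p + t * v)) atTop (𝓝 0))
    (hl' : Tendsto (fun t : ℝ => rayIntegral u' f (p + t * v)) atTop (𝓝 0)) :
    rayIntegral u f p = rayIntegral u' f p := by
  have key : ∀ t : ℝ, 0 ≤ t → rayIntegral u f p - rayIntegral u' f p =
      rayIntegral u f (p + t * v) - rayIntegral u' f (p + t * v) := fun t ht => by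
    have h1 := h.rayIntegral_sub_rayIntegral (p := p) (v := v) (a := 0) (b := t) (fun y hy => by
      rw [uIcc_of_le ht] at hy; exact hp y hy.1)
    have h2 := h'.rayIntegral_sub_rayIntegral (p := p) (v := v) (a := 0) (b := t) (fun y hy => by
      rw [uIcc_of_le ht] at hy; exact hp' y hy.1)
    simp only [Complex.ofReal_zero, zero_mul, add_zero] at h1 h2
    linear_combination h2 - h1
  have h3 : Tendsto (fun _ : ℝ => rayIntegral u f p - rayIntegral u' f p) atTop (𝓝 (0 - 0)) :=
    (hl.sub hl').congr' (by
      filter_upwards [eventually_ge_atTop 0] with t ht using (key t ht).symm)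
  have := tendsto_nhds_unique tendsto_const_nhds h3
  rw [sub_zero] at this
  exact sub_eq_zero.1 this

/-- `φ` is holomorphic to the right of a contour, with at most exponential growth of type `A`. -/
structure CutPlaneBound (φ : ℂ → ℂ) (σ A η v y C : ℝ) : Prop where
  right : DifferentiableOn ℂ φ {s | σ < s.re}
  slanted : ∀ e : ℝ, e * e = 1 → DifferentiableOn ℂ φ (slantedRegion e η v y)
  bound : ∀ e : ℝ, e * e = 1 → ∀ s ∈ slantedRegion e η v y ∪ slantedRegion e 0 σ y,
    ‖φ s‖ ≤ C * Real.exp (A * ‖s‖)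
  bound_right : ∀ c > σ, ∃ C', 0 ≤ C' ∧ ∀ s : ℂ, c ≤ s.re → ‖φ s‖ ≤ C' * Real.exp (A * ‖s‖)
  one_le : 1 ≤ y
  nonneg : 0 ≤ C
  type_pos : 0 < A
  slope_pos : 0 < η
  slope_le : η ≤ 1

/-- The function `φ(s) π / sin (π s)`. -/
def cscKernel (φ : ℂ → ℂ) (s : ℂ) : ℂ := φ s * (Real.pi / Complex.sin (Real.pi * s))

theorem sin_pi_mul_ne_zero_of_im {s : ℂ} (h : s.im ≠ 0) : Complex.sin (Real.pi * s) ≠ 0 := by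
  rw [Ne, sin_pi_mul_eq_zero_iff]
  rintro ⟨k, rfl⟩
  simp at h

theorem sin_pi_mul_ne_zero_of_re {s : ℂ} {n : ℤ} (h : (n : ℝ) < s.re) (h' : s.re < n + 1) :
    Complex.sin (Real.pi * s) ≠ 0 := by
  rw [Ne, sin_pi_mul_eq_zero_iff]
  rintro ⟨k, rfl⟩
  rw [Complex.intCast_re] at h h'
  have h1 : n < k := by exact_mod_cast h
  have h2 : k < n + 1 := by exact_mod_cast h'
  omega

theorem analyticAt_cscKernel {φ : ℂ → ℂ} {s : ℂ} (h : AnalyticAt ℂ φ s)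
    (hs : Complex.sin (Real.pi * s) ≠ 0) : AnalyticAt ℂ (cscKernel φ) s := by
  have : Differentiable ℂ fun s : ℂ => Complex.sin (Real.pi * s) := by fun_prop
  exact h.mul (analyticAt_const.div (this.analyticAt s) hs)

theorem isOpen_re_gt (σ : ℝ) : IsOpen {s : ℂ | σ < s.re} :=
  isOpen_lt continuous_const Complex.continuous_re

theorem abs_eq_one_of_mul_self {e : ℝ} (he : e * e = 1) : |e| = 1 := by
  rw [← sq_eq_sq₀ (abs_nonneg e) one_pos.le, sq_abs]; linarith [he, sq e]

theorem lt_abs_im_of_mem_slantedRegion {e η v y : ℝ} (he : e * e = 1) {s : ℂ}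
    (hs : s ∈ slantedRegion e η v y) : y < |s.im| := by
  have h : y < e * s.im := hs.2
  refine h.trans_le ((le_abs_self _).trans ?_)
  rw [abs_mul, abs_eq_one_of_mul_self he, one_mul]

namespace CutPlaneBound

variable {φ : ℂ → ℂ} {σ A η v y C : ℝ}

theorem analyticAt (h : CutPlaneBound φ σ A η v y C) {s : ℂ} (hs : σ < s.re) :
    AnalyticAt ℂ φ s :=
  h.right.analyticAt ((isOpen_re_gt σ).mem_nhds hs)

theorem analyticAt_cscKernel_strip (h : CutPlaneBound φ σ A η v y C) {s : ℂ} (hs : σ < s.re)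
    (hs' : s.re < ⌊σ⌋ + 1) : AnalyticAt ℂ (cscKernel φ) s :=
  analyticAt_cscKernel (h.analyticAt hs)
    (sin_pi_mul_ne_zero_of_re ((Int.floor_le σ).trans_lt hs) hs')

theorem norm_cscKernel_le (h : CutPlaneBound φ σ A η v y C) {e : ℝ} (he : e * e = 1) {s : ℂ}
    (hs : s ∈ slantedRegion e η v y ∪ slantedRegion e 0 σ y) :
    ‖cscKernel φ s‖ ≤ 16 * C * Real.exp (A * ‖s‖ - Real.pi * |s.im|) := by
  have h1 : 1 ≤ |s.im| := by
    rcases hs with hs | hs <;> exact h.one_le.trans (lt_abs_im_of_mem_slantedRegion he hs).le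
  rw [cscKernel, norm_mul]
  refine (mul_le_mul (h.bound e he s hs) (norm_csc_le_of_one_le h1) (norm_nonneg _)
    (mul_nonneg h.nonneg (Real.exp_pos _).le)).trans (le_of_eq ?_)
  rw [sub_eq_add_neg, Real.exp_add, neg_mul]
  ring

theorem slantedExpBound (h : CutPlaneBound φ σ A η v y C) (T : ℝ) :
    SlantedExpBound η v y σ (⌊σ⌋ + 1) T (cscKernel φ) where
  diff := fun e he s hs => by
    have him : s.im ≠ 0 := by
      have := (h.one_le.trans (lt_abs_im_of_mem_slantedRegion he hs).le)
      intro h0; rw [h0] at this; norm_num at this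
    exact (analyticAt_cscKernel ((h.slanted e he).analyticAt
      ((isOpen_slantedRegion e η v y).mem_nhds hs))
      (sin_pi_mul_ne_zero_of_im him)).differentiableAt.differentiableWithinAt
  bound := by
    refine ⟨16 * C, A, by linarith [h.nonneg], h.type_pos.le, fun e he s hs => ?_⟩
    refine (h.norm_cscKernel_le he (Or.inl hs)).trans ?_
    have := h.nonneg
    gcongr
    linarith [mul_nonneg Real.pi_pos.le (abs_nonneg s.im)]
  strip := fun s h1 h2 _ => h.analyticAt_cscKernel_strip h1 h2

theorem norm_add_mul_direction_le {e : ℝ} (he : e * e = 1) (s : ℂ) {t : ℝ} (ht : 0 ≤ t) :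
    ‖s + t * (e * Complex.I - (0 : ℝ))‖ ≤ ‖s‖ + t := by
  refine (norm_add_le _ _).trans ?_
  rw [Complex.ofReal_zero, sub_zero, norm_mul, norm_mul, Complex.norm_I, Complex.norm_real,
    Complex.norm_real, Real.norm_eq_abs e, abs_eq_one_of_mul_self he, Real.norm_of_nonneg ht]
  linarith

theorem rayBound_vertical (h : CutPlaneBound φ σ A η v y C) {e : ℝ} (he : e * e = 1) :
    RayBound (e * Complex.I - (0 : ℝ)) (cscKernel φ) (slantedRegion e 0 σ y) (A - Real.pi) where
  isOpen := isOpen_slantedRegion e 0 σ y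
  diff := fun s hs => by
    have him : s.im ≠ 0 := by
      have := (h.one_le.trans (lt_abs_im_of_mem_slantedRegion he hs).le)
      intro h0; rw [h0] at this; norm_num at this
    have hre : σ < s.re := by
      have : σ < s.re + e * 0 * s.im := hs.1
      simpa using this
    exact (analyticAt_cscKernel (h.analyticAt hre)
      (sin_pi_mul_ne_zero_of_im him)).differentiableAt.differentiableWithinAt
  ray := fun s hs t ht => add_mem_slantedRegion he hs ht
  bound := by
    refine ⟨fun s => 16 * C * Real.exp (A * ‖s‖), by fun_prop, fun s hs t ht => ?_⟩
    refine (h.norm_cscKernel_le he (Or.inr (add_mem_slantedRegion he hs ht))).trans ?_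
    have h1 : t ≤ |(s + t * (e * Complex.I - (0 : ℝ))).im| := by
      have h2 : (s + t * (e * Complex.I - (0 : ℝ))).im = e * (e * s.im + t) := by
        simp
        linear_combination -s.im * he
      have h3 : y < e * s.im := hs.2
      have h4 := h.one_le
      rw [h2, abs_mul, abs_eq_one_of_mul_self he, one_mul]
      refine le_trans ?_ (le_abs_self _)
      linarith
    have h2 := norm_add_mul_direction_le he s ht
    have h3 := h.nonneg
    have h4 := h.type_pos
    rw [mul_assoc (16 * C), ← Real.exp_add]
    gcongr
    nlinarith [Real.pi_pos]

/-- Decay of the integrand, uniform in the slope of the ray. -/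
theorem norm_cscKernel_mul_exp_le (h : CutPlaneBound φ σ A η v y C) {e : ℝ} (he : e * e = 1)
    {L : ℂ} (hL : A ≤ L.re) {η' c τ t : ℝ} (hη' : 0 ≤ η') (hτ : 0 ≤ τ)
    (ht : 0 ≤ t) (hm : (c + τ * (e * Complex.I) + t * (e * Complex.I - η') : ℂ) ∈
      slantedRegion e η v y ∪ slantedRegion e 0 σ y) :
    ‖cscKernel φ (c + τ * (e * Complex.I) + t * (e * Complex.I - η')) *
      Complex.exp ((c + τ * (e * Complex.I) + t * (e * Complex.I - η')) * L)‖ ≤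
      16 * C * Real.exp (A * |c| + c * L.re) * Real.exp (-(Real.pi - A - |L.im|) * τ) *
        Real.exp (-(Real.pi - A - |L.im|) * t) := by
  have hA := h.type_pos
  have hC := h.nonneg
  have h1 := h.norm_cscKernel_le he hm
  set s : ℂ := c + τ * (e * Complex.I) + t * (e * Complex.I - η') with hs
  have him : s.im = e * (τ + t) := by simp [hs]; ring
  have hre : s.re = c - η' * t := by simp [hs]; ring
  have habs : |s.im| = τ + t := by
    rw [him, abs_mul, abs_eq_one_of_mul_self he, one_mul, abs_of_nonneg (by linarith)]
  have hnorm : ‖s‖ ≤ |c| + η' * t + (τ + t) := by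
    refine (Complex.norm_le_abs_re_add_abs_im s).trans ?_
    rw [habs, hre]
    have := abs_sub c (η' * t)
    rw [abs_of_nonneg (by positivity : 0 ≤ η' * t)] at this
    linarith
  have h2 : (s * L).re ≤ (c - η' * t) * L.re + (τ + t) * |L.im| := by
    rw [Complex.mul_re, hre]
    have : -(s.im * L.im) ≤ |s.im| * |L.im| := by
      rw [← abs_mul]; exact neg_le_abs _
    rw [habs] at this
    linarith
  rw [norm_mul, Complex.norm_exp]
  calc _ ≤ 16 * C * Real.exp (A * (|c| + η' * t + (τ + t)) - Real.pi * (τ + t)) *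
        Real.exp ((c - η' * t) * L.re + (τ + t) * |L.im|) := by
        refine mul_le_mul (h1.trans ?_) (Real.exp_le_exp.2 h2) (Real.exp_pos _).le (by positivity)
        rw [habs]
        gcongr
    _ = 16 * C * Real.exp (A * (|c| + η' * t + (τ + t)) - Real.pi * (τ + t) +
        ((c - η' * t) * L.re + (τ + t) * |L.im|)) := by rw [mul_assoc, ← Real.exp_add]
    _ ≤ 16 * C * Real.exp (A * |c| + c * L.re + -(Real.pi - A - |L.im|) * τ +
        -(Real.pi - A - |L.im|) * t) := by
        -- The two exponents differ by `η' t (Re L - A)`, which is nonnegative by `hL`. Therefore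
        -- the rate does not depend on the slope `η'`.
        refine mul_le_mul_of_nonneg_left (Real.exp_le_exp.2 ?_) (by positivity)
        nlinarith [mul_nonneg (mul_nonneg hη' ht) (sub_nonneg.2 hL)]
    _ = _ := by rw [Real.exp_add, Real.exp_add]; ring

theorem tendsto_rayIntegral (h : CutPlaneBound φ σ A η v y C) {e : ℝ} (he : e * e = 1)
    {L : ℂ} (hL : A ≤ L.re) (hLim : |L.im| < Real.pi - A) {η' c T : ℝ} (hη' : 0 ≤ η') (hT : 0 ≤ T)
    (hm : ∀ τ t : ℝ, T ≤ τ → 0 ≤ t → (c + τ * (e * Complex.I) + t * (e * Complex.I - η') : ℂ) ∈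
      slantedRegion e η v y ∪ slantedRegion e 0 σ y) :
    Tendsto (fun t : ℝ => rayIntegral (e * Complex.I - η')
      (fun s => cscKernel φ s * Complex.exp (s * L))
      (c + T * (e * Complex.I) + t * (e * Complex.I))) atTop (𝓝 0) := by
  set ε := Real.pi - A - |L.im| with hε
  have hε0 : 0 < ε := by rw [hε]; linarith
  have hb : ∀ t : ℝ, 0 ≤ t → ‖rayIntegral (e * Complex.I - η')
      (fun s => cscKernel φ s * Complex.exp (s * L))
      (c + T * (e * Complex.I) + t * (e * Complex.I))‖ ≤
      16 * C * Real.exp (A * |c| + c * L.re) * Real.exp (-ε * (T + t)) *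
        ‖(e * Complex.I - η' : ℂ)‖ / ε := fun t ht => by
    refine norm_rayIntegral_le hε0 fun t' ht' => ?_
    have := h.norm_cscKernel_mul_exp_le he hL hη' (by linarith : 0 ≤ T + t) ht'.le
      (hm (T + t) t' (by linarith) ht'.le)
    rw [Complex.ofReal_add, add_mul, ← add_assoc] at this
    exact this
  have hlim : Tendsto (fun t : ℝ => 16 * C * Real.exp (A * |c| + c * L.re) *
      Real.exp (-ε * (T + t)) * ‖(e * Complex.I - η' : ℂ)‖ / ε) atTop
      (𝓝 (16 * C * Real.exp (A * |c| + c * L.re) * 0 * ‖(e * Complex.I - η' : ℂ)‖ / ε)) := by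
    refine ((Tendsto.const_mul _ ?_).mul_const _).div_const _
    refine Real.tendsto_exp_atBot.comp ?_
    exact (tendsto_atTop_add_const_left _ T tendsto_id).const_mul_atTop_of_neg (by linarith)
  rw [mul_zero, zero_mul, zero_div] at hlim
  refine squeeze_zero_norm' ?_ hlim
  filter_upwards [eventually_ge_atTop 0] with t ht using hb t ht

/-- The contour may be rotated to a vertical line. -/
theorem contourIntegral_rotate (h : CutPlaneBound φ σ A η v y C) {T c : ℝ} (hc : σ < c)
    (hv : v < σ + η * T) (hy : y < T) :
    ∃ R : ℝ, ∀ L : ℂ, R < η * L.re → |L.im| < Real.pi - A →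
      contourIntegral η T (fun s => cscKernel φ s * Complex.exp (s * L)) c =
        contourIntegral 0 T (fun s => cscKernel φ s * Complex.exp (s * L)) c := by
  obtain ⟨B, hB⟩ := (h.slantedExpBound T).rayBound h.slope_pos.le h.slope_le
  have hη := h.slope_pos
  have hη1 := h.slope_le
  have hA := h.type_pos
  have hT : 0 ≤ T := by linarith [h.one_le]
  refine ⟨max (Real.pi + B) A, fun L hLre hLim => ?_⟩
  rw [max_lt_iff] at hLre
  have hL' : |L.im| ≤ Real.pi := by linarith
  have hLA : A ≤ L.re := by
    by_contra! h3
    have : 0 < L.re := by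
      by_contra! h4; nlinarith
    nlinarith
  -- Instead of closing the wedge by arcs, the common vertex of both rays is sent to infinity
  -- vertically; the uniform decay makes both ray integrals vanish in the limit.
  have key : ∀ e : ℝ, e * e = 1 →
      rayIntegral (e * Complex.I - η) (fun s => cscKernel φ s * Complex.exp (s * L))
        (c + T * (e * Complex.I)) =
      rayIntegral (e * Complex.I - (0 : ℝ)) (fun s => cscKernel φ s * Complex.exp (s * L))
        (c + T * (e * Complex.I)) := by
    intro e he
    have hmem : ∀ t : ℝ, T ≤ t → (c + t * (e * Complex.I) : ℂ) ∈ slantedRegion e η v y := by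
      intro t ht
      have h1 : e * (t * e) = t := by linear_combination t * he
      have h2 : e * η * (t * e) = η * t := by linear_combination η * t * he
      constructor
      · simp; nlinarith
      · simp; linarith
    have hmem0 : ∀ t : ℝ, T ≤ t → (c + t * (e * Complex.I) : ℂ) ∈ slantedRegion e 0 σ y := by
      intro t ht
      have h1 : e * (t * e) = t := by linear_combination t * he
      constructor
      · simp; linarith
      · simp; linarith
    have hcomb : ∀ t : ℝ, (c + T * (e * Complex.I) + t * (e * Complex.I) : ℂ) =
        c + (T + t : ℝ) * (e * Complex.I) := fun t => by push_cast; ring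
    refine rayIntegral_eq_rayIntegral (v := e * Complex.I)
      ((hB e he).rayDecay (L := L) ?_) ((h.rayBound_vertical he).rayDecay (L := L) ?_)
      (fun t ht => ?_) (fun t ht => ?_) ?_ ?_
    · linarith [re_direction_mul_le (η := η) he hL']
    · have h1 : ((e * Complex.I - (0 : ℝ)) * L).re ≤ |L.im| := by
        simp
        refine (neg_le_abs _).trans ?_
        rw [abs_mul, abs_eq_one_of_mul_self he, one_mul]
      linarith
    · rw [hcomb]; exact hmem _ (by linarith)
    · rw [hcomb]; exact hmem0 _ (by linarith)
    · exact h.tendsto_rayIntegral he hLA hLim hη.le hT fun τ t hτ ht =>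
        Or.inl (add_mem_slantedRegion he (hmem τ hτ) ht)
    · exact h.tendsto_rayIntegral he hLA hLim le_rfl hT fun τ t hτ ht =>
        Or.inr (add_mem_slantedRegion he (hmem0 τ hτ) ht)
  have k1 := key 1 (by norm_num)
  have k2 := key (-1) (by norm_num)
  simp only [Complex.ofReal_one, Complex.ofReal_neg, one_mul, neg_mul, mul_neg] at k1 k2
  simp only [contourIntegral, Complex.ofReal_neg, neg_mul]
  rw [k1, k2]

theorem differentiableAt_contourIntegral_vertical (h : CutPlaneBound φ σ A η v y C) {T c : ℝ}
    (hc : σ < c) (hc' : c < ⌊σ⌋ + 1) (hy : y < T) {L : ℂ} (hL : |L.im| < Real.pi - A) :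
    DifferentiableAt ℂ
      (fun L => contourIntegral 0 T (fun s => cscKernel φ s * Complex.exp (s * L)) c) L := by
  have h1 := h.rayBound_vertical (e := 1) (by norm_num)
  have h2 := h.rayBound_vertical (e := -1) (by norm_num)
  rw [ofReal_one_mul_I_sub] at h1
  rw [ofReal_neg_one_mul_I_sub] at h2
  have hL' := abs_lt.1 hL
  refine differentiableAt_contourIntegral (by linarith [h.one_le]) h1 h2 ?_ ?_
    (fun y _ => h.analyticAt_cscKernel_strip (by simpa using hc) (by simpa using hc')) ?_ ?_
  · constructor <;> simp <;> linarith
  · constructor <;> simp <;> linarith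
  · simp; linarith
  · simp; linarith

theorem differentiableAt_contourIntegral_slanted (h : CutPlaneBound φ σ A η v y C) {T c : ℝ}
    (hc : σ < c) (hc' : c < ⌊σ⌋ + 1) (hv : v < σ + η * T) (hy : y < T) :
    ∃ R : ℝ, ∀ L : ℂ, R < η * L.re → |L.im| ≤ Real.pi → DifferentiableAt ℂ
      (fun L => contourIntegral η T (fun s => cscKernel φ s * Complex.exp (s * L)) c) L := by
  obtain ⟨B, hB⟩ := (h.slantedExpBound T).rayBound h.slope_pos.le h.slope_le
  have h1 := hB 1 (by norm_num)
  have h2 := hB (-1) (by norm_num)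
  rw [ofReal_one_mul_I_sub] at h1
  rw [ofReal_neg_one_mul_I_sub] at h2
  refine ⟨Real.pi + B, fun L hLre hL => ?_⟩
  have h3 := re_direction_mul_le (η := η) (e := 1) (by norm_num) hL
  have h4 := re_direction_mul_le (η := η) (e := -1) (by norm_num) hL
  rw [ofReal_one_mul_I_sub] at h3
  rw [ofReal_neg_one_mul_I_sub] at h4
  refine differentiableAt_contourIntegral (by linarith [h.one_le]) h1 h2 ?_ ?_
    (fun y _ => h.analyticAt_cscKernel_strip (by simpa using hc) (by simpa using hc'))
    (by linarith) (by linarith)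
  · constructor <;> simp <;> linarith
  · constructor <;> simp <;> linarith

end CutPlaneBound

/-! ### Vertical lines, residues at the integers, and the power series -/

theorem RayDecay.sub {u : ℂ} {f g : ℂ → ℂ} {U : Set ℂ} (hf : RayDecay u f U)
    (hg : RayDecay u g U) : RayDecay u (fun s => f s - g s) U where
  isOpen := hf.isOpen
  diff := hf.diff.sub hg.diff
  ray := hf.ray
  decay := by
    obtain ⟨K, ε, hε, hK, hb⟩ := hf.decay
    obtain ⟨K', ε', hε', hK', hb'⟩ := hg.decay
    refine ⟨fun s => K s + K' s, min ε ε', lt_min hε hε', hK.add hK', fun s hs t ht => ?_⟩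
    have h0 : 0 ≤ K s := by simpa using (norm_nonneg _).trans (hb s hs 0 le_rfl)
    have h0' : 0 ≤ K' s := by simpa using (norm_nonneg _).trans (hb' s hs 0 le_rfl)
    refine (norm_sub_le _ _).trans ((add_le_add (hb s hs t ht) (hb' s hs t ht)).trans ?_)
    rw [add_mul]
    gcongr
    · exact min_le_left _ _
    · exact min_le_right _ _

theorem RayDecay.congr {u : ℂ} {f g : ℂ → ℂ} {U : Set ℂ} (hf : RayDecay u f U) (h : EqOn g f U) :
    RayDecay u g U where
  isOpen := hf.isOpen
  diff := hf.diff.congr h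
  ray := hf.ray
  decay := by
    obtain ⟨K, ε, hε, hK, hb⟩ := hf.decay
    refine ⟨K, ε, hε, hK, fun s hs t ht => ?_⟩
    rw [h (hf.ray s hs t ht)]
    exact hb s hs t ht

theorem ContourDecay.sub {η T a b : ℝ} {f g : ℂ → ℂ} {V W : Set ℂ}
    (hf : ContourDecay η T a b f V W) (hg : ContourDecay η T a b g V W) :
    ContourDecay η T a b (fun s => f s - g s) V W where
  upper := hf.upper.sub hg.upper
  lower := hf.lower.sub hg.lower
  strip := fun s h1 h2 h3 => (hf.strip s h1 h2 h3).sub (hg.strip s h1 h2 h3)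
  nonneg := hf.nonneg
  mem_upper := hf.mem_upper
  mem_lower := hf.mem_lower

theorem cutPlaneBound_one {σ η v y : ℝ} (hη : 0 < η) (hη1 : η ≤ 1) (hy : 1 ≤ y) :
    CutPlaneBound (fun _ => 1) σ 1 η v y 1 where
  right := differentiableOn_const _
  slanted := fun _ _ => differentiableOn_const _
  bound := fun _ _ s _ => by simp
  bound_right := fun c _ => ⟨1, one_pos.le, fun s _ => by simp⟩
  one_le := hy
  nonneg := one_pos.le
  type_pos := one_pos
  slope_pos := hη
  slope_le := hη1

namespace CutPlaneBound

variable {φ : ℂ → ℂ} {σ A η v y C : ℝ}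

theorem rayDecay_vertical (h : CutPlaneBound φ σ A η v y C) {L : ℂ} (hL : |L.im| < Real.pi - A)
    {e : ℝ} (he : e * e = 1) :
    RayDecay (e * Complex.I - (0 : ℝ)) (fun s => cscKernel φ s * Complex.exp (s * L))
      (slantedRegion e 0 σ y) := by
  refine (h.rayBound_vertical he).rayDecay ?_
  have h1 : ((e * Complex.I - (0 : ℝ)) * L).re ≤ |L.im| := by
    simp
    refine (neg_le_abs _).trans ?_
    rw [abs_mul, abs_eq_one_of_mul_self he, one_mul]
  linarith

theorem contourDecay_vertical (h : CutPlaneBound φ σ A η v y C) {T : ℝ} (hy : y < T) {L : ℂ}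
    (hL : |L.im| < Real.pi - A) {a b : ℝ} {m : ℤ} (ha : σ ≤ a) (hm : (m : ℝ) ≤ a)
    (hb : b ≤ m + 1) :
    ContourDecay 0 T a b (fun s => cscKernel φ s * Complex.exp (s * L))
      (slantedRegion 1 0 σ y) (slantedRegion (-1) 0 σ y) where
  upper := by
    have := h.rayDecay_vertical hL (e := 1) (by norm_num)
    rwa [ofReal_one_mul_I_sub] at this
  lower := by
    have := h.rayDecay_vertical hL (e := -1) (by norm_num)
    rwa [ofReal_neg_one_mul_I_sub] at this
  strip := fun s h1 h2 _ => (analyticAt_cscKernel (h.analyticAt (ha.trans_lt h1))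
    (sin_pi_mul_ne_zero_of_re (hm.trans_lt h1) (h2.trans_le hb))).mul (by fun_prop)
  nonneg := by linarith [h.one_le]
  mem_upper := fun x hx _ => by constructor <;> simp <;> linarith
  mem_lower := fun x hx _ => by constructor <;> simp <;> linarith

end CutPlaneBound

theorem complex_sin_add_int_mul_pi (z : ℂ) (n : ℤ) :
    Complex.sin (z + n * Real.pi) = (-1) ^ n * Complex.sin z :=
  n.cast_negOnePow ℂ ▸ Complex.sin_antiperiodic.add_int_mul_eq n

theorem csc_half_integer_line (n : ℤ) (y : ℝ) :
    (Real.pi : ℂ) / Complex.sin (Real.pi * (((n : ℝ) - 1 / 2 : ℝ) + y * Complex.I)) =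
      -(-1) ^ n * (Real.pi / Real.cosh (Real.pi * y) : ℝ) := by
  have h1 : Complex.sin (Real.pi * (((n : ℝ) - 1 / 2 : ℝ) + y * Complex.I)) =
      -((-1) ^ n * Complex.cosh (Real.pi * y)) := by
    have h2 : (Real.pi * (((n : ℝ) - 1 / 2 : ℝ) + y * Complex.I) : ℂ) =
        (Real.pi * y * Complex.I - Real.pi / 2) + n * Real.pi := by push_cast; ring
    rw [h2, complex_sin_add_int_mul_pi, Complex.sin_sub_pi_div_two, Complex.cos_mul_I]
    ring
  rw [h1]
  push_cast
  have h3 : ((-1 : ℂ) ^ n) * (-1) ^ n = 1 := by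
    rw [← mul_zpow]; simp
  have h4 : ((-1 : ℂ) ^ n) ≠ 0 := zpow_ne_zero _ (by norm_num)
  have h5 : Complex.cosh (Real.pi * y) ≠ 0 := by
    rw [← Complex.ofReal_mul, ← Complex.ofReal_cosh]
    exact_mod_cast (Real.cosh_pos _).ne'
  field_simp
  linear_combination h3

theorem hasDerivAt_two_arctan_exp (y : ℝ) :
    HasDerivAt (fun y => 2 * Real.arctan (Real.exp (Real.pi * y)))
      (Real.pi / Real.cosh (Real.pi * y)) y := by
  have h1 : HasDerivAt (fun y => Real.exp (Real.pi * y)) (Real.exp (Real.pi * y) * Real.pi) y := by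
    simpa using ((hasDerivAt_id y).const_mul Real.pi).exp
  refine (h1.arctan.const_mul 2).congr_deriv ?_
  rw [Real.cosh_eq, Real.exp_neg]
  have := Real.exp_pos (Real.pi * y)
  field_simp
  ring

/-- The integral of `π / sin (π s)` along a vertical line, in the middle between two integers. -/
theorem contourIntegral_csc_half_integer {T : ℝ} (hT : 1 < T) (n : ℤ) :
    contourIntegral 0 T (cscKernel fun _ => 1) ((n : ℝ) - 1 / 2) =
      -(-1) ^ n * (Real.pi * Complex.I) := by
  set x : ℝ := (n : ℝ) - 1 / 2 with hx
  have hdec := (cutPlaneBound_one (σ := n - 1) (v := 0) one_pos le_rfl le_rfl).contourDecay_vertical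
    hT (L := 0) (by simp; linarith [Real.pi_gt_three]) (a := n - 1) (b := n) (m := n - 1) le_rfl
    (by push_cast; linarith) (by push_cast; linarith)
  simp only [mul_zero, Complex.exp_zero, mul_one] at hdec
  have hup := hdec.upper.integrableOn (hdec.mem_upper x (by rw [hx]; linarith) (by rw [hx]; linarith))
  have hlo := hdec.lower.integrableOn (hdec.mem_lower x (by rw [hx]; linarith) (by rw [hx]; linarith))
  -- On this line the cosecant is a multiple of `1 / cosh (π y)`, with primitive `2 arctan (e^{π
  -- y})` increasing from `0` to `π`. The values of `G` at `±T` cancel between the segment and the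
  -- rays.
  set G : ℝ → ℂ := fun y => -(-1) ^ n * Complex.I *
    ((2 * Real.arctan (Real.exp (Real.pi * y)) : ℝ) : ℂ) with hG
  have hder : ∀ y : ℝ, HasDerivAt G (cscKernel (fun _ => 1) (x + y * Complex.I) * Complex.I) y := by
    intro y
    have h1 := ((hasDerivAt_two_arctan_exp y).ofReal_comp).const_mul (-(-1) ^ n * Complex.I : ℂ)
    rw [cscKernel, one_mul, csc_half_integer_line]
    refine h1.congr_deriv ?_
    ring
  have hlim : Tendsto G atTop (𝓝 (-(-1) ^ n * Complex.I * ((2 * (Real.pi / 2) : ℝ) : ℂ))) := by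
    refine Tendsto.const_mul _ ((Complex.continuous_ofReal.tendsto _).comp (Tendsto.const_mul 2 ?_))
    refine (tendsto_nhds_of_tendsto_nhdsWithin Real.tendsto_arctan_atTop).comp ?_
    exact Real.tendsto_exp_atTop.comp (tendsto_id.const_mul_atTop Real.pi_pos)
  have hlim' : Tendsto G atBot (𝓝 0) := by
    have h1 : Tendsto G atBot (𝓝 (-(-1) ^ n * Complex.I * ((2 * (Real.arctan 0) : ℝ) : ℂ))) := by
      refine Tendsto.const_mul _ ((Complex.continuous_ofReal.tendsto _).comp (Tendsto.const_mul 2 ?_))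
      refine (Real.continuous_arctan.tendsto 0).comp ?_
      exact Real.tendsto_exp_atBot.comp (tendsto_id.const_mul_atBot Real.pi_pos)
    simpa using h1
  have e1 : rayIntegral (Complex.I - (0 : ℝ)) (cscKernel fun _ => 1) (x + T * Complex.I) =
      -(-1) ^ n * Complex.I * ((2 * (Real.pi / 2) : ℝ) : ℂ) - G T := by
    have h1 := integral_Ioi_of_hasDerivAt_of_tendsto' (a := 0) (f := fun t => G (T + t))
      (f' := fun t : ℝ => cscKernel (fun _ => 1) (x + T * Complex.I + t * (Complex.I - (0 : ℝ))) *
        (Complex.I - (0 : ℝ))) (fun t _ => ?_) (hup.mul_const _)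
        (hlim.comp (tendsto_atTop_add_const_left _ T tendsto_id))
    · rw [add_zero] at h1
      exact h1
    · convert (hder (T + t)).comp_const_add T t using 1
      push_cast
      ring_nf
  have e2 : rayIntegral (-Complex.I - (0 : ℝ)) (cscKernel fun _ => 1) (x + (-T : ℝ) * Complex.I) =
      0 - G (-T) := by
    have h1 := integral_Ioi_of_hasDerivAt_of_tendsto' (a := 0) (f := fun t => G (-T - t))
      (f' := fun t : ℝ => cscKernel (fun _ => 1) (x + (-T : ℝ) * Complex.I +
        t * (-Complex.I - (0 : ℝ))) * (-Complex.I - (0 : ℝ))) (fun t _ => ?_) (hlo.mul_const _)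
        (hlim'.comp (by
          change Tendsto (fun t : ℝ => -T - t) atTop atBot
          simpa only [sub_eq_add_neg] using
            tendsto_atBot_add_const_left atTop (-T) tendsto_neg_atTop_atBot))
    · rw [sub_zero] at h1
      exact h1
    · convert (hder (-T - t)).comp_const_sub (-T) t using 1
      push_cast
      ring_nf
  have e3 : ∫ y in (-T)..T, cscKernel (fun _ => 1) (x + y * Complex.I) * Complex.I =
      G T - G (-T) := by
    refine intervalIntegral.integral_eq_sub_of_hasDerivAt (fun y _ => hder y) ?_
    refine (Continuous.mul (continuous_iff_continuousAt.2 fun y => ?_)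
      continuous_const).intervalIntegrable _ _
    refine ContinuousAt.comp (x := y) (f := fun y : ℝ => (x : ℂ) + y * Complex.I)
      (analyticAt_cscKernel analyticAt_const ?_).continuousAt (by fun_prop)
    refine sin_pi_mul_ne_zero_of_re (n := n - 1) ?_ ?_ <;> simp [hx] <;> linarith
  rw [contourIntegral, e1, e2, e3]
  push_cast
  ring

theorem contourIntegral_csc {T : ℝ} (hT : 1 < T) (n : ℤ) {x : ℝ} (hx : (n : ℝ) - 1 < x)
    (hx' : x < n) :
    contourIntegral 0 T (cscKernel fun _ => 1) x = -(-1) ^ n * (Real.pi * Complex.I) := by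
  have hdec := (cutPlaneBound_one (σ := n - 1) (v := 0) one_pos le_rfl le_rfl).contourDecay_vertical
    hT (L := 0) (by simp; linarith [Real.pi_gt_three]) (a := n - 1) (b := n) (m := n - 1) le_rfl
    (by push_cast; linarith) (by push_cast; linarith)
  simp only [mul_zero, Complex.exp_zero, mul_one] at hdec
  rw [← contourIntegral_csc_half_integer hT n]
  exact hdec.contourIntegral_eq hx hx' (by linarith) (by linarith)

theorem analyticAt_regularizedCsc_of_ne {n : ℤ} {s : ℂ} (hs : s ≠ n) (h1 : (n : ℝ) - 1 < s.re)
    (h2 : s.re < n + 1) : AnalyticAt ℂ (regularizedCsc n) s := by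
  have hsin : Complex.sin (Real.pi * s) ≠ 0 := by
    rw [Ne, sin_pi_mul_eq_zero_iff]
    rintro ⟨k, rfl⟩
    rw [Complex.intCast_re] at h1 h2
    have h3 : n - 1 < k := by exact_mod_cast h1
    have h4 : k < n + 1 := by exact_mod_cast h2
    exact hs (by rw [show k = n by omega])
  have hd : Differentiable ℂ fun s : ℂ => Complex.sin (Real.pi * s) := by fun_prop
  have : AnalyticAt ℂ (fun s => (s - n) * (Real.pi / Complex.sin (Real.pi * s))) s :=
    (analyticAt_id.sub analyticAt_const).mul (analyticAt_const.div (hd.analyticAt s) hsin)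
  refine this.congr ?_
  filter_upwards [isOpen_ne.mem_nhds hs] with z hz
  rw [regularizedCsc_of_ne hz]

namespace CutPlaneBound

variable {φ : ℂ → ℂ} {σ A η v y C : ℝ}

/-- Moving a vertical line over an integer. -/
theorem contourIntegral_jump (h : CutPlaneBound φ σ A η v y C) {T : ℝ} (hy : y < T) {L : ℂ}
    (hL : |L.im| < Real.pi - A) {n : ℤ} (hn : σ < n) {x₁ x₂ : ℝ} (h1 : (n : ℝ) - 1 < x₁)
    (hσ : σ < x₁) (h1' : x₁ < n) (h2 : (n : ℝ) < x₂) (h2' : x₂ < n + 1) :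
    contourIntegral 0 T (fun s => cscKernel φ s * Complex.exp (s * L)) x₁ -
      contourIntegral 0 T (fun s => cscKernel φ s * Complex.exp (s * L)) x₂ =
        -(2 * Real.pi * Complex.I) * ((-1) ^ n * φ n * Complex.exp (n * L)) := by
  have hT : 1 < T := h.one_le.trans_lt hy
  set k : ℂ → ℂ := fun s => φ s * Complex.exp (s * L) with hk
  set a : ℝ := max σ (n - 1) with ha
  have hone := cutPlaneBound_one (σ := σ) (v := v) (y := y) h.slope_pos h.slope_le h.one_le
  have hL0 : |(0 : ℂ).im| < Real.pi - 1 := by simp; linarith [Real.pi_gt_three]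
  set f : ℂ → ℂ := fun s => cscKernel φ s * Complex.exp (s * L) with hf
  set g : ℂ → ℂ := fun s => cscKernel (fun _ => 1) s * Complex.exp (s * 0) with hg
  -- The pole at `n` is removed by subtracting `k n` times the cosecant. The difference `p` is
  -- holomorphic across the line `Re s = n`, so the jump reduces to the explicit integrals of the
  -- cosecant.
  set p : ℂ → ℂ := fun s => dslope k n s * regularizedCsc n s with hp
  have hpeq : ∀ s : ℂ, s ≠ n → f s - k n * g s = p s := fun s hs => by
    have hs' : s - n ≠ 0 := sub_ne_zero.2 hs
    simp only [hp, hf, hg, regularizedCsc_of_ne hs, dslope_of_ne _ hs, slope_def_field, cscKernel,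
      mul_zero, Complex.exp_zero, mul_one, one_mul]
    field_simp
    rfl
  have hsl : ∀ e s, s ∈ slantedRegion e 0 σ y → s ≠ n := by
    rintro e s hs rfl
    have h3 : y < e * (n : ℂ).im := hs.2
    simp at h3
    linarith [h.one_le]
  have d1 := (h.contourDecay_vertical hy hL (a := a) (b := n) (m := n - 1) (le_max_left _ _)
    (by push_cast; exact le_max_right _ _) (by push_cast; linarith)).sub
    ((hone.contourDecay_vertical hy hL0 (a := a) (b := n) (m := n - 1) (le_max_left _ _)
    (by push_cast; exact le_max_right _ _) (by push_cast; linarith)).const_mul (k n))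
  have d1f := (h.contourDecay_vertical hy hL (a := a) (b := n) (m := n - 1) (le_max_left _ _)
    (by push_cast; exact le_max_right _ _) (by push_cast; linarith))
  have d2f := (h.contourDecay_vertical hy hL (a := n) (b := n + 1) (m := n) hn.le le_rfl le_rfl)
  have d1g := (hone.contourDecay_vertical hy hL0 (a := a) (b := n) (m := n - 1) (le_max_left _ _)
    (by push_cast; exact le_max_right _ _) (by push_cast; linarith)).const_mul (-k n)
  have d2g := (hone.contourDecay_vertical hy hL0 (a := n) (b := n + 1) (m := n) hn.le le_rfl
    le_rfl).const_mul (-k n)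
  have dp : ContourDecay 0 T a (n + 1) p (slantedRegion 1 0 σ y) (slantedRegion (-1) 0 σ y) := by
    refine ⟨d1.upper.congr fun s hs => (hpeq s (hsl 1 s hs)).symm,
      d1.lower.congr fun s hs => (hpeq s (hsl (-1) s hs)).symm, fun s hs1 hs2 _ => ?_,
      d1.nonneg, fun x hx _ => ?_, fun x hx _ => ?_⟩
    · have hkd : DifferentiableOn ℂ (dslope k n) {s | σ < s.re} := by
        refine (Complex.differentiableOn_dslope ((isOpen_re_gt σ).mem_nhds ?_)).2 (h.right.mul ?_)
        · simpa using hn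
        · fun_prop
      refine (hkd.analyticAt ((isOpen_re_gt σ).mem_nhds ((le_max_left _ _).trans_lt hs1))).mul ?_
      by_cases hsn : s = n
      · rw [hsn]; exact analyticAt_regularizedCsc n
      · exact analyticAt_regularizedCsc_of_ne hsn ((le_max_right _ _).trans_lt hs1) hs2
    · have : σ < x := (le_max_left _ _).trans_lt hx
      constructor <;> simp <;> linarith
    · have : σ < x := (le_max_left _ _).trans_lt hx
      constructor <;> simp <;> linarith
  have hax : a < x₁ := max_lt hσ h1
  have han : a < n := max_lt hn (by linarith)
  have e0 := dp.contourIntegral_eq hax (by linarith) (han.trans h2) h2'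
  have hcongr : ∀ {a' b' x : ℝ}, (∀ z : ℝ, a' < z → z < b' → z ≠ n) → a' < x → x < b' →
      ContourDecay 0 T a' b' f (slantedRegion 1 0 σ y) (slantedRegion (-1) 0 σ y) →
      ContourDecay 0 T a' b' (fun s => -k n * g s) (slantedRegion 1 0 σ y) (slantedRegion (-1) 0 σ y) →
      contourIntegral 0 T p x = contourIntegral 0 T f x + -k n * contourIntegral 0 T g x := by
    intro a' b' x hz hx hx' hF hG
    rw [← contourIntegral_const_mul, ← hF.contourIntegral_add hG hx hx']
    refine (hF.contourIntegral_congr (fun s hs => ?_) (fun s hs => ?_) (fun s hs hs' _ => ?_)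
      hx hx').symm
    · rw [← hpeq s (hsl 1 s hs)]; ring
    · rw [← hpeq s (hsl (-1) s hs)]; ring
    · rw [← hpeq s (fun h0 => hz s.re hs hs' (by rw [h0]; simp))]; ring
  rw [hcongr (fun z _ hz => hz.ne) hax h1' d1f d1g, hcongr (fun z hz _ => hz.ne') h2 h2' d2f d2g]
    at e0
  have hgc : g = cscKernel fun _ => 1 := by
    ext s; simp [hg]
  have c2 := contourIntegral_csc hT (n + 1) (x := x₂) (by push_cast; linarith) (by push_cast; exact h2')
  rw [hgc, contourIntegral_csc hT n h1 h1', c2, zpow_add₀ (by norm_num), zpow_one] at e0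
  simp only [hk] at e0
  linear_combination e0

theorem contourIntegral_shift (h : CutPlaneBound φ σ A η v y C) {T : ℝ} (hy : y < T) {L : ℂ}
    (hL : |L.im| < Real.pi - A) {c : ℝ} (hc : σ < c) (hc' : c < ⌊σ⌋ + 1) (K : ℕ) :
    contourIntegral 0 T (fun s => cscKernel φ s * Complex.exp (s * L)) c =
      contourIntegral 0 T (fun s => cscKernel φ s * Complex.exp (s * L)) (c + K) -
        2 * Real.pi * Complex.I * ∑ k ∈ Finset.range K, (-1) ^ (⌊σ⌋ + 1 + k : ℤ) *
          φ ((⌊σ⌋ + 1 + k : ℤ)) * Complex.exp ((⌊σ⌋ + 1 + k : ℤ) * L) := by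
  induction K with
  | zero => simp
  | succ K ih =>
    have hfl := Int.floor_le σ
    have hfl' := Int.lt_floor_add_one σ
    have hK : (0 : ℝ) ≤ K := Nat.cast_nonneg K
    have := h.contourIntegral_jump hy hL (n := ⌊σ⌋ + 1 + K) (x₁ := c + K) (x₂ := c + (K + 1 : ℕ))
      (by push_cast; linarith) (by push_cast; linarith) (by linarith) (by push_cast; linarith)
      (by push_cast; linarith) (by push_cast; linarith)
    rw [ih, Finset.sum_range_succ]
    linear_combination this

/-- On the line `Re s = c + K` the growth of `φ` contributes `e^{A K}` and the exponential `e^{K Re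
L}`, while the cosecant has the same bound for all `K`. The result is geometric with ratio `e^{A +
Re L} < 1`. -/
theorem tendsto_contourIntegral_shift (h : CutPlaneBound φ σ A η v y C) {T : ℝ} (hy : y < T) {L : ℂ}
    (hL : |L.im| < Real.pi - A) (hLre : L.re < -A) {c : ℝ} (hc : σ < c) (hc' : c < ⌊σ⌋ + 1) :
    Tendsto (fun K : ℕ => contourIntegral 0 T (fun s => cscKernel φ s * Complex.exp (s * L)) (c + K))
      atTop (𝓝 0) := by
  obtain ⟨C', hC', hb⟩ := h.bound_right c hc
  have hA := h.type_pos
  have hfl := Int.floor_le σ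
  have hT : 0 ≤ T := by linarith [h.one_le]
  set ε := Real.pi - A - |L.im| with hε
  have hε0 : 0 < ε := by rw [hε]; linarith
  have hsc : Real.sin (Real.pi * c) ≠ 0 := by
    have h1 := sin_pi_mul_ne_zero_of_re (s := (c : ℂ)) (n := ⌊σ⌋) (by simp; linarith) (by simpa using hc')
    rw [← Complex.ofReal_mul, ← Complex.ofReal_sin] at h1
    exact_mod_cast h1
  set D : ℝ := 2 * Real.pi / |Real.sin (Real.pi * c)| with hD
  have hD0 : 0 ≤ D := by positivity
  set M₀ : ℝ := C' * D * Real.exp (A * |c| + c * L.re) with hM₀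
  have key : ∀ (K : ℕ) (s : ℂ), s.re = c + K →
      ‖cscKernel φ s * Complex.exp (s * L)‖ ≤
        M₀ * Real.exp (A + L.re) ^ K * Real.exp (-ε * |s.im|) := fun K s hs => by
    have hK : (0 : ℝ) ≤ K := Nat.cast_nonneg K
    have h1 := hb s (by rw [hs]; linarith)
    have habs : |Real.sin (Real.pi * s.re)| = |Real.sin (Real.pi * c)| := by
      rw [hs, mul_add, mul_comm Real.pi (K : ℝ), Real.sin_add_nat_mul_pi, abs_mul, abs_pow, abs_neg,
        abs_one, one_pow, one_mul]
    have h2 := norm_csc_le (s := s) (by rw [← abs_ne_zero, habs, abs_ne_zero]; exact hsc)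
    rw [habs] at h2
    have h3 : ‖s‖ ≤ |c| + K + |s.im| := by
      refine (Complex.norm_le_abs_re_add_abs_im s).trans ?_
      rw [hs]
      have := abs_add_le c K
      rw [abs_of_nonneg hK] at this
      linarith
    have h4 : (s * L).re ≤ (c + K) * L.re + |s.im| * |L.im| := by
      rw [Complex.mul_re, hs]
      have : -(s.im * L.im) ≤ |s.im| * |L.im| := by
        rw [← abs_mul]; exact neg_le_abs _
      linarith
    rw [cscKernel, norm_mul, norm_mul, Complex.norm_exp]
    calc _ ≤ (C' * Real.exp (A * (|c| + K + |s.im|))) * (D * Real.exp (-Real.pi * |s.im|)) *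
          Real.exp ((c + K) * L.re + |s.im| * |L.im|) := by
          refine mul_le_mul (mul_le_mul (h1.trans ?_) h2 (norm_nonneg _) (by positivity))
            (Real.exp_le_exp.2 h4) (Real.exp_pos _).le (by positivity)
          gcongr
      _ = C' * D * (Real.exp (A * (|c| + K + |s.im|)) * Real.exp (-Real.pi * |s.im|) *
          Real.exp ((c + K) * L.re + |s.im| * |L.im|)) := by ring
      _ = C' * D * (Real.exp (A * |c| + c * L.re) * Real.exp (A + L.re) ^ K *
          Real.exp (-ε * |s.im|)) := by
          rw [← Real.exp_nat_mul, ← Real.exp_add, ← Real.exp_add, ← Real.exp_add, ← Real.exp_add, hε]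
          ring_nf
      _ = _ := by rw [hM₀]; ring
  have hbound : ∀ K : ℕ, ‖contourIntegral 0 T (fun s => cscKernel φ s * Complex.exp (s * L)) (c + K)‖ ≤
      M₀ * Real.exp (A + L.re) ^ K * (2 / ε + 2 * T) := fun K => by
    have hM : 0 ≤ M₀ * Real.exp (A + L.re) ^ K := by positivity
    have hray : ∀ e : ℝ, e * e = 1 → ‖rayIntegral (e * Complex.I - (0 : ℝ))
        (fun s => cscKernel φ s * Complex.exp (s * L)) ((c + K : ℝ) + (e * T : ℝ) * Complex.I)‖ ≤
        M₀ * Real.exp (A + L.re) ^ K * (1 / ε) := fun e he => by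
      refine (norm_rayIntegral_le (M := M₀ * Real.exp (A + L.re) ^ K) hε0 fun t ht => ?_).trans ?_
      · refine (key K _ (by simp)).trans ?_
        have h2 : ((c + K : ℝ) + (e * T : ℝ) * Complex.I + t * (e * Complex.I - (0 : ℝ)) : ℂ).im =
            e * (T + t) := by simp; ring
        rw [h2, abs_mul, abs_eq_one_of_mul_self he, one_mul, abs_of_nonneg (by linarith)]
        exact mul_le_mul_of_nonneg_left (Real.exp_le_exp.2 (by nlinarith)) hM
      · have : ‖(e * Complex.I - (0 : ℝ) : ℂ)‖ = 1 := by
          simp [abs_eq_one_of_mul_self he]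
        rw [this, mul_one, mul_one_div]
    have h1 := hray 1 (by norm_num)
    have h2 := hray (-1) (by norm_num)
    rw [ofReal_one_mul_I_sub, one_mul] at h1
    rw [ofReal_neg_one_mul_I_sub, neg_one_mul] at h2
    have h3 : ‖∫ r in (-T)..T, cscKernel φ ((c + K : ℝ) + r * Complex.I) *
        Complex.exp (((c + K : ℝ) + r * Complex.I) * L) * Complex.I‖ ≤
        M₀ * Real.exp (A + L.re) ^ K * (2 * T) := by
      refine (intervalIntegral.norm_integral_le_of_norm_le_const
        (C := M₀ * Real.exp (A + L.re) ^ K) fun r _ => ?_).trans (le_of_eq ?_)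
      · rw [norm_mul, Complex.norm_I, mul_one]
        refine (key K _ (by simp)).trans ?_
        refine mul_le_of_le_one_right hM (Real.exp_le_one_iff.2 ?_)
        nlinarith [abs_nonneg ((c + K : ℝ) + r * Complex.I : ℂ).im]
      · rw [sub_neg_eq_add, abs_of_nonneg (by linarith)]
        ring
    rw [contourIntegral]
    refine (norm_add_le _ _).trans ((add_le_add (norm_sub_le _ _) le_rfl).trans ?_)
    have : M₀ * Real.exp (A + L.re) ^ K * (2 / ε + 2 * T) = M₀ * Real.exp (A + L.re) ^ K * (1 / ε) +
      M₀ * Real.exp (A + L.re) ^ K * (1 / ε) + M₀ * Real.exp (A + L.re) ^ K * (2 * T) := by ring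
    linarith
  refine squeeze_zero_norm hbound ?_
  have := ((tendsto_pow_atTop_nhds_zero_of_lt_one (Real.exp_pos (A + L.re)).le
    (by rw [← Real.exp_zero]; exact Real.exp_lt_exp.2 (by linarith))).const_mul
      M₀).mul_const (2 / ε + 2 * T)
  simpa using this

/-- The power series as an integral along a vertical line. -/
theorem tendsto_sum_contourIntegral (h : CutPlaneBound φ σ A η v y C) {T : ℝ} (hy : y < T) {L : ℂ}
    (hL : |L.im| < Real.pi - A) (hLre : L.re < -A) {c : ℝ} (hc : σ < c) (hc' : c < ⌊σ⌋ + 1) :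
    Tendsto (fun K : ℕ => ∑ k ∈ Finset.range K, (-1) ^ (⌊σ⌋ + 1 + k : ℤ) *
          φ ((⌊σ⌋ + 1 + k : ℤ)) * Complex.exp ((⌊σ⌋ + 1 + k : ℤ) * L)) atTop
      (𝓝 (-(2 * Real.pi * Complex.I)⁻¹ *
        contourIntegral 0 T (fun s => cscKernel φ s * Complex.exp (s * L)) c)) := by
  have h1 := (h.tendsto_contourIntegral_shift hy hL hLre hc hc').sub_const
    (contourIntegral 0 T (fun s => cscKernel φ s * Complex.exp (s * L)) c)
  have h2 := h1.const_mul (2 * Real.pi * Complex.I)⁻¹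
  have hne : (2 * Real.pi * Complex.I : ℂ) ≠ 0 := by
    simp [Real.pi_ne_zero]
  rw [zero_sub, mul_neg, ← neg_mul] at h2
  refine h2.congr fun K => ?_
  rw [h.contourIntegral_shift hy hL hc hc' K]
  rw [sub_sub_cancel, inv_mul_cancel_left₀ hne]

end CutPlaneBound

/-! ### Geometry of the slit plane -/

section SlitDomain

variable {M : ℕ} {s : Fin M → ℂ} {ω : Fin M → ℝ} {κ σ v y : ℝ}

theorem mem_slitDomain (hκ : ∀ m, κ ≤ Real.cos (ω m)) {z : ℂ} (hz : ∀ m, z ∈ rightCone κ (s m)) :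
    z ∈ slitDomain s ω := by
  simp only [slitDomain, mem_compl_iff, mem_iUnion, not_exists]
  exact fun m => notMem_branchCut (hκ m) (hz m)

theorem isOpen_iInter_rightCone (κ : ℝ) (s : Fin M → ℂ) :
    IsOpen {z : ℂ | ∀ m, z ∈ rightCone κ (s m)} := by
  simp only [ofPred_forall]
  exact isOpen_iInter_of_finite fun m => isOpen_rightCone κ (s m)

theorem mem_rightCone_of_pos_slanted (hκ : 0 ≤ κ) {e : ℝ} (he : e * e = 1) {q z : ℂ}
    (h : 0 < (z - q).re + e * κ * (z - q).im) : z ∈ rightCone κ q := by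
  change -κ * ‖z - q‖ < (z - q).re
  have h1 := Complex.abs_im_le_norm (z - q)
  have h2 : e * (z - q).im ≤ |(z - q).im| := by
    refine (le_abs_self _).trans ?_
    rw [abs_mul, abs_eq_one_of_mul_self he, one_mul]
  nlinarith

theorem mem_rightCone_of_mem_slantedRegion (hκ : 0 ≤ κ) {e : ℝ} (he : e * e = 1) {q z : ℂ}
    (hq : q.re ≤ σ) (hv : q.re + κ * |q.im| + 1 ≤ v)
    (hz : z ∈ slantedRegion e κ v y ∪ slantedRegion e 0 σ y) : z ∈ rightCone κ q := by
  rcases hz with hz | hz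
  · exact mem_rightCone_of_pos_slanted hκ he
      (one_pos.trans (one_lt_of_mem_slantedRegion he hκ hv hz))
  · refine mem_rightCone_of_re_lt hκ (hq.trans_lt ?_)
    have : σ < z.re + e * 0 * z.im := hz.1
    simpa using this

/-- A function of exponential growth on the slit plane, to the right of its singularities. -/
theorem exists_cutPlaneBound {φ : ℂ → ℂ} {A y₀ : ℝ} (hφ : DifferentiableOn ℂ φ (slitDomain s ω))
    (hκ0 : 0 < κ) (hκ1 : κ ≤ 1) (hκ : ∀ m, κ ≤ Real.cos (ω m)) (hσ : ∀ m, (s m).re ≤ σ)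
    (hv : ∀ m, (s m).re + κ * |(s m).im| + 1 ≤ v) (hA : 0 < A)
    (hgrowth : GrowthOn φ (slitDomain s ω) A) :
    ∃ y ≥ y₀, ∃ C, CutPlaneBound φ σ A κ v y C := by
  obtain ⟨C, hC, r, hb⟩ := hgrowth
  have hU : DifferentiableOn ℂ φ {z : ℂ | ∀ m, z ∈ rightCone κ (s m)} :=
    hφ.mono fun z hz => mem_slitDomain hκ hz
  have hright : ∀ z : ℂ, σ < z.re → ∀ m, z ∈ rightCone κ (s m) := fun z hz m =>
    mem_rightCone_of_re_lt hκ0.le ((hσ m).trans_lt hz)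
  -- Height at least `r` brings the growth condition into force; height at least `1` is for the
  -- bound of the cosecant.
  refine ⟨max y₀ (max r 1), le_max_left _ _, C, ?_⟩
  exact {
    right := hU.mono hright
    slanted := fun e he => hU.mono fun z hz m =>
      mem_rightCone_of_mem_slantedRegion hκ0.le he (hσ m) (hv m) (Or.inl hz)
    bound := fun e he z hz => by
      refine (hb z (mem_slitDomain hκ fun m =>
        mem_rightCone_of_mem_slantedRegion hκ0.le he (hσ m) (hv m) hz) ?_).le
      have : max y₀ (max r 1) < |z.im| := by
        rcases hz with hz | hz <;> exact lt_abs_im_of_mem_slantedRegion he hz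
      exact ((le_max_left r 1).trans (le_max_right _ _)).trans
        (this.le.trans (Complex.abs_im_le_norm z))
    bound_right := fun c hc => by
      have hK : IsCompact (Metric.closedBall (0 : ℂ) r ∩ {z | c ≤ z.re}) :=
        (isCompact_closedBall 0 r).inter_right (isClosed_le continuous_const Complex.continuous_re)
      obtain ⟨C₁, hC₁⟩ := hK.exists_bound_of_continuousOn
        (hU.continuousOn.mono fun z hz => hright z (lt_of_lt_of_le hc hz.2))
      refine ⟨max C |C₁|, le_max_of_le_left hC.le, fun z hz => ?_⟩
      have h1 : 1 ≤ Real.exp (A * ‖z‖) := Real.one_le_exp (by positivity)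
      rcases le_total r ‖z‖ with hr | hr
      · refine (hb z (mem_slitDomain hκ (hright z (hc.trans_le hz))) hr).le.trans ?_
        exact mul_le_mul_of_nonneg_right (le_max_left _ _) (Real.exp_pos _).le
      · refine (hC₁ z ⟨mem_closedBall_zero_iff.2 hr, hz⟩).trans ((le_abs_self _).trans ?_)
        exact (le_max_right C _).trans
          (le_mul_of_one_le_right (le_max_of_le_left hC.le) h1)
    one_le := (le_max_right r 1).trans (le_max_right _ _)
    nonneg := hC.le
    type_pos := hA
    slope_pos := hκ0
    slope_le := hκ1 }

theorem HasAlgebraicSingularity.eventually_rightCone {φ : ℂ → ℂ} {q lam θ : ℂ} {w : ℝ}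
    {ψ : ℂ → ℂ} (h : HasAlgebraicSingularity φ q w lam θ ψ) (hw : |w| < Real.pi / 2)
    (hκ : κ ≤ Real.cos w) :
    ∀ᶠ z in 𝓝[rightCone κ q] q, φ z = (z - q) ^ (-lam) * ψ ((z - q) ^ θ) := by
  have hle : 𝓝[rightCone κ q] q ≤ 𝓝[(branchCut q w)ᶜ] q :=
    nhdsWithin_mono _ fun z hz => notMem_branchCut hκ hz
  filter_upwards [hle h.local_expansion, self_mem_nhdsWithin] with z hz hmem
  rw [hz, branchPow_eq_cpow hw hκ hmem, branchPow_eq_cpow hw hκ hmem]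

theorem abs_lt_pi_div_two_of_mem {w : ℝ}
    (hw : w ∈ Set.Ioo (-(Real.pi / 2)) 0 ∪ Set.Ioo 0 (Real.pi / 2)) : |w| < Real.pi / 2 := by
  rw [abs_lt]
  rcases hw with hw | hw <;> constructor <;> linarith [hw.1, hw.2]

/-- The slope of the bent contour: finitely many cuts, each at an angle less than `π / 2`, leave a
common positive lower bound for the cosines. -/
theorem exists_pos_le_cos (hω : ∀ m, |ω m| < Real.pi / 2) :
    ∃ κ : ℝ, 0 < κ ∧ κ ≤ 1 ∧ ∀ m, κ ≤ Real.cos (ω m) := by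
  have hpos : ∀ m, 0 < Real.cos (ω m) := fun m =>
    Real.cos_pos_of_mem_Ioo (abs_lt.1 (hω m))
  obtain ⟨κ, hκ0, hκ⟩ : ∃ κ : ℝ, 0 < κ ∧ ∀ m, κ ≤ Real.cos (ω m) := by
    rcases isEmpty_or_nonempty (Fin M) with h | h
    · exact ⟨1, one_pos, fun m => h.elim m⟩
    · obtain ⟨m, hm⟩ := Finite.exists_min fun m => Real.cos (ω m)
      exact ⟨_, hpos m, hm⟩
  exact ⟨min κ 1, lt_min hκ0 one_pos, min_le_right _ _, fun m => (min_le_left _ _).trans (hκ m)⟩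

theorem exists_abs_im_le (s : Fin M → ℂ) : ∃ I₀ : ℝ, 0 ≤ I₀ ∧ ∀ m, |(s m).im| ≤ I₀ := by
  rcases isEmpty_or_nonempty (Fin M) with h | h
  · exact ⟨0, le_rfl, fun m => h.elim m⟩
  · obtain ⟨m, hm⟩ := Finite.exists_max fun m => |(s m).im|
    exact ⟨_, abs_nonneg _, hm⟩

theorem mem_branchCut_self (q : ℂ) (w : ℝ) : q ∈ branchCut q w := ⟨0, le_rfl, by simp⟩

end SlitDomain

/-! ### Analytic continuation of the power series -/

/-- Reindexing of the residues at `b + 1, b + 2, …` as terms of a series over `n ≥ 1`. According to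
the sign of `b`, one of the two correcting sums is empty. -/
theorem sum_range_int_shift (a : ℤ → ℂ) (b : ℤ) (K : ℕ) (hK : -b ≤ K) :
    ∑ k ∈ Finset.range K, a (b + 1 + k) = ∑ n ∈ Finset.range (K + b).toNat, a (n + 1 : ℕ) -
      (∑ n ∈ Finset.range b.toNat, a (n + 1 : ℕ) -
        ∑ k ∈ Finset.range (-b).toNat, a (-(k : ℤ))) := by
  rcases le_total 0 b with hb | hb
  · lift b to ℕ using hb
    have h1 : ((K : ℤ) + b).toNat = b + K := by omega
    have h2 : (-(b : ℤ)).toNat = 0 := by omega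
    rw [h1, h2, Int.toNat_natCast, Finset.sum_range_add]
    simp only [Finset.range_zero, Finset.sum_empty, sub_zero, add_sub_cancel_left]
    refine Finset.sum_congr rfl fun k _ => ?_
    congr 1; push_cast; ring
  · obtain ⟨d, rfl⟩ : ∃ d : ℕ, b = -d := ⟨(-b).toNat, by omega⟩
    have hd : d ≤ K := by omega
    obtain ⟨K, rfl⟩ := Nat.exists_eq_add_of_le hd
    have h1 : (((d + K : ℕ) : ℤ) + -(d : ℤ)).toNat = K := by omega
    have h2 : (-(-(d : ℤ))).toNat = d := by omega
    have h3 : (-(d : ℤ)).toNat = 0 := by omega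
    rw [h1, h2, h3, Finset.sum_range_add, ← Finset.sum_range_reflect (fun k : ℕ => a (-(k : ℤ)))]
    simp only [Finset.range_zero, Finset.sum_empty, zero_sub, sub_neg_eq_add]
    rw [add_comm]
    congr 1
    · refine Finset.sum_congr rfl fun k _ => ?_
      congr 1; push_cast; ring
    · refine Finset.sum_congr rfl fun k hk => ?_
      rw [Finset.mem_range] at hk
      congr 1
      omega

/-- The terms by which the series `∑ φ(n) (-z)^n` over `n ≥ 1` exceeds the one over `n > b`. -/
def residueSum (φ : ℂ → ℂ) (b : ℤ) (z : ℂ) : ℂ :=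
  ∑ n ∈ Finset.range b.toNat, φ ((n + 1 : ℕ) : ℂ) * (-z) ^ (n + 1) +
    ∑ n ∈ Finset.range (-b).toNat, (-1 : ℂ) ^ (n + 1) * φ (-(n : ℂ)) * z ^ (-(n : ℤ))

theorem differentiableAt_residueSum (φ : ℂ → ℂ) (b : ℤ) {z : ℂ} (hz : z ≠ 0) :
    DifferentiableAt ℂ (residueSum φ b) z := by
  refine DifferentiableAt.add (by fun_prop) ?_
  refine DifferentiableAt.fun_sum fun n _ => ?_
  exact (differentiableAt_zpow.2 (Or.inl hz)).const_mul _

theorem isOpen_sector {a : ℝ} (ha : 0 ≤ a) :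
    IsOpen {z : ℂ | z ≠ 0 ∧ |z.arg| < Real.pi - a} := by
  rw [isOpen_iff_mem_nhds]
  rintro z ⟨hz, harg⟩
  have hs : z ∈ Complex.slitPlane := by
    rw [Complex.mem_slitPlane_iff_arg]
    refine ⟨fun h => ?_, hz⟩
    rw [h, abs_of_pos Real.pi_pos] at harg
    linarith
  have h1 : ContinuousAt (fun z : ℂ => |z.arg|) z := (Complex.continuousAt_arg hs).abs
  filter_upwards [isOpen_ne.mem_nhds hz, h1.eventually_lt continuousAt_const harg] with w h2 h3
  exact ⟨h2, h3⟩

namespace CutPlaneBound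

variable {φ : ℂ → ℂ} {σ A η v y C : ℝ}

theorem summable_norm (h : CutPlaneBound φ σ A η v y C) {ρ : ℝ} (hρ : 0 ≤ ρ)
    (hρ' : ρ < Real.exp (-A)) :
    Summable fun n : ℕ => ‖φ ((n + 1 : ℕ) : ℂ)‖ * ρ ^ (n + 1) := by
  obtain ⟨C', hC', hb⟩ := h.bound_right (⌊σ⌋ + 1) (Int.lt_floor_add_one σ)
  have hq : Real.exp A * ρ < 1 := by
    calc Real.exp A * ρ < Real.exp A * Real.exp (-A) := by gcongr
      _ = 1 := by rw [← Real.exp_add]; simp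
  have hs : Summable fun n : ℕ => C' * (Real.exp A * ρ) ^ (n + 1) :=
    ((summable_nat_add_iff 1).2 (summable_geometric_of_lt_one (by positivity) hq)).mul_left C'
  refine Summable.of_norm_bounded_eventually_nat hs ?_
  filter_upwards [eventually_ge_atTop (⌊σ⌋ + 1).toNat] with n hn
  have h1 : (⌊σ⌋ + 1 : ℝ) ≤ (((n + 1 : ℕ) : ℂ)).re := by
    rw [Complex.natCast_re]
    have : ⌊σ⌋ + 1 ≤ ((n + 1 : ℕ) : ℤ) := by omega
    exact_mod_cast this
  have h2 := hb _ h1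
  rw [Complex.norm_natCast] at h2
  rw [Real.norm_of_nonneg (by positivity), mul_pow, ← Real.exp_nat_mul, ← mul_assoc,
    mul_comm _ A]
  gcongr

theorem hasSum_pow (h : CutPlaneBound φ σ A η v y C) {z : ℂ} (hz : ‖z‖ < Real.exp (-A)) :
    HasSum (fun n : ℕ => φ ((n + 1 : ℕ) : ℂ) * (-z) ^ (n + 1))
      (∑' n : ℕ, φ ((n + 1 : ℕ) : ℂ) * (-z) ^ (n + 1)) := by
  refine Summable.hasSum (Summable.of_norm ?_)
  simpa only [norm_mul, norm_pow, norm_neg] using h.summable_norm (norm_nonneg z) hz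

theorem differentiableAt_tsum (h : CutPlaneBound φ σ A η v y C) {z : ℂ}
    (hz : ‖z‖ < Real.exp (-A)) :
    DifferentiableAt ℂ (fun z => ∑' n : ℕ, φ ((n + 1 : ℕ) : ℂ) * (-z) ^ (n + 1)) z := by
  obtain ⟨ρ, hρ, hρ'⟩ := exists_between hz
  have hd : DifferentiableOn ℂ (fun z => ∑' n : ℕ, φ ((n + 1 : ℕ) : ℂ) * (-z) ^ (n + 1))
      (Metric.ball 0 ρ) := by
    refine Complex.differentiableOn_tsum_of_summable_norm
      (h.summable_norm ((norm_nonneg z).trans hρ.le) hρ') (fun n => by fun_prop) Metric.isOpen_ball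
      fun n w hw => ?_
    rw [norm_mul, norm_pow, norm_neg]
    have := (mem_ball_zero_iff.1 hw).le
    gcongr
  exact hd.differentiableAt (Metric.isOpen_ball.mem_nhds (by simpa using hρ))

/-- The power series as a contour integral. -/
theorem tsum_eq_contourIntegral (h : CutPlaneBound φ σ A η v y C) {T : ℝ} (hy : y < T) {c : ℝ}
    (hc : σ < c) (hc' : c < ⌊σ⌋ + 1) {z : ℂ} (hz : ‖z‖ < Real.exp (-A)) (hz0 : z ≠ 0)
    (harg : |z.arg| < Real.pi - A) :
    ∑' n : ℕ, φ ((n + 1 : ℕ) : ℂ) * (-z) ^ (n + 1) = residueSum φ ⌊σ⌋ z -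
      (2 * Real.pi * Complex.I)⁻¹ * contourIntegral 0 T
        (fun s => cscKernel φ s * Complex.exp (s * Complex.log z)) c := by
  set b := ⌊σ⌋ with hb
  have hLre : (Complex.log z).re < -A := by
    rw [Complex.log_re, ← Real.log_exp (-A)]
    exact Real.log_lt_log (norm_pos_iff.2 hz0) hz
  have h1 := h.tendsto_sum_contourIntegral hy (by rwa [Complex.log_im]) hLre hc hc'
  set a : ℤ → ℂ := fun j => (-1) ^ j * φ j * z ^ j with ha
  have hexp : ∀ j : ℤ, Complex.exp (j * Complex.log z) = z ^ j := fun j => by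
    rw [Complex.exp_int_mul, Complex.exp_log hz0]
  have hapos : ∀ n : ℕ, a (n + 1 : ℕ) = φ ((n + 1 : ℕ) : ℂ) * (-z) ^ (n + 1) := fun n => by
    simp only [ha, zpow_natCast, Int.cast_natCast, neg_pow z]
    ring
  have haneg : ∀ n : ℕ, a (-(n : ℤ)) = -((-1 : ℂ) ^ (n + 1) * φ (-(n : ℂ)) * z ^ (-(n : ℤ))) :=
    fun n => by
    have : ((-1 : ℂ)) ^ (-(n : ℤ)) = (-1) ^ n := by
      rw [zpow_neg, zpow_natCast, ← inv_pow]; norm_num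
    simp only [ha, this, Int.cast_neg, Int.cast_natCast, pow_succ]
    ring
  have hres : residueSum φ b z = ∑ n ∈ Finset.range b.toNat, a (n + 1 : ℕ) -
      ∑ k ∈ Finset.range (-b).toNat, a (-(k : ℤ)) := by
    simp only [residueSum, hapos, haneg, Finset.sum_neg_distrib, sub_neg_eq_add]
  have h2 : Tendsto (fun K : ℕ => ∑ n ∈ Finset.range (K + b).toNat, a (n + 1 : ℕ) -
      residueSum φ b z) atTop
      (𝓝 (∑' n : ℕ, φ ((n + 1 : ℕ) : ℂ) * (-z) ^ (n + 1) - residueSum φ b z)) := by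
    have h3 := (h.hasSum_pow hz).tendsto_sum_nat
    have h4 : Tendsto (fun K : ℕ => ((K : ℤ) + b).toNat) atTop atTop := by
      refine tendsto_atTop.2 fun n => ?_
      filter_upwards [eventually_ge_atTop (n + (-b).toNat)] with K hK
      omega
    simp only [hapos]
    exact (h3.comp h4).sub_const _
  have h3 := tendsto_nhds_unique (h2.congr' ?_) h1
  · linear_combination h3
  · filter_upwards [eventually_ge_atTop (-b).toNat] with K hK
    rw [hres, ← sum_range_int_shift a b K (by omega)]
    refine Finset.sum_congr rfl fun k _ => ?_
    have h5 := hexp (b + 1 + k)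
    push_cast at h5 ⊢
    rw [h5]
    simp only [ha]
    push_cast
    ring

/-- The analytic continuation of the power series. -/
theorem exists_continuation (h : CutPlaneBound φ σ A η v y C) {T c : ℝ}
    (hv : v < σ + η * T) (hy : y < T) (hc : σ < c) (hc' : c < ⌊σ⌋ + 1) :
    ∃ (R : ℝ) (F : ℂ → ℂ), 0 < R ∧
      (∀ z : ℂ, ‖z‖ < Real.exp (-A) →
        HasSum (fun n : ℕ => φ ((n + 1 : ℕ) : ℂ) * (-z) ^ (n + 1)) (F z)) ∧
      DifferentiableOn ℂ F (continuationDomain A R) ∧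
      ∀ z ∈ Complex.slitPlane, R < ‖z‖ → F z = residueSum φ ⌊σ⌋ z -
        (2 * Real.pi * Complex.I)⁻¹ * contourIntegral η T
          (fun s => cscKernel φ s * Complex.exp (s * Complex.log z)) c := by
  classical
  have hη := h.slope_pos
  have hA0 := h.type_pos
  obtain ⟨R₁, hR₁⟩ := h.contourIntegral_rotate hc hv hy
  obtain ⟨R₂, hR₂⟩ := h.differentiableAt_contourIntegral_slanted hc hc' hv hy
  -- For `|z| > R` the thresholds for rotating and for differentiating are passed. As `R ≥ 1 >
  -- e^{-A}`, the outer region does not meet the disc.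
  set R := max 1 (Real.exp (max R₁ R₂ / η)) with hR
  set G : ℝ → ℂ → ℂ := fun η z => residueSum φ ⌊σ⌋ z - (2 * Real.pi * Complex.I)⁻¹ *
    contourIntegral η T (fun s => cscKernel φ s * Complex.exp (s * Complex.log z)) c with hG
  -- Three formulas are glued: series, vertical contour, slanted contour. `hsector` and `hfar` show
  -- that each holds on its whole region, so `F` is locally given by one of them.
  set F : ℂ → ℂ := fun z => if ‖z‖ < Real.exp (-A) then
      ∑' n : ℕ, φ ((n + 1 : ℕ) : ℂ) * (-z) ^ (n + 1)
    else if z ≠ 0 ∧ |z.arg| < Real.pi - A then G 0 z else G η z with hF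
  have hlog : ∀ z : ℂ, R < ‖z‖ → R₁ < η * (Complex.log z).re ∧ R₂ < η * (Complex.log z).re := by
    intro z hz
    have h1 : max R₁ R₂ / η < (Complex.log z).re := by
      rw [Complex.log_re, Real.lt_log_iff_exp_lt ((lt_max_of_lt_left one_pos).trans hz)]
      exact (le_max_right _ _).trans_lt hz
    rw [div_lt_iff₀' hη] at h1
    exact max_lt_iff.1 h1
  have hdisc : ∀ z : ℂ, ‖z‖ < Real.exp (-A) →
      F z = ∑' n : ℕ, φ ((n + 1 : ℕ) : ℂ) * (-z) ^ (n + 1) := fun z hz => by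
    simp only [hF, if_pos hz]
  have hsector : ∀ z : ℂ, z ≠ 0 ∧ |z.arg| < Real.pi - A → F z = G 0 z := fun z hz => by
    by_cases h1 : ‖z‖ < Real.exp (-A)
    · rw [hdisc z h1, h.tsum_eq_contourIntegral hy hc hc' h1 hz.1 hz.2]
    · simp only [hF, if_neg h1, if_pos hz]
  have hfar : ∀ z : ℂ, R < ‖z‖ → F z = G η z := fun z hz => by
    have h1 : ¬ ‖z‖ < Real.exp (-A) := by
      have : Real.exp (-A) ≤ 1 := Real.exp_le_one_iff.2 (by linarith)
      have : 1 ≤ R := le_max_left _ _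
      linarith
    by_cases h2 : z ≠ 0 ∧ |z.arg| < Real.pi - A
    · rw [hsector z h2]
      simp only [hG]
      rw [hR₁ _ (hlog z hz).1 (by rw [Complex.log_im]; exact h2.2)]
    · simp only [hF, if_neg h1, if_neg h2]
  refine ⟨R, F, lt_max_of_lt_left one_pos, fun z hz => ?_, ?_, fun z _ hz => hfar z hz⟩
  · rw [hdisc z hz]; exact h.hasSum_pow hz
  · rintro z ((hz | hz) | hz)
    · have : F =ᶠ[𝓝 z] fun z => ∑' n : ℕ, φ ((n + 1 : ℕ) : ℂ) * (-z) ^ (n + 1) := by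
        filter_upwards [(isOpen_lt continuous_norm continuous_const).mem_nhds hz] with w hw
        exact hdisc w hw
      exact ((h.differentiableAt_tsum hz).congr_of_eventuallyEq this).differentiableWithinAt
    · have h1 : F =ᶠ[𝓝 z] G 0 := by
        filter_upwards [(isOpen_sector hA0.le).mem_nhds hz] with w hw
        exact hsector w hw
      have hs : z ∈ Complex.slitPlane := by
        rw [Complex.mem_slitPlane_iff_arg]
        refine ⟨fun h3 => ?_, hz.1⟩
        have h4 := hz.2
        rw [h3, abs_of_pos Real.pi_pos] at h4
        linarith
      have h2 : DifferentiableAt ℂ (G 0) z := by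
        refine (differentiableAt_residueSum φ _ hz.1).sub (DifferentiableAt.const_mul ?_ _)
        exact DifferentiableAt.comp (f := Complex.log) z
          (h.differentiableAt_contourIntegral_vertical hc hc' hy
            (by rw [Complex.log_im]; exact hz.2)) (Complex.differentiableAt_log hs)
      exact (h2.congr_of_eventuallyEq h1).differentiableWithinAt
    · have h1 : F =ᶠ[𝓝 z] G η := by
        filter_upwards [(isOpen_lt continuous_const continuous_norm).mem_nhds hz.1] with w hw
        exact hfar w hw
      have h2 : DifferentiableAt ℂ (G η) z := by
        refine (differentiableAt_residueSum φ _ (Complex.slitPlane_ne_zero hz.2)).sub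
          (DifferentiableAt.const_mul ?_ _)
        exact DifferentiableAt.comp (f := Complex.log) z
          (hR₂ _ (hlog z hz.1).2 (by rw [Complex.log_im]; exact Complex.abs_arg_le_pi z))
          (Complex.differentiableAt_log hz.2)
      exact (h2.congr_of_eventuallyEq h1).differentiableWithinAt

end CutPlaneBound

/-! ### The remainder near the line of leading singularities -/

theorem eventually_sin_pi_mul_ne_zero (q : ℂ) :
    ∀ᶠ s in 𝓝[≠] q, Complex.sin (Real.pi * s) ≠ 0 := by
  have hd : HasDerivAt (fun s : ℂ => Complex.sin (Real.pi * s))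
      (Complex.cos (Real.pi * q) * Real.pi) q := by
    have := ((hasDerivAt_id q).const_mul (Real.pi : ℂ)).csin
    simpa using this
  by_cases h0 : Complex.sin (Real.pi * q) = 0
  · refine hd.eventually_ne (mul_ne_zero (fun h1 => ?_) (by simp [Real.pi_ne_zero]))
    have := Complex.sin_sq_add_cos_sq (Real.pi * q)
    simp [h0, h1] at this
  · exact (hd.continuousAt.eventually_ne h0).filter_mono nhdsWithin_le_nhds

/-- Near `b`, the regularised cosecant times the difference quotient of the sine is `π`; in the
limit that quotient is `(-1)^b π`. -/
theorem regularizedCsc_intCast (b : ℤ) : regularizedCsc b b = (-1) ^ b := by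
  have hcos : Complex.cos (Real.pi * b) = (-1) ^ b := by
    have h1 := Real.cos_int_mul_pi b
    rw [mul_comm, ← Complex.ofReal_intCast, ← Complex.ofReal_mul, ← Complex.ofReal_cos, h1]
    simp
  have hsin : Complex.sin (Real.pi * b) = 0 := by
    rw [mul_comm]; exact Complex.sin_int_mul_pi b
  have hd : HasDerivAt (fun s : ℂ => Complex.sin (Real.pi * s))
      ((-1) ^ b * Real.pi) (b : ℂ) := by
    have := ((hasDerivAt_id (b : ℂ)).const_mul (Real.pi : ℂ)).csin
    simpa [hcos] using this
  have h1 := ((analyticAt_regularizedCsc b).continuousAt.tendsto.mono_left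
    (nhdsWithin_le_nhds (s := {(b : ℂ)}ᶜ))).mul (hasDerivAt_iff_tendsto_slope.1 hd)
  have h2 : Tendsto (fun _ : ℂ => (Real.pi : ℂ)) (𝓝[≠] (b : ℂ)) (𝓝 Real.pi) := tendsto_const_nhds
  have h3 := tendsto_nhds_unique (h1.congr' ?_) h2
  · have hpi : (Real.pi : ℂ) ≠ 0 := by simp [Real.pi_ne_zero]
    have h4 : regularizedCsc b b * (-1) ^ b = 1 := mul_right_cancel₀ hpi (by linear_combination h3)
    have h5 : ((-1 : ℂ) ^ b) * (-1) ^ b = 1 := by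
      rw [← mul_zpow]; simp
    linear_combination (-1) ^ b * h4 - regularizedCsc b b * h5
  · filter_upwards [eventually_sin_pi_mul_ne_zero b, self_mem_nhdsWithin] with s hs hsb
    have : s - b ≠ 0 := sub_ne_zero.2 hsb
    rw [slope_def_field, hsin, sub_zero, regularizedCsc_of_ne hsb]
    field_simp
    rw [mul_comm] at hs
    exact div_self hs

/-- `f` is holomorphic on a one-sided neighbourhood of `p`, with bounded `n`-th derivative. -/
def RightRegularAt (σ : ℝ) (n : ℕ) (f : ℂ → ℂ) (p : ℂ) : Prop :=
  ∃ C : ℝ, ∀ᶠ s in 𝓝 p, σ < s.re → AnalyticAt ℂ f s ∧ ‖iteratedDeriv n f s‖ ≤ C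

namespace RightRegularAt

variable {σ : ℝ} {n : ℕ} {f g : ℂ → ℂ} {p : ℂ}

theorem _root_.AnalyticAt.rightRegularAt (hf : AnalyticAt ℂ f p) (σ : ℝ) (n : ℕ) :
    RightRegularAt σ n f p := by
  have h1 := (analyticAt_iteratedDeriv hf n).continuousAt.norm
  refine ⟨‖iteratedDeriv n f p‖ + 1, ?_⟩
  filter_upwards [hf.eventually_analyticAt, h1.eventually_lt continuousAt_const
    (lt_add_one ‖iteratedDeriv n f p‖)] with s hs hs' _
  exact ⟨hs, hs'.le⟩

theorem sub (hf : RightRegularAt σ n f p) (hg : RightRegularAt σ n g p) :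
    RightRegularAt σ n (fun s => f s - g s) p := by
  obtain ⟨C, hC⟩ := hf
  obtain ⟨C', hC'⟩ := hg
  refine ⟨C + C', ?_⟩
  filter_upwards [hC, hC'] with s hs hs' h
  obtain ⟨h1, h2⟩ := hs h
  obtain ⟨h3, h4⟩ := hs' h
  refine ⟨h1.sub h3, ?_⟩
  have := iteratedDeriv_fun_sub (n := n) h1.contDiffAt h3.contDiffAt
  rw [this]
  exact (norm_sub_le _ _).trans (add_le_add h2 h4)

theorem congr (hf : RightRegularAt σ n f p) (h : ∀ᶠ s in 𝓝 p, σ < s.re → f s = g s) :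
    RightRegularAt σ n g p := by
  obtain ⟨C, hC⟩ := hf
  refine ⟨C, ?_⟩
  filter_upwards [hC, eventually_eventually_nhds.2 h] with s hs hs' hlt
  have he : f =ᶠ[𝓝 s] g := by
    filter_upwards [hs', (isOpen_re_gt σ).mem_nhds hlt] with z hz hz' using hz hz'
  rw [← he.iteratedDeriv_eq]
  exact ⟨(hs hlt).1.congr he, (hs hlt).2⟩

end RightRegularAt

/-- The difference `p - q` is purely imaginary and nonzero, hence off the negative real axis. So a
branch point on the line causes no trouble at the other points of the line. -/
theorem analyticAt_cpow_sub {p q : ℂ} (hre : p.re = q.re) (hne : p ≠ q) (a : ℂ) :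
    AnalyticAt ℂ (fun s => (s - q) ^ a) p := by
  refine (analyticAt_id.sub analyticAt_const).cpow analyticAt_const ?_
  rw [Complex.mem_slitPlane_iff]
  right
  intro h
  refine hne (Complex.ext hre ?_)
  simpa [sub_eq_zero] using h

theorem analyticAt_localExpansion {p q : ℂ} (hre : p.re = q.re) (hne : p ≠ q) (lam θ : ℂ)
    (ψ : ℂ → ℂ) (S : Finset (ℕ × ℤ)) : AnalyticAt ℂ (localExpansion q lam θ ψ S) p := by
  unfold localExpansion
  exact Finset.analyticAt_fun_sum _ fun x _ => analyticAt_const.mul (analyticAt_cpow_sub hre hne _)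

theorem analyticAt_localExpansion_of_re_lt {q s : ℂ} (h : q.re < s.re) (lam θ : ℂ)
    (ψ : ℂ → ℂ) (S : Finset (ℕ × ℤ)) : AnalyticAt ℂ (localExpansion q lam θ ψ S) s := by
  unfold localExpansion
  refine Finset.analyticAt_fun_sum _ fun x _ => analyticAt_const.mul
    ((analyticAt_id.sub analyticAt_const).cpow analyticAt_const ?_)
  rw [Complex.mem_slitPlane_iff]
  left
  simpa using h

/-- The polar part of `φ(s) π / sin (π s)` on the line `Re s = σ`, apart from the points `q i`. -/
def IsPolarPart {ι : Type*} (φ : ℂ → ℂ) (σ : ℝ) (I : Finset ι) (q : ι → ℂ) (ρ : ℂ) : Prop :=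
  (ρ = 0 ∧ ∀ b : ℤ, σ = b → ∃ i ∈ I, q i = b) ∨
    ∃ b : ℤ, σ = b ∧ ρ = (-1) ^ b * φ b ∧ ∀ i ∈ I, q i ≠ b

/-- Local data at the singularities `q i`, `i ∈ I`, on the line `Re s = σ`. -/
structure LineSingularities {ι : Type*} (φ : ℂ → ℂ) (σ κ : ℝ) (I : Finset ι) (q lam θ : ι → ℂ)
    (ψ : ι → ℂ → ℂ) : Prop where
  re_eq : ∀ i ∈ I, (q i).re = σ
  inj : ∀ i ∈ I, ∀ j ∈ I, q i = q j → i = j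
  re_pos : ∀ i ∈ I, 0 < (θ i).re
  analytic : ∀ i ∈ I, AnalyticAt ℂ (ψ i) 0
  local_expansion : ∀ i ∈ I, ∀ᶠ s in 𝓝[rightCone κ (q i)] (q i),
    φ s = (s - q i) ^ (-lam i) * ψ i ((s - q i) ^ θ i)
  differentiableAt : ∀ i ∈ I, ∀ᶠ s in 𝓝 (q i), s ∈ rightCone κ (q i) → DifferentiableAt ℂ φ s
  analyticAt : ∀ p : ℂ, p.re = σ → (∀ i ∈ I, p ≠ q i) → AnalyticAt ℂ φ p

/-- What is left of `φ(s) π / sin (π s)` when the truncated expansions are subtracted. -/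
def cscRemainder {ι : Type*} (φ : ℂ → ℂ) (σ : ℝ) (I : Finset ι) (q lam θ : ι → ℂ)
    (ψ : ι → ℂ → ℂ) (ρ : ℂ) (K J : ℕ) (s : ℂ) : ℂ :=
  cscKernel φ s - ∑ i ∈ I, localExpansion (q i) (lam i) (θ i) (ψ i) (expansionIndex K J) s -
    ρ * (s - σ) ^ (-1 : ℂ)

namespace LineSingularities

variable {ι : Type*} {φ : ℂ → ℂ} {σ κ : ℝ} {I : Finset ι} {q lam θ : ι → ℂ} {ψ : ι → ℂ → ℂ}
  {A v y C : ℝ}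

/-- Being `O(‖s - q‖ ^ n)` in a cone with vertex `q` that is wider than the half-plane, the
difference has a bounded `n`-th derivative in the half-plane, by Cauchy's estimate. -/
theorem rightRegularAt_sub_localExpansion (hq : LineSingularities φ σ κ I q lam θ ψ)
    (h : CutPlaneBound φ σ A κ v y C) {n K J : ℕ} {i : ι} (hi : i ∈ I)
    (hK : n + 1 + (lam i).re ≤ (θ i).re * K) (hJ : n + 1 + (lam i).re ≤ J) :
    RightRegularAt σ n (fun s => cscKernel φ s -
      localExpansion (q i) (lam i) (θ i) (ψ i) (expansionIndex K J) s) (q i) := by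
  have hO := isBigO_sub_localExpansion (hq.re_pos i hi) (hq.analytic i hi)
    (hq.local_expansion i hi) hK hJ
  have hd : ∀ᶠ s in 𝓝 (q i), s ∈ rightCone κ (q i) → DifferentiableAt ℂ (fun s => cscKernel φ s -
      localExpansion (q i) (lam i) (θ i) (ψ i) (expansionIndex K J) s) s := by
    filter_upwards [hq.differentiableAt i hi,
      eventually_nhdsWithin_iff.1 (eventually_sin_pi_mul_ne_zero (q i))] with s hs hsin hmem
    refine DifferentiableAt.sub ?_ ?_
    · refine (hs hmem).mul (DifferentiableAt.div (differentiableAt_const _) (by fun_prop)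
        (hsin (ne_of_mem_rightCone hmem)))
    · unfold localExpansion
      refine DifferentiableAt.fun_sum fun x _ => DifferentiableAt.const_mul ?_ _
      exact (differentiableAt_id.sub_const _).cpow_const
        (mem_slitPlane_of_mem_rightCone h.slope_le hmem)
  obtain ⟨C, hC⟩ := eventually_norm_iteratedDeriv_le_of_isBigO h.slope_pos h.slope_le n hd hO
  have hlt : (q i).re < ⌊σ⌋ + 1 := by rw [hq.re_eq i hi]; exact Int.lt_floor_add_one σ
  refine ⟨C, ?_⟩
  filter_upwards [hC, (isOpen_lt Complex.continuous_re continuous_const).mem_nhds hlt]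
    with s hs hs' hσ
  exact ⟨(h.analyticAt_cscKernel_strip hσ hs').sub
    (analyticAt_localExpansion_of_re_lt (by rwa [hq.re_eq i hi]) _ _ _ _),
    hs (by rwa [hq.re_eq i hi])⟩

/-- At every point of the line at most one subtracted term is singular, and it was chosen to remove
the singularity of the kernel there: the expansion at a branch point, the simple pole at an integer.
Elsewhere all parts are analytic. -/
theorem rightRegularAt_cscRemainder (hq : LineSingularities φ σ κ I q lam θ ψ)
    (h : CutPlaneBound φ σ A κ v y C) {ρ : ℂ} (hρ : IsPolarPart φ σ I q ρ) {n K J : ℕ}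
    (hK : ∀ i ∈ I, n + 1 + (lam i).re ≤ (θ i).re * K) (hJ : ∀ i ∈ I, n + 1 + (lam i).re ≤ J)
    {p : ℂ} (hp : p.re = σ) :
    RightRegularAt σ n (cscRemainder φ σ I q lam θ ψ ρ K J) p := by
  classical
  have hpole : ∀ (_ : ρ = 0 ∨ p ≠ σ), AnalyticAt ℂ (fun s : ℂ => ρ * (s - σ) ^ (-1 : ℂ)) p := by
    rintro (h0 | h0)
    · simp only [h0, zero_mul]; exact analyticAt_const
    · exact analyticAt_const.mul (analyticAt_cpow_sub (by simpa using hp) h0 _)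
  by_cases hpq : ∃ i ∈ I, p = q i
  · obtain ⟨i, hi, rfl⟩ := hpq
    have hne : ρ = 0 ∨ q i ≠ σ := by
      rcases hρ with h0 | ⟨b, hb, _, h0⟩
      · exact Or.inl h0.1
      · refine Or.inr ?_
        rw [hb]
        simpa using h0 i hi
    have hsum : AnalyticAt ℂ (fun s => ∑ j ∈ I.erase i,
        localExpansion (q j) (lam j) (θ j) (ψ j) (expansionIndex K J) s) (q i) := by
      refine Finset.analyticAt_fun_sum _ fun j hj => ?_
      rw [Finset.mem_erase] at hj
      exact analyticAt_localExpansion (by rw [hq.re_eq i hi, hq.re_eq j hj.2])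
        (fun h0 => hj.1 (hq.inj i hi j hj.2 h0).symm) _ _ _ _
    refine (((hq.rightRegularAt_sub_localExpansion h hi (hK i hi) (hJ i hi)).sub
      (hsum.rightRegularAt σ n)).sub ((hpole hne).rightRegularAt σ n)).congr
        (Eventually.of_forall fun s _ => ?_)
    rw [cscRemainder, ← Finset.add_sum_erase I _ hi]
    ring
  · push Not at hpq
    have hφ := hq.analyticAt p hp hpq
    have hsum : AnalyticAt ℂ (fun s => ∑ j ∈ I,
        localExpansion (q j) (lam j) (θ j) (ψ j) (expansionIndex K J) s) p :=
      Finset.analyticAt_fun_sum _ fun j hj =>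
        analyticAt_localExpansion (by rw [hp, hq.re_eq j hj]) (hpq j hj) _ _ _ _
    by_cases hsin : Complex.sin (Real.pi * p) = 0
    · obtain ⟨b, rfl⟩ := (sin_pi_mul_eq_zero_iff p).1 hsin
      have hb : σ = b := by rw [← hp, Complex.intCast_re]
      have hρ' : ρ = φ b * regularizedCsc b b := by
        rcases hρ with ⟨_, h0⟩ | ⟨b', hb', h0, _⟩
        · obtain ⟨i, hi, hib⟩ := h0 b hb
          exact absurd hib.symm (hpq i hi)
        · have : b' = b := by rw [hb] at hb'; exact_mod_cast hb'.symm
          rw [h0, this, regularizedCsc_intCast, mul_comm]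
      -- Near `b` the kernel is `k s / (s - b)`, and `k b` is the coefficient `ρ` of the subtracted
      -- pole. The difference is the divided difference of `k`, which is analytic.
      set k : ℂ → ℂ := fun s => φ s * regularizedCsc b s with hk
      have hka : AnalyticAt ℂ (dslope k b) b := by
        obtain ⟨p, hp⟩ := hφ.mul (analyticAt_regularizedCsc b)
        exact hp.has_fpower_series_dslope_fslope.analyticAt
      refine ((hka.rightRegularAt σ n).sub (hsum.rightRegularAt σ n)).congr
        (Eventually.of_forall fun s hs => ?_)
      have hsb : s ≠ b := by rintro rfl; simp [hb] at hs
      have hsb' : s - b ≠ 0 := sub_ne_zero.2 hsb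
      have hσ : (σ : ℂ) = b := by rw [hb]; simp
      rw [cscRemainder, dslope_of_ne _ hsb, slope_def_field, hρ', hσ, Complex.cpow_neg_one,
        cscKernel]
      simp only [hk]
      rw [regularizedCsc_of_ne hsb]
      field_simp
      ring
    · have hne : ρ = 0 ∨ p ≠ σ := by
        rcases hρ with h0 | ⟨b, hb, _, h0⟩
        · exact Or.inl h0.1
        · refine Or.inr fun h1 => hsin ?_
          rw [sin_pi_mul_eq_zero_iff]
          exact ⟨b, by rw [h1, hb]; simp⟩
      exact ((((analyticAt_cscKernel hφ hsin).rightRegularAt σ n).sub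
        (hsum.rightRegularAt σ n)).sub ((hpole hne).rightRegularAt σ n)).congr
          (Eventually.of_forall fun s _ => rfl)

end LineSingularities

/-! ### Contour integral of the remainder -/

theorem SlantedExpBound.sub {η v y σ b T : ℝ} {f g : ℂ → ℂ} (hf : SlantedExpBound η v y σ b T f)
    (hg : SlantedExpBound η v y σ b T g) : SlantedExpBound η v y σ b T (fun s => f s - g s) := by
  simpa only [neg_one_mul, ← sub_eq_add_neg] using hf.add (hg.const_mul (-1))

/-- The contour integral of a sum of powers is given by Hankel's formula. -/
theorem SlantedExpBound.contourIntegral_sub_sum_cpow {X : Type*} {η v y σ b T : ℝ} {f : ℂ → ℂ}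
    (hf : SlantedExpBound η v y σ b T f) (hη : 0 < η) (hη1 : η ≤ 1) (hT : 0 ≤ T)
    (hv : v < σ + η * T) (hy : y < T) (S : Finset X) (α Q a : X → ℂ)
    (hQ : ∀ x ∈ S, (Q x).re ≤ σ) (hQT : ∀ x ∈ S, |(Q x).im| ≤ T)
    (hQv : ∀ x ∈ S, (Q x).re + η * |(Q x).im| + 1 ≤ v) :
    ∃ R : ℝ, ∀ L : ℂ, |L.im| ≤ Real.pi → R < η * L.re → ∀ x, σ < x → x < b →
      contourIntegral η T (fun s => (f s - ∑ i ∈ S, α i * (s - Q i) ^ a i) *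
        Complex.exp (s * L)) x = contourIntegral η T (fun s => f s * Complex.exp (s * L)) x -
      2 * Real.pi * Complex.I * ∑ i ∈ S, α i * (Complex.exp (Q i * L) * L ^ (-a i - 1) *
        (Complex.Gamma (-a i))⁻¹) := by
  classical
  induction S using Finset.induction_on with
  | empty => exact ⟨0, fun L _ _ x _ _ => by simp⟩
  | insert i S hi ih =>
    obtain ⟨R, hR⟩ := ih (fun x hx => hQ x (Finset.mem_insert_of_mem hx))
      (fun x hx => hQT x (Finset.mem_insert_of_mem hx))
      (fun x hx => hQv x (Finset.mem_insert_of_mem hx))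
    have hi' := Finset.mem_insert_self i S
    have hterm : ∀ j ∈ insert i S, SlantedExpBound η v y σ b T fun s => α j * (s - Q j) ^ a j :=
      fun j hj => (SlantedExpBound.cpow hη hη1 (hQ j hj) (a j) b T y (hQv j hj)).const_mul _
    have hrest := hf.sub (SlantedExpBound.finsetSum S fun j hj =>
      hterm j (Finset.mem_insert_of_mem hj))
    obtain ⟨R', hR'⟩ := hrest.contourDecay hη.le hη1 hT hv hy
    obtain ⟨R'', hR''⟩ := (hterm i hi').contourDecay hη.le hη1 hT hv hy
    refine ⟨max R (max R' (max R'' (Real.pi + 2 * (‖a i‖ + 1)))), fun L hL hLre x hx hxb => ?_⟩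
    simp only [max_lt_iff] at hLre
    obtain ⟨h1, h2, h3, h4⟩ := hLre
    have e1 := hR L hL h1 x hx hxb
    have e2 := (hR' L hL h2).contourIntegral_add ((hR'' L hL h3).const_mul (-1)) hx hxb
    rw [contourIntegral_const_mul] at e2
    have e3 := contourIntegral_cpow hη hη1 (hQT i hi') hL h4 ((hQ i hi').trans_lt hx)
    have e4 := contourIntegral_const_mul η T (α i)
      (fun s => (s - Q i) ^ a i * Complex.exp (s * L)) x
    rw [e3] at e4
    simp only [← mul_assoc] at e4
    have e5 : (fun s => (f s - ∑ j ∈ insert i S, α j * (s - Q j) ^ a j) * Complex.exp (s * L)) =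
        fun s => (f s - ∑ j ∈ S, α j * (s - Q j) ^ a j) * Complex.exp (s * L) +
          -1 * (α i * (s - Q i) ^ a i * Complex.exp (s * L)) := by
      ext s
      rw [Finset.sum_insert hi]
      ring
    rw [e5, e2, e1, e4, Finset.sum_insert hi]
    ring

/-- A term of the logarithmic series. -/
def logTerm (q lam θ : ℂ) (ψ : ℂ → ℂ) (p : ℕ × ℤ) (L : ℂ) : ℂ :=
  taylorCoeffAt ψ 0 p.1 * cscCoeff q p.2 / Complex.Gamma (-θ * p.1 - p.2 + lam) *
    L ^ (-θ * p.1 - p.2 + lam - 1)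

namespace LineSingularities

variable {ι : Type*} {φ : ℂ → ℂ} {σ κ : ℝ} {I : Finset ι} {q lam θ : ι → ℂ} {ψ : ι → ℂ → ℂ}
  {A v y C : ℝ}

/-- Hankel's formula accounts for all subtracted powers, so the quantity to be bounded is the
contour integral of the remainder over `2πi`. Compactness of the segment turns its local regularity
into a bound on a strip, and integration by parts does the rest. -/
theorem norm_contourIntegral_sub_le (hq : LineSingularities φ σ κ I q lam θ ψ)
    (h : CutPlaneBound φ σ A κ v y C) {ρ : ℂ} (hρ : IsPolarPart φ σ I q ρ) {n K J : ℕ}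
    (hK : ∀ i ∈ I, n + 1 + (lam i).re ≤ (θ i).re * K) (hJ : ∀ i ∈ I, n + 1 + (lam i).re ≤ J)
    {T : ℝ} (hT : ∀ i ∈ I, |(q i).im| ≤ T) (hqv : ∀ i ∈ I, σ + κ * |(q i).im| + 1 ≤ v)
    (hσv : σ + 1 ≤ v) (hv : v + 2 < σ + κ * T) (hy : y + 1 < T) {c : ℝ} (hc : σ < c)
    (hc' : c < ⌊σ⌋ + 1) :
    ∃ D R : ℝ, 0 ≤ D ∧ ∀ L : ℂ, |L.im| ≤ Real.pi → R < κ * L.re →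
      ‖(2 * Real.pi * Complex.I)⁻¹ *
          contourIntegral κ T (fun s => cscKernel φ s * Complex.exp (s * L)) c -
        (∑ i ∈ I, Complex.exp (q i * L) *
          ∑ p ∈ expansionIndex K J, logTerm (q i) (lam i) (θ i) (ψ i) p L +
          ρ * Complex.exp (σ * L))‖ * ‖L‖ ^ n ≤ D * Real.exp (σ * L.re) := by
  have hκ := h.slope_pos
  have hκ1 := h.slope_le
  have hT0 : 0 ≤ T := by linarith [h.one_le]
  set X : Finset (ι × (ℕ × ℤ)) := I ×ˢ expansionIndex K J with hX
  set α : ι × (ℕ × ℤ) → ℂ := fun x => taylorCoeffAt (ψ x.1) 0 x.2.1 * cscCoeff (q x.1) x.2.2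
  set Q : ι × (ℕ × ℤ) → ℂ := fun x => q x.1
  set a : ι × (ℕ × ℤ) → ℂ := fun x => θ x.1 * x.2.1 + x.2.2 - lam x.1
  have hXI : ∀ x ∈ X, x.1 ∈ I := fun x hx => (Finset.mem_product.1 hx).1
  have hQ : ∀ x ∈ X, (Q x).re ≤ σ := fun x hx => (hq.re_eq _ (hXI x hx)).le
  have hQT : ∀ x ∈ X, |(Q x).im| ≤ T := fun x hx => hT _ (hXI x hx)
  have hQv : ∀ x ∈ X, (Q x).re + κ * |(Q x).im| + 1 ≤ v := fun x hx => by
    rw [hq.re_eq _ (hXI x hx)]; exact hqv _ (hXI x hx)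
  have hb := h.slantedExpBound T
  have hterm : ∀ x ∈ X, SlantedExpBound κ v y σ (⌊σ⌋ + 1) T fun s => α x * (s - Q x) ^ a x :=
    fun x hx => (SlantedExpBound.cpow hκ hκ1 (hQ x hx) (a x) _ T y (hQv x hx)).const_mul _
  have hf₁ := hb.sub (SlantedExpBound.finsetSum X hterm)
  obtain ⟨R₁, hR₁⟩ := hb.contourIntegral_sub_sum_cpow hκ hκ1 hT0 (by linarith) (by linarith) X α Q a
    hQ hQT hQv
  -- The simple pole is the power with exponent `-1`, for which Hankel's formula gives `2πi ρ
  -- e^{σL}` because `Γ 1 = 1`.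
  obtain ⟨R₂, hR₂⟩ := hf₁.contourIntegral_sub_sum_cpow hκ hκ1 hT0 (by linarith) (by linarith)
    {()} (fun _ => ρ) (fun _ => (σ : ℂ)) (fun _ => -1) (by simp) (by simpa using hT0)
    (by simpa using hσv)
  have hrem : (fun s => cscKernel φ s - ∑ x ∈ X, α x * (s - Q x) ^ a x -
      ∑ _x ∈ ({()} : Finset Unit), ρ * (s - σ) ^ (-1 : ℂ)) = cscRemainder φ σ I q lam θ ψ ρ K J := by
    ext s
    rw [cscRemainder, hX, Finset.sum_product, Finset.sum_singleton]
    rfl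
  have hf₂ : SlantedExpBound κ v y σ (⌊σ⌋ + 1) T (cscRemainder φ σ I q lam θ ψ ρ K J) := by
    rw [← hrem]
    refine hf₁.sub (SlantedExpBound.finsetSum _ fun _ _ =>
      (SlantedExpBound.cpow hκ hκ1 (q := (σ : ℂ)) (by simp) _ _ T y (by simpa using hσv)).const_mul _)
  obtain ⟨D, R₃, hD, hR₃⟩ := hf₂.norm_contourIntegral_le hκ hκ1 hT0 hv hy (hc.trans hc') n
    (exists_bound_strip fun p hp _ => by
      obtain ⟨C', hC'⟩ := hq.rightRegularAt_cscRemainder h hρ hK hJ hp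
      refine ⟨C', ?_⟩
      filter_upwards [hC'] with s hs hlt using (hs hlt).2)
  refine ⟨‖(2 * Real.pi * Complex.I : ℂ)⁻¹‖ * D, max R₁ (max R₂ R₃), by positivity,
    fun L hL hLre => ?_⟩
  simp only [max_lt_iff] at hLre
  obtain ⟨h1, h2, h3⟩ := hLre
  have e1 := hR₁ L hL h1 c hc hc'
  have e2 := hR₂ L hL h2 c hc hc'
  have e3 := hR₃ L hL h3 c hc hc'
  have e4 : (fun s => (cscKernel φ s - ∑ x ∈ X, α x * (s - Q x) ^ a x -
      ∑ _x ∈ ({()} : Finset Unit), ρ * (s - σ) ^ (-1 : ℂ)) * Complex.exp (s * L)) =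
      fun s => cscRemainder φ σ I q lam θ ψ ρ K J s * Complex.exp (s * L) := by
    rw [← hrem]
  rw [e4, e1, Finset.sum_singleton, neg_neg, sub_self, Complex.cpow_zero, Complex.Gamma_one,
    inv_one, mul_one, mul_one] at e2
  have hne : (2 * Real.pi * Complex.I : ℂ) ≠ 0 := by simp [Real.pi_ne_zero]
  have e5 : ∑ x ∈ X, α x * (Complex.exp (Q x * L) * L ^ (-a x - 1) * (Complex.Gamma (-a x))⁻¹) =
      ∑ i ∈ I, Complex.exp (q i * L) *
          ∑ p ∈ expansionIndex K J, logTerm (q i) (lam i) (θ i) (ψ i) p L := by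
    rw [hX, Finset.sum_product]
    refine Finset.sum_congr rfl fun i _ => ?_
    rw [Finset.mul_sum]
    refine Finset.sum_congr rfl fun p _ => ?_
    simp only [logTerm, α, Q, a]
    rw [show -(θ i * p.1 + p.2 - lam i) = -θ i * p.1 - p.2 + lam i by ring]
    ring
  rw [e5] at e2
  have e6 : (2 * Real.pi * Complex.I)⁻¹ *
        contourIntegral κ T (fun s => cscKernel φ s * Complex.exp (s * L)) c -
      (∑ i ∈ I, Complex.exp (q i * L) *
        ∑ p ∈ expansionIndex K J, logTerm (q i) (lam i) (θ i) (ψ i) p L +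
        ρ * Complex.exp (σ * L)) = (2 * Real.pi * Complex.I)⁻¹ *
      contourIntegral κ T (fun s => cscRemainder φ σ I q lam θ ψ ρ K J s * Complex.exp (s * L)) c := by
    rw [e2, mul_sub, mul_sub, inv_mul_cancel_left₀ hne, inv_mul_cancel_left₀ hne]
    ring
  have e7 := mul_le_mul_of_nonneg_left e3 (norm_nonneg (2 * Real.pi * Complex.I : ℂ)⁻¹)
  rw [← mul_assoc, ← mul_assoc] at e7
  rw [e6, norm_mul]
  exact e7

end LineSingularities

/-! ### Orders of magnitude at infinity -/

/-- The filter of neighbourhoods of `∞` in the slit plane. -/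
def atInfSlit : Filter ℂ := Bornology.cobounded ℂ ⊓ 𝓟 Complex.slitPlane

theorem eventually_mem_slitPlane : ∀ᶠ z in atInfSlit, z ∈ Complex.slitPlane :=
  mem_inf_of_right (mem_principal_self _)

theorem tendsto_norm_atInfSlit : Tendsto (fun z : ℂ => ‖z‖) atInfSlit atTop :=
  tendsto_norm_cobounded_atTop.mono_left inf_le_left

theorem tendsto_log_re_atInfSlit : Tendsto (fun z : ℂ => (Complex.log z).re) atInfSlit atTop := by
  simp only [Complex.log_re]
  exact Real.tendsto_log_atTop.comp tendsto_norm_atInfSlit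

theorem eventually_one_le_norm_log : ∀ᶠ z in atInfSlit, 1 ≤ ‖Complex.log z‖ := by
  filter_upwards [tendsto_log_re_atInfSlit.eventually_ge_atTop 1] with z hz
  exact hz.trans (Complex.re_le_norm _)

theorem isBigO_cpow_atInfSlit (a : ℂ) :
    (fun z : ℂ => z ^ a) =O[atInfSlit] fun z => ‖z‖ ^ a.re := by
  refine IsBigO.of_bound (Real.exp (Real.pi * |a.im|)) ?_
  filter_upwards [eventually_mem_slitPlane] with z hz
  rw [Complex.norm_cpow_of_ne_zero (Complex.slitPlane_ne_zero hz),
    Real.norm_of_nonneg (by positivity), div_eq_mul_inv, ← Real.exp_neg, mul_comm]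
  refine mul_le_mul_of_nonneg_right (Real.exp_le_exp.2 ?_) (by positivity)
  refine (neg_le_abs _).trans ?_
  rw [abs_mul]
  exact mul_le_mul_of_nonneg_right (Complex.abs_arg_le_pi z) (abs_nonneg _)

theorem isBigO_norm_log_rpow {x x' : ℝ} (h : x ≤ x') :
    (fun z : ℂ => ‖Complex.log z‖ ^ x) =O[atInfSlit] fun z => ‖Complex.log z‖ ^ x' := by
  refine IsBigO.of_bound 1 ?_
  filter_upwards [eventually_one_le_norm_log] with z hz
  rw [Real.norm_of_nonneg (by positivity), Real.norm_of_nonneg (by positivity), one_mul]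
  exact Real.rpow_le_rpow_of_exponent_le hz h

theorem isBigO_log_cpow (a : ℂ) :
    (fun z : ℂ => Complex.log z ^ a) =O[atInfSlit] fun z => ‖Complex.log z‖ ^ a.re := by
  refine IsBigO.of_bound (Real.exp (Real.pi * |a.im|)) ?_
  filter_upwards [eventually_one_le_norm_log] with z hz
  have h0 : Complex.log z ≠ 0 := norm_pos_iff.1 (one_pos.trans_le hz)
  rw [Complex.norm_cpow_of_ne_zero h0,
    Real.norm_of_nonneg (by positivity), div_eq_mul_inv, ← Real.exp_neg, mul_comm]
  refine mul_le_mul_of_nonneg_right (Real.exp_le_exp.2 ?_) (by positivity)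
  refine (neg_le_abs _).trans ?_
  rw [abs_mul]
  exact mul_le_mul_of_nonneg_right (Complex.abs_arg_le_pi _) (abs_nonneg _)

/-- A gain in the power of `|z|` outweighs any power of `log z`. As soon as `log |z| ≥ π`, the bound
`|log z| ≤ 2 log |z|` holds and reduces this to the real logarithm. -/
theorem isBigO_rpow_mul_log_rpow {a σ : ℝ} (h : a < σ) (x : ℝ) :
    (fun z : ℂ => ‖z‖ ^ a) =O[atInfSlit] fun z => ‖z‖ ^ σ * ‖Complex.log z‖ ^ x := by
  have h1 : (fun z : ℂ => Real.log ‖z‖ ^ |x|) =O[atInfSlit] fun z => ‖z‖ ^ (σ - a) :=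
    (isLittleO_log_rpow_rpow_atTop |x| (sub_pos.2 h)).isBigO.comp_tendsto tendsto_norm_atInfSlit
  obtain ⟨C, hC, hb⟩ := h1.exists_pos
  refine IsBigO.of_bound (2 ^ |x| * C) ?_
  filter_upwards [hb.bound, eventually_one_le_norm_log, eventually_mem_slitPlane,
    tendsto_log_re_atInfSlit.eventually_ge_atTop Real.pi] with z hz hlog hs hre
  have hz0 : 0 < ‖z‖ := norm_pos_iff.2 (Complex.slitPlane_ne_zero hs)
  have hr : Real.pi ≤ Real.log ‖z‖ := by rwa [Complex.log_re] at hre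
  have hr0 : 0 ≤ Real.log ‖z‖ := Real.pi_pos.le.trans hr
  have h2 : ‖Complex.log z‖ ≤ 2 * Real.log ‖z‖ := by
    refine (Complex.norm_le_abs_re_add_abs_im _).trans ?_
    rw [Complex.log_re, Complex.log_im, abs_of_nonneg hr0]
    linarith [Complex.abs_arg_le_pi z]
  have h3 : ‖Complex.log z‖ ^ (-x) ≤ 2 ^ |x| * C * ‖z‖ ^ (σ - a) := by
    calc ‖Complex.log z‖ ^ (-x) ≤ ‖Complex.log z‖ ^ |x| :=
          Real.rpow_le_rpow_of_exponent_le hlog (neg_le_abs x)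
      _ ≤ (2 * Real.log ‖z‖) ^ |x| := Real.rpow_le_rpow (norm_nonneg _) h2 (abs_nonneg x)
      _ = 2 ^ |x| * Real.log ‖z‖ ^ |x| := Real.mul_rpow two_pos.le hr0
      _ ≤ _ := by
          rw [mul_assoc]
          refine mul_le_mul_of_nonneg_left ?_ (by positivity)
          rwa [Real.norm_of_nonneg (by positivity), Real.norm_of_nonneg (by positivity)] at hz
  have hl0 : 0 < ‖Complex.log z‖ := one_pos.trans_le hlog
  rw [Real.norm_of_nonneg (by positivity), Real.norm_of_nonneg (by positivity)]
  calc ‖z‖ ^ a = ‖z‖ ^ a * ‖Complex.log z‖ ^ x * ‖Complex.log z‖ ^ (-x) := by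
        rw [mul_assoc, ← Real.rpow_add hl0, add_neg_cancel, Real.rpow_zero, mul_one]
    _ ≤ ‖z‖ ^ a * ‖Complex.log z‖ ^ x * (2 ^ |x| * C * ‖z‖ ^ (σ - a)) :=
        mul_le_mul_of_nonneg_left h3 (by positivity)
    _ = 2 ^ |x| * C * (‖z‖ ^ a * ‖z‖ ^ (σ - a) * ‖Complex.log z‖ ^ x) := by ring
    _ = _ := by rw [← Real.rpow_add hz0, add_sub_cancel]

/-- Every term beyond the truncation has `Re (θ k + j) ≥ K`, so it is no larger than the error term.
This permits working with rectangular index sets. -/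
theorem isBigO_sum_logTerm_sub {q lam θ : ℂ} {ψ : ℂ → ℂ} (hθ : 0 < θ.re) {K : ℝ}
    {S : Finset (ℕ × ℤ)} (hS : truncIndex θ K ⊆ S) (hS' : ∀ p ∈ S, -1 ≤ p.2) :
    (fun z => ∑ p ∈ S, logTerm q lam θ ψ p (Complex.log z) - logPartialSum q lam θ ψ K z)
      =O[atInfSlit] fun z => ‖Complex.log z‖ ^ (lam.re - K - 1) := by
  have h1 : (fun z => ∑ p ∈ S, logTerm q lam θ ψ p (Complex.log z) - logPartialSum q lam θ ψ K z) =
      fun z => ∑ p ∈ S \ truncIndex θ K, logTerm q lam θ ψ p (Complex.log z) := by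
    ext z
    rw [← Finset.sum_sdiff hS]
    exact add_sub_cancel_right _ _
  rw [h1]
  refine IsBigO.fun_sum fun p hp => ?_
  rw [Finset.mem_sdiff] at hp
  have h2 : ¬ (θ.re * (p.1 : ℝ) + (p.2 : ℝ) < K) := fun h =>
    hp.2 ((mem_truncIndex hθ K p.1 p.2).2 ⟨hS' p hp.1, h⟩)
  refine ((isBigO_log_cpow _).const_mul_left _).trans (isBigO_norm_log_rpow ?_)
  simp
  linarith

theorem mem_expansionIndex {K J : ℕ} {p : ℕ × ℤ} :
    p ∈ expansionIndex K J ↔ p.1 < K ∧ -1 ≤ p.2 ∧ p.2 < J - 1 := by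
  simp [expansionIndex]

theorem truncIndex_subset_expansionIndex {θ : ℂ} {K : ℝ} {K₁ J : ℕ} (hK : (K + 1) / θ.re ≤ K₁)
    (hJ : K + 1 ≤ J) : truncIndex θ K ⊆ expansionIndex K₁ J := by
  intro p hp
  simp only [truncIndex, Finset.mem_filter, Finset.mem_product, Finset.mem_range,
    Finset.mem_Ico] at hp
  rw [mem_expansionIndex]
  refine ⟨hp.1.1.trans_le (Nat.ceil_le.2 hK), hp.1.2.1, hp.1.2.2.trans_le (Int.ceil_le.2 ?_)⟩
  push_cast
  linarith

/-! ### Matching the residues with `nMax`, and the expansion -/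

/-- The coefficient `ρ` is the same as that of the pole subtracted on the line `Re s = σ`, so `ρ
z^σ` drops out of the final expansion. The last sum contains only powers of exponent less than `σ`
and is negligible. -/
theorem exists_residueSum_eq {M N : ℕ} (φ : ℂ → ℂ) {s : Fin M → ℂ} {σ : ℝ}
    (hlead : ∀ m : Fin M, (m : ℕ) < N → (s m).re = σ)
    (hint : ∀ m : Fin M, ∀ b : ℤ, s m = b → b ≤ 0) :
    ∃ (ρ : ℂ) (n₀ : ℕ),
      IsPolarPart φ σ (Finset.univ.filter fun m : Fin M => (m : ℕ) < N) s ρ ∧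
      (n₀ = 0 ∨ (n₀ : ℝ) < σ) ∧ ∀ z : ℂ, z ≠ 0 → residueSum φ ⌊σ⌋ z =
        ∑ n ∈ Finset.range (nMax s N σ + 1).toNat,
          (-1 : ℂ) ^ (n + 1) * φ (-(n : ℂ)) * z ^ (-(n : ℤ)) + ρ * z ^ (σ : ℂ) +
        ∑ n ∈ Finset.range n₀, φ ((n + 1 : ℕ) : ℂ) * (-z) ^ (n + 1) := by
  by_cases hP : (∃ a : ℤ, σ = a) ∧ ∀ m : Fin M, (m : ℕ) < N → ∀ a : ℤ, s m ≠ a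
  · have hn : nMax s N σ = ⌊-σ⌋ := if_pos hP
    obtain ⟨⟨b, rfl⟩, hP⟩ := hP
    have hn' : nMax s N b = -b := by rw [hn, ← Int.cast_neg, Int.floor_intCast]
    -- If `b ≤ 0`, the residues stop at `z^{b+1}`, and `ρ z^b` cancels the additional last term `n =
    -- -b` of the sum up to `nMax`. If `b > 0`, it is the top term of the positive powers, and only
    -- `b - 1` of them remain.
    refine ⟨(-1) ^ b * φ b, b.toNat - 1, Or.inr ⟨b, rfl, rfl, fun i hi => hP i (by simpa using hi) b⟩,
      ?_, fun z hz => ?_⟩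
    · rcases le_or_gt b 0 with h | h
      · left; omega
      · right
        have : ((b.toNat - 1 : ℕ) : ℤ) < b := by omega
        exact_mod_cast this
    · rw [hn', residueSum, Int.floor_intCast, Complex.ofReal_intCast, Complex.cpow_intCast]
      rcases le_or_gt b 0 with h | h
      · obtain ⟨d, rfl⟩ : ∃ d : ℕ, b = -d := ⟨(-b).toNat, by omega⟩
        have h1 : (-(d : ℤ)).toNat = 0 := by omega
        have h2 : (-(-(d : ℤ)) + 1).toNat = d + 1 := by omega
        have h3 : (-(-(d : ℤ))).toNat = d := by omega
        have h4 : ((-1 : ℂ)) ^ (-(d : ℤ)) = (-1) ^ d := by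
          rw [zpow_neg, zpow_natCast, ← inv_pow]; norm_num
        rw [h1, h2, h3, h4, Finset.sum_range_succ]
        push_cast
        simp only [Finset.range_zero, Finset.sum_empty]
        ring
      · obtain ⟨d, rfl⟩ : ∃ d : ℕ, b = d + 1 := ⟨(b - 1).toNat, by omega⟩
        have h1 : ((d : ℤ) + 1).toNat = d + 1 := by omega
        have h2 : (-((d : ℤ) + 1)).toNat = 0 := by omega
        have h3 : (-((d : ℤ) + 1) + 1).toNat = 0 := by omega
        have h4 : ((d : ℤ) + 1) = ((d + 1 : ℕ) : ℤ) := by push_cast; ring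
        rw [h1, h2, h3, Finset.sum_range_succ, h4, zpow_natCast, zpow_natCast, neg_pow z (d + 1)]
        simp only [Nat.add_sub_cancel, Finset.range_zero, Finset.sum_empty]
        push_cast
        ring
  · have hn : nMax s N σ = ⌈-σ⌉ - 1 := if_neg hP
    have hn' : nMax s N σ + 1 = -⌊σ⌋ := by rw [hn, Int.ceil_neg]; ring
    -- In this case an integer `σ` must be one of the leading `s m`: an integer with real part `σ`
    -- equals `σ`. So no separate pole occurs.
    have hint' : ∀ b : ℤ, σ = b → ∃ m : Fin M, (m : ℕ) < N ∧ s m = b := by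
      intro b hb
      by_contra! h
      refine hP ⟨⟨b, hb⟩, fun m hm a ha => ?_⟩
      have h1 := hlead m hm
      rw [ha, Complex.intCast_re, hb] at h1
      have h2 : a = b := by exact_mod_cast h1
      exact h m hm (by rw [ha, h2])
    refine ⟨0, ⌊σ⌋.toNat, Or.inl ⟨rfl, fun b hb => ?_⟩, ?_, fun z hz => ?_⟩
    · obtain ⟨m, hm, hmb⟩ := hint' b hb
      exact ⟨m, by simpa using hm, hmb⟩
    -- For positive `⌊σ⌋` equality with `σ` would make some `s m` a positive integer; so all
    -- positive powers have exponent strictly below `σ`.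
    · rcases le_or_gt ⌊σ⌋ 0 with h | h
      · left; omega
      · right
        have h1 : ((⌊σ⌋.toNat : ℕ) : ℤ) = ⌊σ⌋ := Int.toNat_of_nonneg h.le
        have h2 : ((⌊σ⌋.toNat : ℕ) : ℝ) = ⌊σ⌋ := by exact_mod_cast h1
        rw [h2]
        refine lt_of_le_of_ne (Int.floor_le σ) fun h3 => ?_
        obtain ⟨m, hm, hmb⟩ := hint' ⌊σ⌋ h3.symm
        have := hint m _ hmb
        omega
    · rw [hn', residueSum]
      ring

/-- Disjoint cuts have distinct end points. A point of the line other than `s m` lies in the open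
cone at `s m`, since `Re (p - s m) ≥ 0`. So near a given `s i` only the cone at `s i` itself is a
restriction. -/
theorem lineSingularities {M N : ℕ} {φ : ℂ → ℂ} {s lam θ : Fin M → ℂ} {ω : Fin M → ℝ}
    {ψ : Fin M → ℂ → ℂ} {κ σ : ℝ} (hκ0 : 0 < κ) (hκ : ∀ m, κ ≤ Real.cos (ω m))
    (hω : ∀ m, |ω m| < Real.pi / 2) (hφ : DifferentiableOn ℂ φ (slitDomain s ω))
    (hsing : ∀ m, HasAlgebraicSingularity φ (s m) (ω m) (lam m) (θ m) (ψ m))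
    (hdisj : Pairwise fun m m' => Disjoint (branchCut (s m) (ω m)) (branchCut (s m') (ω m')))
    (hlead : ∀ m : Fin M, (m : ℕ) < N → (s m).re = σ)
    (hrest : ∀ m : Fin M, N ≤ (m : ℕ) → (s m).re < σ) :
    LineSingularities φ σ κ (Finset.univ.filter fun m : Fin M => (m : ℕ) < N) s lam θ ψ := by
  have hinj : ∀ i j, s i = s j → i = j := by
    intro i j hij
    by_contra hne
    refine Set.disjoint_left.1 (hdisj hne) (mem_branchCut_self (s i) (ω i)) ?_
    rw [hij]; exact mem_branchCut_self _ _
  have hcone : ∀ p : ℂ, p.re = σ → ∀ m, p ≠ s m → p ∈ rightCone κ (s m) := by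
    intro p hp m hpm
    rcases lt_or_ge (m : ℕ) N with hm | hm
    · change -κ * ‖p - s m‖ < (p - s m).re
      rw [Complex.sub_re, hp, hlead m hm, sub_self]
      have := norm_pos_iff.2 (sub_ne_zero.2 hpm)
      nlinarith
    · exact mem_rightCone_of_re_lt hκ0.le (by rw [hp]; exact hrest m hm)
  have hU := isOpen_iInter_rightCone κ s
  have hdU : DifferentiableOn ℂ φ {z : ℂ | ∀ m, z ∈ rightCone κ (s m)} :=
    hφ.mono fun z hz => mem_slitDomain hκ hz
  refine ⟨fun i hi => hlead i (by simpa using hi), fun i _ j _ => hinj i j,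
    fun i _ => (hsing i).re_pos, fun i _ => (hsing i).analytic,
    fun i _ => (hsing i).eventually_rightCone (hω i) (hκ i), fun i hi => ?_, fun p hp hpq => ?_⟩
  · have h1 : ∀ m, ∀ᶠ z in 𝓝 (s i), m ≠ i → z ∈ rightCone κ (s m) := by
      intro m
      by_cases hm : m = i
      · exact Eventually.of_forall fun z h => absurd hm h
      · filter_upwards [(isOpen_rightCone κ (s m)).mem_nhds (hcone (s i)
          (hlead i (by simpa using hi)) m fun h => hm (hinj i m h).symm)] with z hz _ using hz
    filter_upwards [eventually_all.2 h1] with z hz hzi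
    refine hdU.differentiableAt (hU.mem_nhds fun m => ?_)
    by_cases hm : m = i
    · rwa [hm]
    · exact hz m hm
  · refine hdU.analyticAt (hU.mem_nhds fun m => hcone p hp m fun hpm => ?_)
    refine hpq m ?_ hpm
    by_contra hm
    have := hrest m (by simpa using hm)
    rw [← hpm, hp] at this
    exact lt_irrefl _ this

theorem isBigO_single_sum {ι : Type*} {I : Finset ι} (lam : ι → ℂ) (σ K : ℝ) {i : ι} (hi : i ∈ I) :
    (fun z : ℂ => ‖z‖ ^ σ * ‖Complex.log z‖ ^ ((lam i).re - K - 1))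
      =O[atInfSlit] fun z => ‖z‖ ^ σ * ∑ i ∈ I, ‖Complex.log z‖ ^ ((lam i).re - K - 1) := by
  refine IsBigO.of_bound 1 (Eventually.of_forall fun z => ?_)
  have h1 : ‖Complex.log z‖ ^ ((lam i).re - K - 1) ≤
      ∑ i ∈ I, ‖Complex.log z‖ ^ ((lam i).re - K - 1) :=
    Finset.single_le_sum (f := fun i => ‖Complex.log z‖ ^ ((lam i).re - K - 1))
      (fun j _ => by positivity) hi
  have h2 : 0 ≤ ‖Complex.log z‖ ^ ((lam i).re - K - 1) := by positivity
  rw [one_mul, Real.norm_of_nonneg (by positivity),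
    Real.norm_of_nonneg (mul_nonneg (by positivity) (h2.trans h1))]
  exact mul_le_mul_of_nonneg_left h1 (by positivity)

namespace LineSingularities

variable {ι : Type*} {φ : ℂ → ℂ} {σ κ : ℝ} {I : Finset ι} {q lam θ : ι → ℂ} {ψ : ι → ℂ → ℂ}
  {A v y C : ℝ}

/-- The asymptotic expansion of the contour integral. -/
theorem isBigO_contourIntegral_sub (hq : LineSingularities φ σ κ I q lam θ ψ)
    (h : CutPlaneBound φ σ A κ v y C) {ρ : ℂ} (hρ : IsPolarPart φ σ I q ρ)
    {T : ℝ} (hT : ∀ i ∈ I, |(q i).im| ≤ T) (hqv : ∀ i ∈ I, σ + κ * |(q i).im| + 1 ≤ v)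
    (hσv : σ + 1 ≤ v) (hv : v + 2 < σ + κ * T) (hy : y + 1 < T) {c : ℝ} (hc : σ < c)
    (hc' : c < ⌊σ⌋ + 1) (hI : I.Nonempty) (K : ℝ) :
    (fun z : ℂ => (2 * Real.pi * Complex.I)⁻¹ * contourIntegral κ T
        (fun s => cscKernel φ s * Complex.exp (s * Complex.log z)) c -
        (∑ i ∈ I, z ^ q i * logPartialSum (q i) (lam i) (θ i) (ψ i) K z + ρ * z ^ (σ : ℂ)))
      =O[atInfSlit] fun z => ‖z‖ ^ σ * ∑ i ∈ I, ‖Complex.log z‖ ^ ((lam i).re - K - 1) := by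
  obtain ⟨i₀, hi₀⟩ := hI
  -- Enough integrations by parts that `|log z|^{-n}` is dominated by the summand of the error term
  -- that belongs to `i₀`.
  obtain ⟨n, hn⟩ := exists_nat_ge (-((lam i₀).re - K - 1))
  -- One `k` for all singularities: the `k × k` index set gives the required order of the remainder
  -- and contains every `truncIndex`.
  have hev : ∀ᶠ k : ℕ in atTop, ∀ i ∈ I, (n + 1 + (lam i).re ≤ (θ i).re * k ∧
      (K + 1) / (θ i).re ≤ k) ∧ (n + 1 + (lam i).re ≤ k ∧ K + 1 ≤ k) := by
    rw [Filter.eventually_all_finset]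
    intro i hi
    have h1 : Tendsto (fun k : ℕ => (k : ℝ)) atTop atTop := tendsto_natCast_atTop_atTop
    have h2 := h1.const_mul_atTop (hq.re_pos i hi)
    filter_upwards [h2.eventually_ge_atTop (n + 1 + (lam i).re),
      h1.eventually_ge_atTop ((K + 1) / (θ i).re), h1.eventually_ge_atTop (n + 1 + (lam i).re),
      h1.eventually_ge_atTop (K + 1)] with k a b c d using ⟨⟨a, b⟩, c, d⟩
  obtain ⟨k, hk⟩ := hev.exists
  obtain ⟨D, R, hD, hR⟩ := hq.norm_contourIntegral_sub_le h hρ (n := n) (K := k) (J := k)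
    (fun i hi => (hk i hi).1.1) (fun i hi => (hk i hi).2.1) hT hqv hσv hv hy hc hc'
  have hrem : (fun z : ℂ => (2 * Real.pi * Complex.I)⁻¹ * contourIntegral κ T
        (fun s => cscKernel φ s * Complex.exp (s * Complex.log z)) c -
        (∑ i ∈ I, Complex.exp (q i * Complex.log z) *
          ∑ p ∈ expansionIndex k k, logTerm (q i) (lam i) (θ i) (ψ i) p (Complex.log z) +
          ρ * Complex.exp (σ * Complex.log z)))
      =O[atInfSlit] fun z => ‖z‖ ^ σ * ‖Complex.log z‖ ^ ((lam i₀).re - K - 1) := by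
    refine IsBigO.of_bound D ?_
    have hκ := h.slope_pos
    filter_upwards [eventually_one_le_norm_log, eventually_mem_slitPlane,
      (tendsto_log_re_atInfSlit.const_mul_atTop hκ).eventually_gt_atTop R] with z hlog hz hre
    have h1 := hR (Complex.log z) (by rw [Complex.log_im]; exact Complex.abs_arg_le_pi z) hre
    have hz0 : 0 < ‖z‖ := norm_pos_iff.2 (Complex.slitPlane_ne_zero hz)
    have hl0 : 0 < ‖Complex.log z‖ := one_pos.trans_le hlog
    have h2 : Real.exp (σ * (Complex.log z).re) = ‖z‖ ^ σ := by
      rw [Complex.log_re, Real.rpow_def_of_pos hz0, mul_comm]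
    rw [h2, ← le_div_iff₀ (by positivity)] at h1
    refine h1.trans ?_
    rw [Real.norm_of_nonneg (by positivity), ← mul_assoc, div_eq_mul_inv, ← Real.rpow_natCast,
      ← Real.rpow_neg hl0.le]
    refine mul_le_mul_of_nonneg_left ?_ (by positivity)
    exact Real.rpow_le_rpow_of_exponent_le hlog (by linarith)
  have hsum : (fun z : ℂ => ∑ i ∈ I, z ^ q i *
      (∑ p ∈ expansionIndex k k, logTerm (q i) (lam i) (θ i) (ψ i) p (Complex.log z) -
        logPartialSum (q i) (lam i) (θ i) (ψ i) K z))
      =O[atInfSlit] fun z => ‖z‖ ^ σ * ∑ i ∈ I, ‖Complex.log z‖ ^ ((lam i).re - K - 1) := by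
    refine IsBigO.fun_sum fun i hi => IsBigO.trans (IsBigO.mul ?_ ?_) (isBigO_single_sum lam σ K hi)
    · have := isBigO_cpow_atInfSlit (q i)
      rwa [hq.re_eq i hi] at this
    · exact isBigO_sum_logTerm_sub (hq.re_pos i hi)
        (truncIndex_subset_expansionIndex (hk i hi).1.2 (hk i hi).2.2)
        fun p hp => (mem_expansionIndex.1 hp).2.1
  refine ((hrem.trans (isBigO_single_sum lam σ K hi₀)).add hsum).congr' ?_ EventuallyEq.rfl
  filter_upwards [eventually_mem_slitPlane] with z hz
  have hexp : ∀ a : ℂ, Complex.exp (a * Complex.log z) = z ^ a := fun a => by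
    rw [Complex.cpow_def_of_ne_zero (Complex.slitPlane_ne_zero hz), mul_comm]
  simp only [hexp, mul_sub, Finset.sum_sub_distrib]
  ring

end LineSingularities

/-- Each exponent `n + 1 ≤ n₀` is strictly less than `σ`, which leaves room for any power of the
logarithm. -/
theorem isBigO_sum_neg_pow (a : ℕ → ℂ) {n₀ : ℕ} {σ : ℝ} (h : n₀ = 0 ∨ (n₀ : ℝ) < σ) (x : ℝ) :
    (fun z : ℂ => ∑ n ∈ Finset.range n₀, a n * (-z) ^ (n + 1)) =O[atInfSlit]
      fun z => ‖z‖ ^ σ * ‖Complex.log z‖ ^ x := by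
  refine IsBigO.fun_sum fun n hn => IsBigO.const_mul_left ?_ _
  rw [Finset.mem_range] at hn
  have h1 : ((n + 1 : ℕ) : ℝ) < σ := by
    rcases h with h | h
    · omega
    · refine lt_of_le_of_lt ?_ h
      exact_mod_cast hn
  refine (IsBigO.of_bound 1 (Eventually.of_forall fun z => ?_)).trans (isBigO_rpow_mul_log_rpow h1 x)
  rw [Real.rpow_natCast, norm_pow, norm_pow, norm_neg, norm_norm, one_mul]

end

theorem mainTheorem4 (M N : ℕ) (hN : 1 ≤ N) (hNM : N ≤ M)
    (φ : ℂ → ℂ) (s lam θ : Fin M → ℂ) (ω : Fin M → ℝ) (ψ : Fin M → ℂ → ℂ) (A σ : ℝ)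
    -- `φ` is analytic off the cuts, with singularities of algebraic type at the `s m`
    (hφ : DifferentiableOn ℂ φ (slitDomain s ω))
    (hsing : ∀ m, HasAlgebraicSingularity φ (s m) (ω m) (lam m) (θ m) (ψ m))
    -- the cuts go to the left, are not horizontal, are disjoint and avoid the positive integers
    (hω : ∀ m, ω m ∈ Set.Ioo (-(Real.pi / 2)) 0 ∪ Set.Ioo 0 (Real.pi / 2))
    (hdisj : Pairwise fun m m' => Disjoint (branchCut (s m) (ω m)) (branchCut (s m') (ω m')))
    (hint : ∀ m, ∀ n : ℕ, 1 ≤ n → (n : ℂ) ∉ branchCut (s m) (ω m))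
    -- growth
    (hA0 : 0 < A) (hA : ∀ m, A < Real.pi * |Real.sin (ω m)|)
    (hgrowth : GrowthOn φ (slitDomain s ω) A)
    -- the first `N` singularities have the largest real part `σ`
    (hlead : ∀ m : Fin M, (m : ℕ) < N → (s m).re = σ)
    (hrest : ∀ m : Fin M, N ≤ (m : ℕ) → (s m).re < σ) :
    ∃ (R : ℝ) (F : ℂ → ℂ),
      -- `F` is the analytic continuation of `∑ φ(n) (-z)^n`
      (∀ z : ℂ, ‖z‖ < Real.exp (-A) →
        HasSum (fun n : ℕ => φ ((n + 1 : ℕ) : ℂ) * (-z) ^ (n + 1)) (F z)) ∧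
      DifferentiableOn ℂ F (continuationDomain A R) ∧
      -- the asymptotic expansion as `|z| → ∞`, uniformly in `|arg z| < π`
      ∀ K : ℝ,
        (fun z : ℂ => F z
            - (∑ n ∈ Finset.range (nMax s N σ + 1).toNat,
                (-1 : ℂ) ^ (n + 1) * φ (-(n : ℂ)) * z ^ (-(n : ℤ))
              - ∑ m ∈ Finset.univ.filter (fun m : Fin M => (m : ℕ) < N),
                  z ^ (s m) * logPartialSum (s m) (lam m) (θ m) (ψ m) K z))
          =O[Bornology.cobounded ℂ ⊓ 𝓟 Complex.slitPlane]
        (fun z : ℂ => ‖z‖ ^ σ *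
            ∑ m ∈ Finset.univ.filter (fun m : Fin M => (m : ℕ) < N), ‖Complex.log z‖ ^ ((lam m).re - K - 1)) := by
  have hω' : ∀ m, |ω m| < Real.pi / 2 := fun m => abs_lt_pi_div_two_of_mem (hω m)
  obtain ⟨κ, hκ0, hκ1, hκ⟩ := exists_pos_le_cos hω'
  obtain ⟨I₀, hI₀, him⟩ := exists_abs_im_le s
  have hre : ∀ m, (s m).re ≤ σ := fun m => by
    rcases lt_or_ge (m : ℕ) N with hm | hm
    · exact (hlead m hm).le
    · exact (hrest m hm).le
  -- Places the slanted regions to the right of all `s m`, with margin `1`.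
  set v : ℝ := σ + κ * I₀ + 1 with hv
  have him' : ∀ m, κ * |(s m).im| ≤ κ * I₀ := fun m =>
    mul_le_mul_of_nonneg_left (him m) hκ0.le
  obtain ⟨y, hy0, C, h⟩ := exists_cutPlaneBound (y₀ := 0) (v := v) hφ hκ0 hκ1 hκ hre
    (fun m => by linarith [hre m, him' m]) hA0 hgrowth
  -- High enough that the vertical segment passes all `s m` and its ends lie in the slanted regions;
  -- the `3 / κ` pays for the margin `1` in `v` and the loss `2` from Cauchy's estimate.
  set T : ℝ := I₀ + 3 / κ + y + 2 with hT
  have hT1 : κ * T = κ * I₀ + 3 + κ * (y + 2) := by rw [hT]; field_simp; ring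
  have hT2 : 0 < κ * (y + 2) := by positivity
  have hT3 : 0 < 3 / κ := by positivity
  have hfl := Int.lt_floor_add_one σ
  obtain ⟨c, hc, hc'⟩ := exists_between hfl
  obtain ⟨R, F, hR, hsum, hdiff, hfar⟩ := h.exists_continuation (T := T) (c := c) (by linarith)
    (by linarith) hc hc'
  have hint' : ∀ m : Fin M, ∀ b : ℤ, s m = b → b ≤ 0 := by
    intro m b hb
    by_contra! hpos
    refine hint m b.toNat (by omega) ?_
    have : ((b.toNat : ℕ) : ℂ) = b := by
      rw [← Int.cast_natCast, Int.toNat_of_nonneg hpos.le]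
    rw [this, ← hb]
    exact mem_branchCut_self _ _
  obtain ⟨ρ, n₀, hρ, hn₀, hres⟩ := exists_residueSum_eq φ hlead hint'
  have hq := lineSingularities hκ0 hκ hω' hφ hsing hdisj hlead hrest
  have hI : (⟨0, by omega⟩ : Fin M) ∈ Finset.univ.filter fun m : Fin M => (m : ℕ) < N := by
    simpa using Nat.lt_of_lt_of_le one_pos hN
  refine ⟨R, F, hsum, hdiff, fun K => ?_⟩
  have hO := hq.isBigO_contourIntegral_sub h hρ (T := T)
    (fun m _ => by linarith [him m]) (fun m _ => by linarith [him' m])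
    (by have := mul_nonneg hκ0.le hI₀; linarith) (by linarith) (by linarith) hc hc' ⟨_, hI⟩ K
  have hO' : (fun z : ℂ => ∑ n ∈ Finset.range n₀, φ ((n + 1 : ℕ) : ℂ) * (-z) ^ (n + 1))
      =O[atInfSlit] fun z => ‖z‖ ^ σ *
        ∑ m ∈ Finset.univ.filter (fun m : Fin M => (m : ℕ) < N),
          ‖Complex.log z‖ ^ ((lam m).re - K - 1) := by
    refine (isBigO_sum_neg_pow (fun n => φ ((n + 1 : ℕ) : ℂ)) hn₀
      ((lam ⟨0, by omega⟩).re - K - 1)).trans ?_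
    exact isBigO_single_sum lam σ K hI
  -- The terms `ρ z^σ` from the residues and from the contour integral cancel here.
  refine (hO'.sub hO).congr' ?_ EventuallyEq.rfl
  filter_upwards [eventually_mem_slitPlane, tendsto_norm_atInfSlit.eventually_gt_atTop R]
    with z hz hzR
  rw [hfar z hz hzR, hres z (Complex.slitPlane_ne_zero hz)]
  ring
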